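/- Let $G$ be the group of self-homeomorphisms of the Cantor set $\mathfrak X$, topologized so that the subgroups $\bigcap_{i=1}^n\{g : g\mathfrak A_i=\mathfrak A_i\}$, with $\mathfrak A_1,\dots,\mathfrak A_n\subset\mathfrak X$ clopen, form a neighbourhood basis of the identity. A finitary $G$-set is a set with a $G$-action that has open stabilizers and finitely many orbits. For $n\ge 0$ let $Y(n)$ be the finitary $G$-set of all continuous maps $\mathfrak X\to\{1,\dots,n\}$, and let $X(n)\subset Y(n)$ be the subset of surjective maps. A measure for $G$ valued in a commutative ring $k$ is a rule $\mu$ that assigns to each map $f\colon X\to Y$ of finitary $G$-sets, with $Y$ transitive, an element $\mu(f)\in k$ such that: $\mu(f)=1$ if $f$ is an isomorphism; $\mu(f)=\mu(f|_{X_1})+\mu(f|_{X_2})$ if $X=X_1\amalg X_2$; $\mu(g\circ f)=\mu(g)\mu(f)$ if $g\colon Y\to Z$ is a map of transitive $G$-sets; and $\mu(f')=\mu(f)$ if $f'\colon X'\to Y'$ is the base change of $f$ along a map $Y'\to Y$ of transitive $G$-sets. Put $\mu(X)=\mu(X\to\mathbf 1)$. The measure is regular if $\mu(f)$ is a unit for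 every map $f$ of transitive $G$-sets. For a measure $\mu$ valued in $k$, let $\underline{\mathrm{Perm}}_k(G;\mu)$ be the $k$-linear symmetric monoidal category whose objects are formal symbols $\mathrm{Vec}_X$, with $X$ a finitary $G$-set, and whose morphisms $\mathrm{Vec}_X\to\mathrm{Vec}_Y$ are the $G$-invariant functions $Y\times X\to k$. Composition is matrix multiplication, $BA=(p_{13})_*(p_{23}^*B\cdot p_{12}^*A)$, where for $f\colon X\to Y$ the push-forward is the linear map with $f_*(1_W)=\mu(W\to f(W))\,1_{f(W)}$ for each orbit $W$ of $X$. The tensor product is $\mathrm{Vec}_X\otimes\mathrm{Vec}_Y=\mathrm{Vec}_{X\times Y}$ on objects and the Kronecker product on morphisms. Every object is self-dual, with evaluation and co-evaluation given by the indicator function of the diagonal, so every endomorphism has a categorical trace in $\mathrm{End}(\mathbf 1)=k$. There is a regular $\mathbf Q$-valued measure $\nu$ for $G$ such that $\nu(X(n))=(-1)^{n-1}$ for all $n\ge 1$. For this measure and for every field $k$ of characteristic $0$ (with $\nu$ regarded as valued in $k$) the following hold. (a) The object $\mathrm{Vec}_{Y(3)}$ of $\underline{\mathrm{Perm}}_k(G;\nu)$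 has a nilpotent endomorphism with non-zero trace. In particular, $\underline{\mathrm{Perm}}_k(G;\nu)$ has nilpotent endomorphisms with non-zero trace. (b) The Karoubi envelope of $\underline{\mathrm{Perm}}_k(G;\nu)$ is not semi-simple, i.e. it is not an abelian category in which every object is a finite direct sum of simple objects. (c) $\underline{\mathrm{Perm}}_k(G;\nu)$ does not embed into any pre-Tannakian category: there is no faithful $k$-linear symmetric monoidal functor from it to a $k$-linear abelian symmetric monoidal category with $k$-bilinear tensor product in which all objects have finite length, all $\mathrm{Hom}$ spaces are finite dimensional over $k$, all objects are rigid, and $\mathrm{End}(\mathbf 1)=k$. -/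

import Mathlib

open CategoryTheory MonoidalCategory

universe u v w

noncomputable section

namespace Oligo

/-- The topological group `G` is Roelcke pre-compact: there are finitely many
double cosets for any two open subgroups. -/
class RoelckePrecompact (G : Type) [Group G] [TopologicalSpace G] : Prop where
  exists_finset : ∀ U V : Subgroup G, IsOpen (U : Set G) → IsOpen (V : Set G) →
    ∃ F : Finset G, ∀ g : G, ∃ a ∈ F, ∃ u ∈ U, ∃ v ∈ V, g = u * a * v

/-- A finitary `G`-set: a set with a smooth action of `G` (all stabilizers are open)
that has finitely many orbits. -/
structure GSet (G : Type) [Group G] [TopologicalSpace G] where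
  carrier : Type
  [action : MulAction G carrier]
  smooth : ∀ x : carrier, IsOpen (MulAction.stabilizer G x : Set G)
  finitary : Finite (MulAction.orbitRel.Quotient G carrier)

variable {G : Type} [Group G] [TopologicalSpace G]

namespace GSet

instance : CoeSort (GSet G) Type := ⟨GSet.carrier⟩

instance (X : GSet G) : MulAction G X := X.action

/-- The set of orbits. -/
abbrev Orb (X : GSet G) : Type := MulAction.orbitRel.Quotient G X

/-- The orbit of a point. -/
abbrev orb (X : GSet G) (x : X) : X.Orb := Quotient.mk _ x

instance (X : GSet G) : Finite X.Orb := X.finitary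

instance (X : GSet G) : Fintype X.Orb := Fintype.ofFinite _

/-- A `G`-set is transitive if it consists of exactly one orbit. -/
def IsTransitive (X : GSet G) : Prop := Nonempty X ∧ MulAction.IsPretransitive G X

theorem orb_eq {X : GSet G} {x y : X} : X.orb x = X.orb y ↔ ∃ g : G, g • y = x := by
  rw [Quotient.eq, MulAction.orbitRel_apply, MulAction.mem_orbit_iff]

@[simp] theorem orb_smul {X : GSet G} (g : G) (x : X) : X.orb (g • x) = X.orb x :=
  orb_eq.2 ⟨g, rfl⟩

/-- The map on orbits induced by an equivariant map. -/
def orbMap {X Y : GSet G} (f : X →[G] Y) : X.Orb → Y.Orb :=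
  Quotient.map f (by
    intro a b h
    obtain ⟨g, rfl⟩ := h
    exact ⟨g, by simp⟩)

@[simp] theorem orbMap_orb {X Y : GSet G} (f : X →[G] Y) (x : X) :
    orbMap f (X.orb x) = Y.orb (f x) := rfl

@[simp] theorem orbMap_comp {X Y Z : GSet G} (g : Y →[G] Z) (f : X →[G] Y) (w : X.Orb) :
    orbMap (g.comp f) w = orbMap g (orbMap f w) := by
  induction w using Quotient.ind; rfl

@[simp] theorem orbMap_id {X : GSet G} (w : X.Orb) :
    orbMap (MulActionHom.id G : X →[G] X) w = w := by
  induction w using Quotient.ind; rfl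

/-- The `G`-subset of `X` that is the union of a given set of orbits. -/
def sub (X : GSet G) (T : Set X.Orb) : GSet G where
  carrier := {x : X // X.orb x ∈ T}
  action :=
    { smul := fun g x => ⟨g • x.1, by rw [orb_smul]; exact x.2⟩
      one_smul := fun x => Subtype.ext (one_smul G x.1)
      mul_smul := fun g h x => Subtype.ext (mul_smul g h x.1) }
  smooth := fun x => by
    convert X.smooth x.1 using 1
    ext g
    exact Subtype.ext_iff
  finitary := by
    refine Finite.of_injective (β := X.Orb)
      (Quotient.map' (s₂ := MulAction.orbitRel G X) (fun x => x.1) ?_) ?_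
    · rintro a b ⟨g, rfl⟩
      exact ⟨g, rfl⟩
    · intro a b
      induction a using Quotient.inductionOn'
      induction b using Quotient.inductionOn'
      intro h
      obtain ⟨g, hg⟩ := Quotient.eq'.1 h
      exact Quotient.eq'.2 ⟨g, Subtype.ext hg⟩

@[simp] theorem sub_smul_val {X : GSet G} {T : Set X.Orb} (g : G) (x : X.sub T) :
    (g • x).1 = g • x.1 := rfl

theorem sub_singleton_transitive (X : GSet G) (w : X.Orb) : (X.sub {w}).IsTransitive := by
  induction w using Quotient.inductionOn with | h x => ?_
  refine ⟨⟨⟨x, rfl⟩⟩, ⟨?_⟩⟩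
  rintro ⟨a, ha⟩ ⟨b, hb⟩
  obtain ⟨g, hg⟩ := orb_eq.1 (Eq.trans hb (Eq.symm ha) : X.orb b = X.orb a)
  exact ⟨g, Subtype.ext hg⟩

/-- The restriction of an equivariant map to unions of orbits. -/
def res {X Y : GSet G} (f : X →[G] Y) (T : Set X.Orb) (S : Set Y.Orb)
    (h : ∀ w ∈ T, orbMap f w ∈ S) : X.sub T →[G] Y.sub S where
  toFun x := ⟨f x.1, h _ x.2⟩
  map_smul' g x := Subtype.ext (f.map_smul g x.1)

@[simp] theorem res_val {X Y : GSet G} (f : X →[G] Y) (T : Set X.Orb) (S : Set Y.Orb)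
    (h : ∀ w ∈ T, orbMap f w ∈ S) (x : X.sub T) : (res f T S h x).1 = f x.1 := rfl

/-- The one-point `G`-set. -/
def one : GSet G where
  carrier := Unit
  action := { smul := fun _ x => x, one_smul := fun _ => rfl, mul_smul := fun _ _ _ => rfl }
  smooth := fun x => by
    convert isOpen_univ
    ext g
    simp [MulAction.mem_stabilizer_iff]
  finitary := inferInstanceAs (Finite (Quotient _))

/-- The product of two finitary `G`-sets, with the diagonal action. -/
def prod [RoelckePrecompact G] (X Y : GSet G) : GSet G where
  carrier := X × Y
  smooth := fun p => by
    convert (X.smooth p.1).inter (Y.smooth p.2) using 1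
    ext g
    simp [MulAction.mem_stabilizer_iff, Prod.ext_iff]
  finitary := by
    classical
    choose F hF using fun p : X.Orb × Y.Orb => RoelckePrecompact.exists_finset _ _
      (X.smooth p.1.out) (Y.smooth p.2.out)
    let ι : (Σ p : X.Orb × Y.Orb, F p) → MulAction.orbitRel.Quotient G (X × Y) :=
      fun s => Quotient.mk _ (s.1.1.out, s.2.1 • s.1.2.out)
    refine Finite.of_surjective ι ?_
    intro q
    induction q using Quotient.inductionOn with | h q => ?_
    obtain ⟨x, y⟩ := q
    obtain ⟨g, hg⟩ := orb_eq.1 (Quotient.out_eq (X.orb x)).symm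
    obtain ⟨h, hh⟩ := orb_eq.1 (Quotient.out_eq (Y.orb y)).symm
    obtain ⟨a, ha, u, hu, v, hv, e⟩ := hF (X.orb x, Y.orb y) (g⁻¹ * h)
    refine ⟨⟨(X.orb x, Y.orb y), ⟨a, ha⟩⟩, ?_⟩
    refine (Quotient.sound ?_ : (⟦_⟧ : MulAction.orbitRel.Quotient G (X × Y)) = ⟦_⟧)
    refine ⟨u⁻¹ * g⁻¹, Prod.ext ?_ ?_⟩
    · change (u⁻¹ * g⁻¹) • x = _
      rw [mul_smul, inv_smul_eq_iff, inv_smul_eq_iff, MulAction.mem_stabilizer_iff.1 hu, hg]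
    · change (u⁻¹ * g⁻¹) • y = a • _
      have hv' : v • (Y.orb y).out = (Y.orb y).out := hv
      have : (u⁻¹ * g⁻¹) • y = a • v • (Y.orb y).out := by
        conv_lhs => rw [← hh]
        rw [smul_smul, mul_assoc, e, smul_smul]
        congr 1
        group
      rw [this, hv']

end GSet

open GSet

/-- The square with `f ∘ p = g ∘ q` is cartesian, i.e. `q` is a base change of `f` along `g`. -/
structure IsCartesian {P X Y Z : GSet G} (p : P →[G] X) (q : P →[G] Y) (f : X →[G] Z)
    (g : Y →[G] Z) : Prop where
  comm : ∀ a, f (p a) = g (q a)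
  lift : ∀ x y, f x = g y → ∃! a, p a = x ∧ q a = y

/-- A measure for `G` valued in `k`: it is `1` on isomorphisms, additive with respect to
decompositions `X = X₁ ⨿ X₂` of the source, multiplicative in compositions of maps, and invariant
under base change. -/
structure Measure (G : Type) [Group G] [TopologicalSpace G] (k : Type w) [CommRing k] where
  /-- the value on a map of finitary `G`-sets with transitive target -/
  val : ∀ {X Y : GSet G} (_ : X →[G] Y), Y.IsTransitive → k
  iso : ∀ {X Y : GSet G} (f : X →[G] Y) (hY : Y.IsTransitive), Function.Bijective f → val f hY = 1
  add : ∀ {X₁ X₂ X Y : GSet G} (i₁ : X₁ →[G] X) (i₂ : X₂ →[G] X) (f : X →[G] Y)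
    (hY : Y.IsTransitive), Function.Injective i₁ → Function.Injective i₂ →
    IsCompl (Set.range i₁) (Set.range i₂) → val f hY = val (f.comp i₁) hY + val (f.comp i₂) hY
  comp : ∀ {X Y Z : GSet G} (f : X →[G] Y) (g : Y →[G] Z) (hY : Y.IsTransitive)
    (hZ : Z.IsTransitive), val (g.comp f) hZ = val g hZ * val f hY
  baseChange : ∀ {X X' Y Y' : GSet G} (p : X' →[G] X) (f' : X' →[G] Y') (f : X →[G] Y)
    (g : Y' →[G] Y) (hY : Y.IsTransitive) (hY' : Y'.IsTransitive),
    IsCartesian p f' f g → val f' hY' = val f hY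

namespace Measure

variable {k : Type w} [CommRing k] (μ : Measure G k)

/-- A measure is regular if it is a unit on all maps of transitive `G`-sets. -/
def IsRegular : Prop :=
  ∀ {X Y : GSet G} (f : X →[G] Y) (hY : Y.IsTransitive), X.IsTransitive → IsUnit (μ.val f hY)

/-- The measure of a finitary `G`-set. -/
def size (X : GSet G) : k :=
  μ.val (X := X) (Y := one) ⟨fun _ => (), fun _ _ => rfl⟩ ⟨⟨()⟩, ⟨fun _ _ => ⟨1, rfl⟩⟩⟩

/-- Extension of scalars for measures. -/
def map {k' : Type*} [CommRing k'] (φ : k →+* k') : Measure G k' where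
  val f hY := φ (μ.val f hY)
  iso f hY h := by rw [μ.iso f hY h, map_one]
  add i₁ i₂ f hY h₁ h₂ h := by rw [μ.add i₁ i₂ f hY h₁ h₂ h, map_add]
  comp f g hY hZ := by rw [μ.comp f g hY hZ, map_mul]
  baseChange p f' f g hY hY' h := by rw [μ.baseChange p f' f g hY hY' h]

/-- The measure of the map from the orbit `w` to its image. -/
def orbVal {X Y : GSet G} (f : X →[G] Y) (w : X.Orb) : k :=
  μ.val (res f {w} {orbMap f w} (by rintro _ rfl; rfl)) (sub_singleton_transitive _ _)

theorem orbVal_eq {X Y : GSet G} (f : X →[G] Y) (w : X.Orb) (v : Y.Orb) (h : orbMap f w = v) :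
    μ.val (res f {w} {v} (by rintro _ rfl; exact h)) (sub_singleton_transitive _ _)
      = μ.orbVal f w := by
  subst h; rfl

theorem orbVal_comp {X Y Z : GSet G} (f : X →[G] Y) (g : Y →[G] Z) (w : X.Orb) :
    μ.orbVal (g.comp f) w = μ.orbVal g (orbMap f w) * μ.orbVal f w := by
  rw [← μ.orbVal_eq (g.comp f) w (orbMap g (orbMap f w)) (orbMap_comp g f w)]
  exact μ.comp (res f {w} {orbMap f w} _) (res g {orbMap f w} {orbMap g (orbMap f w)} _) _ _

theorem orbVal_injective {X Y : GSet G} (f : X →[G] Y) (hf : Function.Injective f) (w : X.Orb) :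
    μ.orbVal f w = 1 := by
  refine μ.iso _ _ ⟨fun a b h => Subtype.ext (hf (congrArg Subtype.val h)), ?_⟩
  induction w using Quotient.inductionOn with | h x => ?_
  rintro ⟨y, hy⟩
  obtain ⟨g, hg⟩ := orb_eq.1 (show Y.orb y = Y.orb (f x) from hy)
  exact ⟨⟨g • x, orb_smul g x⟩, Subtype.ext ((f.map_smul g x).trans hg)⟩

theorem val_sub_finset {X Y : GSet G} (f : X →[G] Y) (v : Y.Orb) (T : Finset X.Orb)
    (h : ∀ w ∈ T, orbMap f w = v) :
    μ.val (res f (T : Set X.Orb) {v} h) (sub_singleton_transitive _ _)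
      = ∑ w ∈ T, μ.orbVal f w := by
  classical
  induction T using Finset.induction_on with
  | empty =>
    have e : ∀ x : X.sub ((∅ : Finset X.Orb) : Set X.Orb), False := fun x => by simpa using x.2
    have := μ.add (MulActionHom.id G) (MulActionHom.id G)
      (res f ((∅ : Finset X.Orb) : Set X.Orb) {v} h) (sub_singleton_transitive _ _)
      (fun x => (e x).elim) (fun x => (e x).elim)
      ⟨Set.disjoint_left.2 fun x => (e x).elim,
        codisjoint_iff_le_sup.2 fun x => (e x).elim⟩
    rw [Finset.sum_empty]
    exact left_eq_add.1 this
  | insert w T hw ih =>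
    rw [Finset.sum_insert hw, ← ih (fun a ha => h a (Finset.mem_insert_of_mem ha)),
      ← μ.orbVal_eq f w v (h w (Finset.mem_insert_self _ _))]
    refine μ.add (res (MulActionHom.id G) {w} ((insert w T : Finset X.Orb) : Set X.Orb) ?_)
      (res (MulActionHom.id G) (T : Set X.Orb) ((insert w T : Finset X.Orb) : Set X.Orb) ?_)
      (res f ((insert w T : Finset X.Orb) : Set X.Orb) {v} h) (sub_singleton_transitive _ _)
      ?_ ?_ ⟨?_, ?_⟩
    · rintro _ rfl; simp
    · intro a ha; simpa using Or.inr ha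
    · exact fun a b h => Subtype.ext (congrArg (fun z => z.1) h :)
    · exact fun a b h => Subtype.ext (congrArg (fun z => z.1) h :)
    · refine Set.disjoint_left.2 ?_
      rintro _ ⟨a, rfl⟩ ⟨b, hb⟩
      have h1 : b.1 = a.1 := congrArg Subtype.val hb
      have h2 : X.orb a.1 = w := a.2
      have h3 : X.orb b.1 ∈ T := b.2
      rw [h1, h2] at h3
      exact hw h3
    · refine codisjoint_iff_le_sup.2 ?_
      rintro ⟨x, hx⟩ -
      rcases Finset.mem_insert.1 hx with hx' | hx'
      · exact Or.inl ⟨⟨x, hx'⟩, rfl⟩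
      · exact Or.inr ⟨⟨x, hx'⟩, rfl⟩

open Classical in
theorem orbVal_baseChange {P X Y Z : GSet G} {p : P →[G] X} {q : P →[G] Y} {f : X →[G] Z}
    {g : Y →[G] Z} (h : IsCartesian p q f g) (w : X.Orb) (v : Y.Orb)
    (hwv : orbMap f w = orbMap g v) :
    ∑ u with orbMap p u = w ∧ orbMap q u = v, μ.orbVal q u = μ.orbVal f w := by
  rw [← μ.val_sub_finset q v _ (by simp), ← μ.orbVal_eq f w _ hwv]
  refine μ.baseChange (res p _ {w} (by simp; tauto)) _ _
    (res g {v} {orbMap g v} (by rintro _ rfl; rfl)) _ _ ⟨?_, ?_⟩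
  · exact fun a => Subtype.ext (h.comm a.1)
  · rintro ⟨x, hx⟩ ⟨y, hy⟩ e
    obtain ⟨a, ⟨ha, ha'⟩, hu⟩ := h.lift x y (congrArg Subtype.val e)
    subst ha ha'
    refine ⟨⟨a, by simpa using ⟨hx, hy⟩⟩, ⟨rfl, rfl⟩, ?_⟩
    rintro ⟨b, hb⟩ ⟨h1, h2⟩
    exact Subtype.ext (hu b ⟨congrArg Subtype.val h1, congrArg Subtype.val h2⟩)

end Measure

/-- The `k`-module of `G`-invariant functions on `X`. An invariant function is the same thing as a
function on the set of orbits, and is represented as such. -/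
abbrev Fn (k : Type w) (X : GSet G) : Type w := X.Orb → k

section Push

variable {k : Type w} [CommRing k] (μ : Measure G k)

/-- Pull-back of invariant functions. -/
def pull {X Y : GSet G} (f : X →[G] Y) (φ : Fn k Y) : Fn k X := fun w => φ (orbMap f w)

open Classical in
/-- Push-forward of invariant functions: the linear map with
`1_W ↦ μ (W → f W) • 1_{f W}` for every orbit `W`. -/
def push {X Y : GSet G} (f : X →[G] Y) (φ : Fn k X) : Fn k Y :=
  ∑ w : X.Orb, Pi.single (orbMap f w) (μ.orbVal f w * φ w)

open Classical in
theorem push_apply {X Y : GSet G} (f : X →[G] Y) (φ : Fn k X) (v : Y.Orb) :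
    push μ f φ v = ∑ w with orbMap f w = v, μ.orbVal f w * φ w := by
  simp [push, Finset.sum_apply, Pi.single_apply, Finset.sum_filter, eq_comm]

theorem push_comp {X Y Z : GSet G} (f : X →[G] Y) (g : Y →[G] Z) (φ : Fn k X) :
    push μ g (push μ f φ) = push μ (g.comp f) φ := by
  classical
  ext z
  simp only [push_apply, Finset.mul_sum, μ.orbVal_comp, orbMap_comp]
  rw [Finset.sum_sigma']
  refine Finset.sum_bij' (fun s _ => s.2) (fun w _ => ⟨orbMap f w, w⟩) ?_ ?_ ?_ ?_ ?_
  · rintro ⟨v, w⟩ h; simp at h ⊢; rw [h.2, h.1]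
  · intro w h; simpa using h
  · rintro ⟨v, w⟩ h; simp at h; obtain ⟨_, rfl⟩ := h; rfl
  · intro w h; rfl
  · rintro ⟨v, w⟩ h; simp at h; obtain ⟨_, rfl⟩ := h; ring

theorem pull_push {P X Y Z : GSet G} {p : P →[G] X} {q : P →[G] Y} {f : X →[G] Z}
    {g : Y →[G] Z} (h : IsCartesian p q f g) (φ : Fn k X) :
    pull g (push μ f φ) = push μ q (pull p φ) := by
  classical
  ext v
  simp only [pull, push_apply]
  have key : ∀ w ∈ Finset.univ.filter (fun w => orbMap f w = orbMap g v),
      μ.orbVal f w * φ w = ∑ u with orbMap p u = w ∧ orbMap q u = v,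
        μ.orbVal q u * φ (orbMap p u) := by
    intro w hw
    rw [← μ.orbVal_baseChange h w v (by simpa using hw), Finset.sum_mul]
    refine Finset.sum_congr rfl fun u hu => ?_
    simp at hu
    rw [hu.1]
  rw [Finset.sum_congr rfl key, Finset.sum_sigma']
  have hc : ∀ u, orbMap f (orbMap p u) = orbMap g (orbMap q u) := by
    intro u
    induction u using Quotient.inductionOn with | h u => ?_
    exact congrArg Z.orb (h.comm u)
  refine Finset.sum_bij' (fun s _ => s.2) (fun u _ => ⟨orbMap p u, u⟩) ?_ ?_ ?_ ?_ ?_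
  · rintro ⟨w, u⟩ h; simp at h ⊢; exact h.2.2
  · intro u h; simp at h ⊢; exact ⟨by rw [hc, h], h⟩
  · rintro ⟨w, u⟩ h; simp at h; obtain ⟨_, rfl, _⟩ := h; rfl
  · intro w h; rfl
  · rintro ⟨w, u⟩ h; rfl

theorem push_mul_pull {X Y : GSet G} (f : X →[G] Y) (φ : Fn k X) (ψ : Fn k Y) :
    push μ f (φ * pull f ψ) = push μ f φ * ψ := by
  classical
  ext v
  simp only [Pi.mul_apply, push_apply, Finset.sum_mul, pull]
  refine Finset.sum_congr rfl fun w hw => ?_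
  simp at hw
  rw [hw, mul_assoc]

theorem push_pull_mul {X Y : GSet G} (f : X →[G] Y) (φ : Fn k X) (ψ : Fn k Y) :
    push μ f (pull f ψ * φ) = ψ * push μ f φ := by
  rw [mul_comm, push_mul_pull, mul_comm]

theorem pull_comp {X Y Z : GSet G} (f : X →[G] Y) (g : Y →[G] Z) (φ : Fn k Z) :
    pull f (pull g φ) = pull (g.comp f) φ := by
  ext w; simp [pull]

theorem pull_mul {X Y : GSet G} (f : X →[G] Y) (φ ψ : Fn k Y) :
    pull f (φ * ψ) = pull f φ * pull f ψ := rfl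

@[simp] theorem pull_one {X Y : GSet G} (f : X →[G] Y) : pull f (1 : Fn k Y) = 1 := rfl

theorem pull_id {X : GSet G} (φ : Fn k X) : pull (MulActionHom.id G) φ = φ := by
  ext w; simp [pull]

theorem push_id {X : GSet G} (φ : Fn k X) : push μ (MulActionHom.id G) φ = φ := by
  classical
  ext w
  simp only [push_apply, orbMap_id, μ.orbVal_injective (MulActionHom.id G : X →[G] X) (fun _ _ h => h), one_mul]
  rw [Finset.sum_filter]; simp

theorem push_add {X Y : GSet G} (f : X →[G] Y) (φ ψ : Fn k X) :
    push μ f (φ + ψ) = push μ f φ + push μ f ψ := by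
  classical
  ext v; simp [push_apply, mul_add, Finset.sum_add_distrib]

theorem push_smul {X Y : GSet G} (f : X →[G] Y) (c : k) (φ : Fn k X) :
    push μ f (c • φ) = c • push μ f φ := by
  classical
  ext v; simp only [push_apply, Pi.smul_apply, smul_eq_mul, Finset.mul_sum]
  exact Finset.sum_congr rfl fun w _ => by ring

end Push

section Matrices

variable [RoelckePrecompact G] {k : Type w} [CommRing k] (μ : Measure G k)

namespace GSet

/-- The map to a product with given components. -/
def pair {W X Y : GSet G} (f : W →[G] X) (g : W →[G] Y) : W →[G] X.prod Y where
  toFun w := (f w, g w)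
  map_smul' a w := Prod.ext (f.map_smul a w) (g.map_smul a w)

/-- The first projection. -/
def fst {X Y : GSet G} : X.prod Y →[G] X where
  toFun p := p.1
  map_smul' _ _ := rfl

/-- The second projection. -/
def snd {X Y : GSet G} : X.prod Y →[G] Y where
  toFun p := p.2
  map_smul' _ _ := rfl

/-- The identity map. -/
def idt (X : GSet G) : X →[G] X := MulActionHom.id G

/-- The map to the one-point `G`-set. -/
def pt (X : GSet G) : X →[G] (one : GSet G) where
  toFun _ := ()
  map_smul' _ _ := rfl

/-- The product of two maps. -/
def prodMap {X X' Y Y' : GSet G} (f : X →[G] Y) (f' : X' →[G] Y') :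
    X.prod X' →[G] Y.prod Y' :=
  pair (f.comp fst) (f'.comp snd)

end GSet

theorem push_mul_push {T T₁ T₂ X : GSet G} {r : T →[G] T₁} {s : T →[G] T₂} {q₁ : T₁ →[G] X}
    {q₂ : T₂ →[G] X} (h : IsCartesian r s q₁ q₂) (φ : Fn k T₁) (ψ : Fn k T₂) :
    push μ q₁ φ * push μ q₂ ψ = push μ (q₁.comp r) (pull r φ * pull s ψ) := by
  have h' : IsCartesian s r q₂ q₁ := ⟨fun a => (h.comm a).symm, fun x y e => by
    obtain ⟨a, ha, hu⟩ := h.lift y x e.symm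
    exact ⟨a, ha.symm, fun b hb => hu b hb.symm⟩⟩
  rw [← push_mul_pull, pull_push μ h', ← push_comp, mul_comm (pull r φ), push_mul_pull, mul_comm]

/-- A `(Y × X)`-matrix: an invariant function on `Y × X`. -/
abbrev Mat (k : Type w) (Y X : GSet G) : Type w := Fn k (Y.prod X)

/-- The product `BA` of matrices:
the push-forward of `(z, y, x) ↦ B (z, y) * A (y, x)` along `(z, y, x) ↦ (z, x)`. -/
def mul {X Y Z : GSet G} (B : Mat k Z Y) (A : Mat k Y X) : Mat k Z X :=
  push μ (pair fst (snd.comp snd) : Z.prod (Y.prod X) →[G] Z.prod X)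
    (pull (pair fst (fst.comp snd)) B * pull snd A)

/-- The Kronecker product `(y, y', x, x') ↦ A (y, x) * A' (y', x')` of matrices. -/
def kron {X X' Y Y' : GSet G} (A : Mat k Y X) (A' : Mat k Y' X') :
    Mat k (Y.prod Y') (X.prod X') :=
  pull (pair (fst.comp fst) (fst.comp snd)) A * pull (pair (snd.comp fst) (snd.comp snd)) A'

open Classical in
/-- The indicator function of the image of an equivariant map. -/
def ind (k : Type w) [CommRing k] {X Y : GSet G} (i : X →[G] Y) : Fn k Y :=
  fun w => if w ∈ Set.range (orbMap i) then 1 else 0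

theorem push_one_of_injective {X Y : GSet G} (i : X →[G] Y) (hi : Function.Injective i) :
    push μ i 1 = ind k i := by
  classical
  have hinj : Function.Injective (orbMap i) := by
    intro a b
    induction a using Quotient.inductionOn with | h a => ?_
    induction b using Quotient.inductionOn with | h b => ?_
    intro h
    obtain ⟨g, hg⟩ := orb_eq.1 (show Y.orb (i a) = Y.orb (i b) from h)
    rw [← i.map_smul] at hg
    exact orb_eq.2 ⟨g, hi hg⟩
  ext v
  rw [push_apply, ind]
  simp only [μ.orbVal_injective i hi, Pi.one_apply, mul_one]
  split_ifs with h
  · obtain ⟨w, rfl⟩ := h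
    rw [Finset.sum_filter]
    simp [hinj.eq_iff]
  · refine Finset.sum_eq_zero fun w hw => ?_
    exact absurd ⟨w, by simpa using hw⟩ h

/-- The matrix of an equivariant map: the indicator function of `{(f x, x)}`. -/
def graph (k : Type w) [CommRing k] {X Y : GSet G} (f : X →[G] Y) : Mat k Y X :=
  ind k (pair f (idt X))

theorem graph_eq_push {X Y : GSet G} (f : X →[G] Y) :
    graph k f = push μ (pair f (idt X)) 1 :=
  (push_one_of_injective μ _ fun _ _ h => congrArg Prod.snd h).symm

theorem mul_span {S X Y Z : GSet G} (a : S →[G] X) (b : S →[G] Y) (B : Mat k Z Y) :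
    mul μ B (push μ (pair b a) 1) =
      push μ (pair fst (a.comp snd) : Z.prod S →[G] Z.prod X)
        (pull (pair fst (b.comp snd)) B) := by
  have h : IsCartesian (snd : Z.prod S →[G] S)
      (pair fst (pair (b.comp snd) (a.comp snd)) : Z.prod S →[G] Z.prod (Y.prod X))
      (pair b a) snd := by
    refine ⟨fun _ => rfl, ?_⟩
    rintro s ⟨z, y, x⟩ e
    obtain ⟨rfl, rfl⟩ := Prod.ext_iff.1 e
    refine ⟨(z, s), ⟨rfl, rfl⟩, ?_⟩
    rintro ⟨z', s'⟩ ⟨rfl, h2⟩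
    exact Prod.ext (congrArg Prod.fst h2 :) rfl
  rw [mul, pull_push μ h, pull_one, ← push_pull_mul, mul_one, push_comp, pull_comp]
  rfl

theorem span_mul {S X Y Z : GSet G} (b : S →[G] Y) (c : S →[G] Z) (A : Mat k Y X) :
    mul μ (push μ (pair c b) 1) A =
      push μ (pair (c.comp fst) snd : S.prod X →[G] Z.prod X)
        (pull (pair (b.comp fst) snd) A) := by
  have h : IsCartesian (fst : S.prod X →[G] S)
      (pair (c.comp fst) (pair (b.comp fst) snd) : S.prod X →[G] Z.prod (Y.prod X))
      (pair c b) (pair fst (fst.comp snd)) := by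
    refine ⟨fun _ => rfl, ?_⟩
    rintro s ⟨z, y, x⟩ e
    obtain ⟨rfl, rfl⟩ := Prod.ext_iff.1 e
    refine ⟨(s, x), ⟨rfl, rfl⟩, ?_⟩
    rintro ⟨s', x'⟩ ⟨rfl, h2⟩
    exact Prod.ext rfl (congrArg (fun t => t.2.2) h2 :)
  rw [mul, pull_push μ h, pull_one, ← push_mul_pull, one_mul, push_comp, pull_comp]
  rfl

theorem push_bij {X Y : GSet G} (e : X →[G] Y) (e' : Y →[G] X) (h : ∀ x, e' (e x) = x)
    (h' : ∀ y, e (e' y) = y) (φ : Fn k X) : push μ e φ = pull e' φ := by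
  have hc : IsCartesian e' (idt Y) e (idt Y) := by
    refine ⟨fun y => h' y, ?_⟩
    rintro x y rfl
    exact ⟨e x, ⟨h x, rfl⟩, fun b hb => hb.2⟩
  have := pull_push μ hc φ
  rw [idt, pull_id, push_id] at this
  exact this

theorem push_one_reindex {X Y Z : GSet G} (i : X →[G] Y) (e : Z →[G] X) (e' : X →[G] Z)
    (h : ∀ z, e' (e z) = z) (h' : ∀ x, e (e' x) = x) :
    push μ i (1 : Fn k X) = push μ (i.comp e) 1 := by
  rw [← push_comp, push_bij μ e e' h h', pull_one]

theorem mul_graph {X Y Z : GSet G} (f : X →[G] Y) (B : Mat k Z Y) :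
    mul μ B (graph k f) = pull (pair fst (f.comp snd)) B := by
  rw [graph_eq_push μ, mul_span]
  exact push_id μ _

theorem graph_mul {X Y Z : GSet G} (f : Y →[G] Z) (f' : Z →[G] Y) (h : ∀ y, f' (f y) = y)
    (h' : ∀ z, f (f' z) = z) (A : Mat k Y X) :
    mul μ (graph k f) A = pull (pair (f'.comp fst) snd) A := by
  rw [graph_eq_push μ, span_mul]
  have e : (pair ((idt Y).comp fst) snd : Y.prod X →[G] Y.prod X) = MulActionHom.id G := rfl
  rw [e, pull_id]
  refine push_bij μ (pair (f.comp fst) snd : Y.prod X →[G] Z.prod X)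
    (pair (f'.comp fst) snd) ?_ ?_ _
  · rintro ⟨y, x⟩
    exact Prod.ext (h y) rfl
  · rintro ⟨z, x⟩
    exact Prod.ext (h' z) rfl

theorem span_mul_span {P S T X Y Z : GSet G} {a : S →[G] X} {b : S →[G] Y} {b' : T →[G] Y}
    {c : T →[G] Z} {p : P →[G] S} {q : P →[G] T} (h : IsCartesian p q b b') :
    mul μ (push μ (pair c b') 1) (push μ (pair b a) 1) =
      push μ (pair (c.comp q) (a.comp p)) (1 : Fn k P) := by
  have h2 : IsCartesian q (pair (c.comp q) p) (pair c b')
      (pair fst (b.comp snd) : Z.prod S →[G] Z.prod Y) := by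
    refine ⟨fun x => Prod.ext rfl (h.comm x).symm, ?_⟩
    rintro t ⟨z, s⟩ e
    obtain ⟨rfl, e2⟩ := Prod.ext_iff.1 e
    obtain ⟨x, ⟨rfl, rfl⟩, hu⟩ := h.lift s t e2.symm
    exact ⟨x, ⟨rfl, rfl⟩, fun y hy => hu y ⟨(congrArg Prod.snd hy.2 :), hy.1⟩⟩
  rw [mul_span, pull_push μ h2, pull_one, push_comp]
  rfl

theorem graph_mul_graph {X Y Z : GSet G} (f : X →[G] Y) (g : Y →[G] Z) :
    mul μ (graph k g) (graph k f) = graph k (g.comp f) := by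
  rw [graph_eq_push μ, graph_eq_push μ, graph_eq_push μ,
    span_mul_span μ (p := idt X) (q := f) ⟨fun _ => rfl, ?_⟩]
  · rfl
  · rintro x _ rfl
    exact ⟨x, ⟨rfl, rfl⟩, fun b hb => hb.1⟩

theorem mul_one_mat {X Y : GSet G} (A : Mat k Y X) : mul μ A (graph k (idt X)) = A := by
  rw [mul_graph]; exact pull_id A

theorem one_mul_mat {X Y : GSet G} (A : Mat k Y X) : mul μ (graph k (idt Y)) A = A := by
  rw [graph_mul μ _ (idt Y) (fun _ => rfl) (fun _ => rfl)]; exact pull_id A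

theorem mul_assoc_mat {W X Y Z : GSet G} (C : Mat k W Z) (B : Mat k Z Y) (A : Mat k Y X) :
    mul μ C (mul μ B A) = mul μ (mul μ C B) A := by
  have h1 : IsCartesian (snd : W.prod (Z.prod (Y.prod X)) →[G] Z.prod (Y.prod X))
      (pair fst (pair (fst.comp snd) (snd.comp (snd.comp snd))) :
        W.prod (Z.prod (Y.prod X)) →[G] W.prod (Z.prod X))
      (pair fst (snd.comp snd)) snd := by
    refine ⟨fun _ => rfl, ?_⟩
    rintro ⟨z, y, x⟩ ⟨w, z', x'⟩ e
    obtain ⟨rfl, rfl⟩ := Prod.ext_iff.1 e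
    refine ⟨(w, z, y, x), ⟨rfl, rfl⟩, ?_⟩
    rintro ⟨w1, t⟩ ⟨h1, h2⟩
    exact Prod.ext (congrArg Prod.fst h2 :) h1
  have h2 : IsCartesian (pair fst (pair (fst.comp snd) (fst.comp (snd.comp snd))) :
        W.prod (Z.prod (Y.prod X)) →[G] W.prod (Z.prod Y))
      (pair fst (snd.comp snd) : W.prod (Z.prod (Y.prod X)) →[G] W.prod (Y.prod X))
      (pair fst (snd.comp snd)) (pair fst (fst.comp snd)) := by
    refine ⟨fun _ => rfl, ?_⟩
    rintro ⟨w, z, y⟩ ⟨w', y', x⟩ e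
    obtain ⟨rfl, rfl⟩ := Prod.ext_iff.1 e
    refine ⟨(w, z, y, x), ⟨rfl, rfl⟩, ?_⟩
    rintro ⟨w1, z1, t⟩ ⟨h1, h2⟩
    exact Prod.ext (congrArg Prod.fst h2 :)
      (Prod.ext (congrArg (fun s => s.2.1) h1 :) (congrArg Prod.snd h2 :))
  simp only [mul]
  rw [pull_push μ h1, pull_push μ h2, ← push_pull_mul, ← push_mul_pull, push_comp, push_comp]
  simp only [pull_mul, pull_comp, mul_assoc]
  rfl

theorem kron_span {S S' X X' Y Y' : GSet G} (a : S →[G] X) (b : S →[G] Y) (a' : S' →[G] X')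
    (b' : S' →[G] Y') :
    kron (push μ (pair b a) 1) (push μ (pair b' a') (1 : Fn k S')) =
      push μ (pair (prodMap b b') (prodMap a a')) 1 := by
  have h1 : IsCartesian (fst : S.prod (Y'.prod X') →[G] S)
      (pair (pair (b.comp fst) (fst.comp snd)) (pair (a.comp fst) (snd.comp snd)) :
        S.prod (Y'.prod X') →[G] (Y.prod Y').prod (X.prod X'))
      (pair b a) (pair (fst.comp fst) (fst.comp snd)) := by
    refine ⟨fun _ => rfl, ?_⟩
    rintro s ⟨⟨y, y'⟩, x, x'⟩ e
    obtain ⟨rfl, rfl⟩ := Prod.ext_iff.1 e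
    refine ⟨(s, y', x'), ⟨rfl, rfl⟩, ?_⟩
    rintro ⟨s1, t⟩ ⟨h1, h2⟩
    exact Prod.ext h1 (Prod.ext (congrArg (fun u => u.1.2) h2 :) (congrArg (fun u => u.2.2) h2 :))
  have h2 : IsCartesian (fst : S'.prod (Y.prod X) →[G] S')
      (pair (pair (fst.comp snd) (b'.comp fst)) (pair (snd.comp snd) (a'.comp fst)) :
        S'.prod (Y.prod X) →[G] (Y.prod Y').prod (X.prod X'))
      (pair b' a') (pair (snd.comp fst) (snd.comp snd)) := by
    refine ⟨fun _ => rfl, ?_⟩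
    rintro s ⟨⟨y, y'⟩, x, x'⟩ e
    obtain ⟨rfl, rfl⟩ := Prod.ext_iff.1 e
    refine ⟨(s, y, x), ⟨rfl, rfl⟩, ?_⟩
    rintro ⟨s1, t⟩ ⟨h1, h2⟩
    exact Prod.ext h1 (Prod.ext (congrArg (fun u => u.1.1) h2 :) (congrArg (fun u => u.2.1) h2 :))
  have h3 : IsCartesian
      (pair fst (pair (b'.comp snd) (a'.comp snd)) : S.prod S' →[G] S.prod (Y'.prod X'))
      (pair snd (pair (b.comp fst) (a.comp fst)) : S.prod S' →[G] S'.prod (Y.prod X))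
      (pair (pair (b.comp fst) (fst.comp snd)) (pair (a.comp fst) (snd.comp snd)))
      (pair (pair (fst.comp snd) (b'.comp fst)) (pair (snd.comp snd) (a'.comp fst))) := by
    refine ⟨fun _ => rfl, ?_⟩
    rintro ⟨s, y', x'⟩ ⟨s', y, x⟩ e
    obtain ⟨e1, e2⟩ := Prod.ext_iff.1 e
    have e11 : b s = y := (congrArg Prod.fst e1 :)
    have e12 : y' = b' s' := (congrArg Prod.snd e1 :)
    have e21 : a s = x := (congrArg Prod.fst e2 :)
    have e22 : x' = a' s' := (congrArg Prod.snd e2 :)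
    subst e11 e12 e21 e22
    exact ⟨(s, s'), ⟨rfl, rfl⟩, fun t ht =>
      Prod.ext (congrArg Prod.fst ht.1 :) (congrArg Prod.fst ht.2 :)⟩
  rw [kron, pull_push μ h1, pull_push μ h2, push_mul_push μ h3]
  simp only [pull_one, mul_one]
  rfl

theorem kron_mul {X Y Z X' Y' Z' : GSet G} (B : Mat k Z Y) (A : Mat k Y X) (B' : Mat k Z' Y')
    (A' : Mat k Y' X') :
    kron (mul μ B A) (mul μ B' A') = mul μ (kron B B') (kron A A') := by
  have h1 : IsCartesian
      (pair (fst.comp fst) (pair (fst.comp snd) (fst.comp (snd.comp snd))) :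
        (Z.prod Z').prod (Y.prod (X.prod X')) →[G] Z.prod (Y.prod X))
      (pair fst (snd.comp snd) :
        (Z.prod Z').prod (Y.prod (X.prod X')) →[G] (Z.prod Z').prod (X.prod X'))
      (pair fst (snd.comp snd)) (pair (fst.comp fst) (fst.comp snd)) := by
    refine ⟨fun _ => rfl, ?_⟩
    rintro ⟨z, y, x⟩ ⟨⟨z1, z'⟩, x1, x'⟩ e
    obtain ⟨rfl, rfl⟩ := Prod.ext_iff.1 e
    refine ⟨((z, z'), y, x, x'), ⟨rfl, rfl⟩, ?_⟩
    rintro ⟨t1, t2, t3⟩ ⟨h1, h2⟩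
    exact Prod.ext (congrArg Prod.fst h2 :)
      (Prod.ext (congrArg (fun u => u.2.1) h1 :) (congrArg Prod.snd h2 :))
  have h2 : IsCartesian
      (pair (snd.comp fst) (pair (fst.comp snd) (snd.comp (snd.comp snd))) :
        (Z.prod Z').prod (Y'.prod (X.prod X')) →[G] Z'.prod (Y'.prod X'))
      (pair fst (snd.comp snd) :
        (Z.prod Z').prod (Y'.prod (X.prod X')) →[G] (Z.prod Z').prod (X.prod X'))
      (pair fst (snd.comp snd)) (pair (snd.comp fst) (snd.comp snd)) := by
    refine ⟨fun _ => rfl, ?_⟩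
    rintro ⟨z', y', x'⟩ ⟨⟨z, z1⟩, x, x1⟩ e
    obtain ⟨rfl, rfl⟩ := Prod.ext_iff.1 e
    refine ⟨((z, z'), y', x, x'), ⟨rfl, rfl⟩, ?_⟩
    rintro ⟨t1, t2, t3⟩ ⟨h1, h2⟩
    exact Prod.ext (congrArg Prod.fst h2 :)
      (Prod.ext (congrArg (fun u => u.2.1) h1 :) (congrArg Prod.snd h2 :))
  have h3 : IsCartesian
      (pair fst (pair (fst.comp (fst.comp snd)) (snd.comp snd)) :
        (Z.prod Z').prod ((Y.prod Y').prod (X.prod X')) →[G]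
          (Z.prod Z').prod (Y.prod (X.prod X')))
      (pair fst (pair (snd.comp (fst.comp snd)) (snd.comp snd)) :
        (Z.prod Z').prod ((Y.prod Y').prod (X.prod X')) →[G]
          (Z.prod Z').prod (Y'.prod (X.prod X')))
      (pair fst (snd.comp snd)) (pair fst (snd.comp snd)) := by
    refine ⟨fun _ => rfl, ?_⟩
    rintro ⟨z, y, x⟩ ⟨z', y', x'⟩ e
    obtain ⟨rfl, rfl⟩ := Prod.ext_iff.1 e
    refine ⟨(z, (y, y'), x), ⟨rfl, rfl⟩, ?_⟩
    rintro ⟨t1, ⟨t2, t3⟩, t4⟩ ⟨h1, h2⟩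
    exact Prod.ext (congrArg Prod.fst h2 :)
      (Prod.ext (Prod.ext (congrArg (fun u => u.2.1) h1 :) (congrArg (fun u => u.2.1) h2 :))
        (congrArg (fun u => u.2.2) h2 :))
  rw [kron, mul, mul, pull_push μ h1, pull_push μ h2, push_mul_push μ h3, mul]
  simp only [pull_mul, pull_comp, kron]
  rw [mul_mul_mul_comm]
  rfl

theorem kron_graph (μ : Measure G k) {X X' Y Y' : GSet G} (f : X →[G] Y) (f' : X' →[G] Y') :
    kron (graph k f) (graph k f') = graph k (prodMap f f') := by
  rw [graph_eq_push μ, graph_eq_push μ, graph_eq_push μ, kron_span]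
  rfl

end Matrices

section Category

variable {k : Type w} [CommRing k]

/-- The category of permutation modules; its objects are formal symbols `Vec_X` for finitary
`G`-sets `X`. -/
structure Perm (μ : Measure G k) : Type 1 where
  /-- the object `Vec_X` -/
  vec ::
  /-- the underlying finitary `G`-set -/
  set : GSet G

namespace Perm

variable [RoelckePrecompact G] {μ : Measure G k}

/-- Morphisms `Vec_X ⟶ Vec_Y` are `(Y × X)`-matrices, composed by matrix multiplication. -/
instance : Category.{w} (Perm μ) where
  Hom V W := Mat k W.set V.set
  id V := graph k (idt V.set)
  comp A B := mul μ B A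
  id_comp A := mul_one_mat μ A
  comp_id A := one_mul_mat μ A
  assoc A B C := mul_assoc_mat μ C B A

theorem comp_def {U V W : Perm μ} (A : U ⟶ V) (B : V ⟶ W) :
    A ≫ B = mul μ (Z := W.set) (Y := V.set) (X := U.set) B A := rfl

instance : Preadditive (Perm μ) where
  homGroup V W := inferInstanceAs (AddCommGroup (Mat k W.set V.set))
  add_comp U V W A A' B := by
    change mul μ B (_ + _) = mul μ B _ + mul μ B _
    rw [mul, mul, mul, ← push_add, ← mul_add]; rfl
  comp_add U V W A B B' := by
    change mul μ (_ + _) A = mul μ _ A + mul μ _ A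
    rw [mul, mul, mul, ← push_add, ← add_mul]; rfl

instance : Linear k (Perm μ) where
  homModule V W := inferInstanceAs (Module k (Mat k W.set V.set))
  smul_comp U V W c A B := by
    change mul μ B (c • _) = c • mul μ B _
    rw [mul, mul, ← push_smul, ← mul_smul_comm]; rfl
  comp_smul U V W A c B := by
    change mul μ (c • _) A = c • mul μ _ A
    rw [mul, mul, ← push_smul, ← smul_mul_assoc]; rfl

/-- The isomorphism of permutation modules given by an isomorphism of `G`-sets. -/
def isoOfEquiv {X Y : GSet G} (f : X →[G] Y) (f' : Y →[G] X) (h : ∀ x, f' (f x) = x)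
    (h' : ∀ y, f (f' y) = y) : (vec X : Perm μ) ≅ vec Y where
  hom := graph k f
  inv := graph k f'
  hom_inv_id := by
    refine (graph_mul_graph μ f f').trans (congrArg (graph k) ?_)
    ext x; exact h x
  inv_hom_id := by
    refine (graph_mul_graph μ f' f).trans (congrArg (graph k) ?_)
    ext x; exact h' x

/-- The tensor product is the product of `G`-sets on objects and the Kronecker product
on morphisms; the unit object is given by the one-point `G`-set. -/
instance : MonoidalCategoryStruct (Perm μ) where
  tensorObj V W := vec (V.set.prod W.set)
  tensorHom A B := kron A B
  whiskerLeft V _ _ B := kron (graph k (idt V.set)) B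
  whiskerRight A W := kron A (graph k (idt W.set))
  tensorUnit := vec one
  associator U V W := isoOfEquiv
    (X := (U.set.prod V.set).prod W.set) (Y := U.set.prod (V.set.prod W.set))
    (pair (fst.comp fst) (pair (snd.comp fst) snd))
    (pair (pair fst (fst.comp snd)) (snd.comp snd)) (fun _ => rfl) (fun _ => rfl)
  leftUnitor V := isoOfEquiv (X := one.prod V.set) (Y := V.set) snd (pair (pt _) (idt _))
    (fun _ => rfl) (fun _ => rfl)
  rightUnitor V := isoOfEquiv (X := V.set.prod one) (Y := V.set) fst (pair (idt _) (pt _))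
    (fun _ => rfl) (fun _ => rfl)

theorem naturality {X X' Y Y' : GSet G} (f : X →[G] X') (g : Y →[G] Y') (g' : Y' →[G] Y)
    (h : ∀ y, g' (g y) = y) (h' : ∀ y, g (g' y) = y) (A : Mat k Y X) (B : Mat k Y' X')
    (e : pull (pair fst (f.comp snd)) B = pull (pair (g'.comp fst) snd) A) :
    mul μ (graph k g) A = mul μ B (graph k f) := by
  rw [graph_mul μ g g' h h', mul_graph, e]

theorem graph_one : graph k (idt (one : GSet G)) = 1 := by
  ext w
  induction w using Quotient.inductionOn with | h x => ?_
  obtain ⟨⟨⟩, ⟨⟩⟩ := x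
  exact if_pos ⟨GSet.orb one (), rfl⟩

instance : MonoidalCategory (Perm μ) :=
  MonoidalCategory.ofTensorHom
    (id_tensorHom_id := fun V W => kron_graph μ (idt V.set) (idt W.set))
    (id_tensorHom := fun _ _ _ _ => rfl)
    (tensorHom_id := fun _ _ => rfl)
    (tensorHom_comp_tensorHom := fun A A' B B' => (kron_mul μ B A B' A').symm)
    (associator_naturality := fun A B C => by
      refine naturality _ _ (pair (pair fst (fst.comp snd)) (snd.comp snd)) (fun _ => rfl)
        (fun _ => rfl) _ _ ?_
      change pull _ (kron _ (kron _ _)) = pull _ (kron (kron _ _) _)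
      simp only [kron, pull_mul, pull_comp, mul_assoc]
      rfl)
    (leftUnitor_naturality := fun A => by
      refine naturality _ _ (pair (pt _) (idt _)) (fun _ => rfl) (fun _ => rfl) _ _ ?_
      change pull _ _ = pull _ (kron _ _)
      change pull _ _ = pull _ (pull _ (graph k (idt one)) * pull _ _)
      rw [graph_one, pull_one, one_mul, pull_comp]
      rfl)
    (rightUnitor_naturality := fun A => by
      refine naturality _ _ (pair (idt _) (pt _)) (fun _ => rfl) (fun _ => rfl) _ _ ?_
      change pull _ _ = pull _ (kron _ _)
      change pull _ _ = pull _ (pull _ _ * pull _ (graph k (idt one)))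
      rw [graph_one, pull_one, mul_one, pull_comp]
      rfl)
    (pentagon := fun U V W X => by
      change mul μ (mul μ (kron (graph k _) (graph k _)) (graph k _))
        (kron (graph k _) (graph k _)) = mul μ (graph k _) (graph k _)
      rw [kron_graph μ, kron_graph μ, graph_mul_graph, graph_mul_graph, graph_mul_graph]
      rfl)
    (triangle := fun U V => by
      change mul μ (kron (graph k _) (graph k _)) (graph k _) = kron (graph k _) (graph k _)
      rw [kron_graph μ, kron_graph μ, graph_mul_graph]
      rfl)

instance : SymmetricCategory (Perm μ) where
  braiding V W := isoOfEquiv (X := V.set.prod W.set) (Y := W.set.prod V.set)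
    (pair snd fst) (pair snd fst) (fun _ => rfl) (fun _ => rfl)
  braiding_naturality_right V W W' B := by
    refine naturality _ _ (pair snd fst) (fun _ => rfl) (fun _ => rfl) _ _ ?_
    change pull _ (kron _ _) = pull _ (kron _ _)
    simp only [kron, pull_mul, pull_comp]
    rw [mul_comm]
    rfl
  braiding_naturality_left B V := by
    refine naturality _ _ (pair snd fst) (fun _ => rfl) (fun _ => rfl) _ _ ?_
    change pull _ (kron _ _) = pull _ (kron _ _)
    simp only [kron, pull_mul, pull_comp]
    rw [mul_comm]
    rfl
  hexagon_forward U V W := by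
    change mul μ (mul μ (graph k _) (graph k _)) (graph k _) =
      mul μ (mul μ (kron (graph k _) (graph k _)) (graph k _)) (kron (graph k _) (graph k _))
    rw [kron_graph μ, kron_graph μ, graph_mul_graph, graph_mul_graph, graph_mul_graph,
      graph_mul_graph]
    rfl
  hexagon_reverse U V W := by
    change mul μ (mul μ (graph k _) (graph k _)) (graph k _) =
      mul μ (mul μ (kron (graph k _) (graph k _)) (graph k _)) (kron (graph k _) (graph k _))
    rw [kron_graph μ, kron_graph μ, graph_mul_graph, graph_mul_graph, graph_mul_graph,
      graph_mul_graph]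
    rfl
  symmetry V W := Iso.hom_inv_id (isoOfEquiv (X := V.set.prod W.set) (Y := W.set.prod V.set)
    (pair snd fst) (pair snd fst) (fun _ => rfl) (fun _ => rfl))

instance : MonoidalPreadditive (Perm μ) where
  whiskerLeft_zero := by
    intros
    change kron _ 0 = 0
    exact mul_zero _
  zero_whiskerRight := by
    intros
    change kron 0 _ = 0
    exact zero_mul _
  whiskerLeft_add := by
    intro _ _ _ A B
    change kron _ (_ + _) = kron _ _ + kron _ _
    exact mul_add _ _ _
  add_whiskerRight := by
    intro _ _ _ A B
    change kron (_ + _) _ = kron _ _ + kron _ _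
    exact add_mul _ _ _

instance : MonoidalLinear k (Perm μ) where
  whiskerLeft_smul := by
    intro _ _ _ c A
    exact mul_smul_comm c (pull _ _) (pull _ A)
  smul_whiskerRight := by
    intro c _ _ A _
    exact smul_mul_assoc c (pull _ A) (pull _ _)

/-- Every object is self-dual: evaluation and co-evaluation are the indicator functions
of the diagonal. -/
instance (V : Perm μ) : ExactPairing V V where
  coevaluation' := ind k (pair (pair (idt V.set) (idt V.set)) (pt V.set))
  evaluation' := ind k (pair (pt V.set) (pair (idt V.set) (idt V.set)))
  coevaluation_evaluation' := by
    change mul μ (mul μ (kron (ind k _) (graph k _)) (graph k _)) (kron (graph k _) (ind k _)) =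
      mul μ (graph k _) (graph k _)
    have hc := push_one_of_injective μ (pair (pair (idt V.set) (idt V.set)) (pt V.set))
      (fun _ _ h => (congrArg (fun p : (V.set.prod V.set).prod one => p.1.1) h :))
    have he := push_one_of_injective μ (pair (pt V.set) (pair (idt V.set) (idt V.set)))
      (fun _ _ h => (congrArg (fun p : one.prod (V.set.prod V.set) => p.2.1) h :))
    rw [graph_mul_graph, ← hc, ← he]
    simp only [graph_eq_push μ]
    rw [kron_span, kron_span,
      span_mul_span μ (P := V.set.prod V.set) (q := idt _) (p := pair fst (pair fst snd)) ⟨?_, ?_⟩,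
      span_mul_span μ (P := V.set) (p := pair (idt _) (idt _)) (q := pair (idt _) (idt _)) ⟨?_, ?_⟩]
    · exact (push_one_reindex μ (Z := V.set)
        (pair ((pair (pt V.set) (idt V.set)).comp fst) (idt (V.set.prod one)))
        (pair (idt _) (pt _)) fst (fun _ => rfl) (fun _ => rfl)).symm
    · exact fun _ => rfl
    · rintro ⟨s, t⟩ ⟨s', t'⟩ e
      have e1 : s = s' := (congrArg (fun p : V.set.prod (V.set.prod V.set) => p.1) e :)
      have e2 : t = s' := (congrArg (fun p : V.set.prod (V.set.prod V.set) => p.2.1) e :)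
      have e3 : t = t' := (congrArg (fun p : V.set.prod (V.set.prod V.set) => p.2.2) e :)
      subst e1 e2 e3
      exact ⟨t, ⟨rfl, rfl⟩, fun x hx => (congrArg Prod.fst hx.1 :)⟩
    · exact fun _ => rfl
    · rintro ⟨x, y, z⟩ ⟨s, t⟩ e
      have e1 : x = s := (congrArg (fun p : (V.set.prod V.set).prod V.set => p.1.1) e :)
      have e2 : y = s := (congrArg (fun p : (V.set.prod V.set).prod V.set => p.1.2) e :)
      have e3 : z = t := (congrArg (fun p : (V.set.prod V.set).prod V.set => p.2) e :)
      subst e1 e2 e3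
      exact ⟨(y, z), ⟨rfl, rfl⟩, fun x hx => hx.2⟩
  evaluation_coevaluation' := by
    change mul μ (mul μ (kron (graph k _) (ind k _)) (graph k _)) (kron (ind k _) (graph k _)) =
      mul μ (graph k _) (graph k _)
    have hc := push_one_of_injective μ (pair (pair (idt V.set) (idt V.set)) (pt V.set))
      (fun _ _ h => (congrArg (fun p : (V.set.prod V.set).prod one => p.1.1) h :))
    have he := push_one_of_injective μ (pair (pt V.set) (pair (idt V.set) (idt V.set)))
      (fun _ _ h => (congrArg (fun p : one.prod (V.set.prod V.set) => p.2.1) h :))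
    rw [graph_mul_graph, ← hc, ← he]
    simp only [graph_eq_push μ]
    rw [kron_span, kron_span,
      span_mul_span μ (P := V.set.prod V.set) (q := idt _) (p := pair (pair fst snd) snd) ⟨?_, ?_⟩,
      span_mul_span μ (P := V.set) (p := pair (idt _) (idt _)) (q := pair (idt _) (idt _)) ⟨?_, ?_⟩]
    · exact (push_one_reindex μ (Z := V.set)
        (pair ((pair (idt V.set) (pt V.set)).comp snd) (idt (one.prod V.set)))
        (pair (pt _) (idt _)) snd (fun _ => rfl) (fun _ => rfl)).symm
    · exact fun _ => rfl
    · rintro ⟨s, t⟩ ⟨s', t'⟩ e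
      have e1 : s = s' := (congrArg (fun p : (V.set.prod V.set).prod V.set => p.1.1) e :)
      have e2 : s = t' := (congrArg (fun p : (V.set.prod V.set).prod V.set => p.1.2) e :)
      have e3 : t = t' := (congrArg (fun p : (V.set.prod V.set).prod V.set => p.2) e :)
      subst e1 e2 e3
      exact ⟨t, ⟨rfl, rfl⟩, fun x hx => (congrArg Prod.fst hx.1 :)⟩
    · exact fun _ => rfl
    · rintro ⟨⟨x, y⟩, z⟩ ⟨s, t⟩ e
      have e1 : x = s := (congrArg (fun p : V.set.prod (V.set.prod V.set) => p.1) e :)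
      have e2 : y = t := (congrArg (fun p : V.set.prod (V.set.prod V.set) => p.2.1) e :)
      have e3 : z = t := (congrArg (fun p : V.set.prod (V.set.prod V.set) => p.2.2) e :)
      subst e1 e2 e3
      exact ⟨(x, z), ⟨rfl, rfl⟩, fun x hx => hx.2⟩

end Perm

end Category

section CantorGroup

/-- The Cantor space. -/
abbrev Cantor : Type := ℕ → Bool

/-- The group of self-homeomorphisms of the Cantor space. -/
abbrev CantorGroup : Type := Cantor ≃ₜ Cantor

/-- The subgroups `⋂ A ∈ S, {g | g A = A}`, with `S` a finite set of clopen subsets of the Cantor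
space, form a neighbourhood basis of the identity. -/
instance : TopologicalSpace CantorGroup where
  IsOpen U := ∀ g ∈ U, ∃ S : Finset (TopologicalSpace.Clopens Cantor),
    ∀ h : CantorGroup, (∀ A ∈ S, h '' (A : Set Cantor) = A) → g * h ∈ U
  isOpen_univ := fun _ _ => ⟨∅, fun _ _ => trivial⟩
  isOpen_inter := fun U V hU hV g hg => by
    classical
    obtain ⟨S, hS⟩ := hU g hg.1
    obtain ⟨T, hT⟩ := hV g hg.2
    exact ⟨S ∪ T, fun h hh => ⟨hS h fun A hA => hh A (Finset.mem_union_left _ hA),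
      hT h fun A hA => hh A (Finset.mem_union_right _ hA)⟩⟩
  isOpen_sUnion := fun s hs g hg => by
    obtain ⟨U, hU, hgU⟩ := hg
    obtain ⟨S, hS⟩ := hs U hU g hgU
    exact ⟨S, fun h hh => ⟨U, hU, hS h hh⟩⟩

namespace Cantor

/-- Splitting off the first `n` coordinates. -/
def split (n : ℕ) : Cantor ≃ₜ (Fin n → Bool) × Cantor where
  toFun x := (fun i => x i, fun m => x (n + m))
  invFun p m := if h : m < n then p.1 ⟨m, h⟩ else p.2 (m - n)
  left_inv x := by
    ext m
    by_cases h : m < n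
    · simp [h]
    · simp [h, Nat.add_sub_of_le (not_lt.1 h)]
  right_inv p := by
    refine Prod.ext ?_ ?_
    · ext i; simp
    · ext m; simp
  continuous_toFun := by fun_prop
  continuous_invFun := by
    refine continuous_pi fun m => ?_
    by_cases h : m < n
    · simp only [h, dite_true]; fun_prop
    · simp only [h, dite_false]; fun_prop

theorem sum_self : Nonempty (Cantor ⊕ Cantor ≃ₜ Cantor) := by
  let e : Unit ⊕ Unit ≃ₜ (Fin 1 → Bool) :=
    Equiv.toHomeomorphOfDiscrete (Fintype.equivOfCardEq (by simp))
  exact ⟨((Homeomorph.sumCongr (Homeomorph.punitProd Cantor).symm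
    (Homeomorph.punitProd Cantor).symm).trans Homeomorph.sumProdDistrib.symm).trans
    ((Homeomorph.prodCongr e (Homeomorph.refl _)).trans (split 1).symm)⟩

theorem fin_prod (n : ℕ) : Nonempty (Fin (n + 1) × Cantor ≃ₜ Cantor) := by
  induction n with
  | zero => exact ⟨Homeomorph.uniqueProd (Fin 1) _⟩
  | succ n ih =>
    obtain ⟨e⟩ := ih
    obtain ⟨s⟩ := sum_self
    let d : Fin (n + 1 + 1) ≃ₜ Fin (n + 1) ⊕ Unit :=
      Equiv.toHomeomorphOfDiscrete (Fintype.equivOfCardEq (by simp))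
    exact ⟨((Homeomorph.prodCongr d (Homeomorph.refl _)).trans Homeomorph.sumProdDistrib).trans
      ((Homeomorph.sumCongr e (Homeomorph.punitProd _)).trans s)⟩

theorem finite_prod (F : Type) [Finite F] [Nonempty F] [TopologicalSpace F] [DiscreteTopology F] :
    Nonempty (F × Cantor ≃ₜ Cantor) := by
  obtain ⟨n, ⟨e⟩⟩ := Finite.exists_equiv_fin F
  obtain _ | n := n
  · exact (e (Classical.arbitrary F)).elim0
  · obtain ⟨s⟩ := fin_prod n
    exact ⟨(Homeomorph.prodCongr (Equiv.toHomeomorphOfDiscrete e) (Homeomorph.refl _)).trans s⟩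

theorem exists_factor {F : Type} [TopologicalSpace F] [DiscreteTopology F] (ψ : Cantor → F)
    (hψ : Continuous ψ) : ∃ n, ∀ x y : Cantor, (∀ i < n, x i = y i) → ψ x = ψ y := by
  have h : ∀ x : Cantor, ∃ n, PiNat.cylinder x n ⊆ ψ ⁻¹' {ψ x} := by
    intro x
    obtain ⟨v, ⟨y, n, rfl⟩, hx, hv⟩ :=
      (PiNat.isTopologicalBasis_cylinders (fun _ : ℕ => Bool)).exists_subset_of_mem_open
        (show x ∈ ψ ⁻¹' {ψ x} from rfl) ((isOpen_discrete _).preimage hψ)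
    exact ⟨n, by rwa [PiNat.mem_cylinder_iff_eq.1 hx]⟩
  choose N hN using h
  obtain ⟨t, -, ht⟩ := isCompact_univ.elim_nhds_subcover (fun x => PiNat.cylinder x (N x))
    (fun x _ => (PiNat.isOpen_cylinder _ x (N x)).mem_nhds (PiNat.self_mem_cylinder x _))
  refine ⟨t.sup N, fun x y hxy => ?_⟩
  obtain ⟨z, hz, hxz⟩ := Set.mem_iUnion₂.1 (ht (Set.mem_univ x))
  have hyz : y ∈ PiNat.cylinder z (N z) := by
    rw [PiNat.mem_cylinder_iff] at hxz ⊢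
    intro i hi
    rw [← hxz i hi, hxy i (hi.trans_le (Finset.le_sup hz))]
  exact (hN z hxz).trans (hN z hyz).symm

/-- Two continuous maps from the Cantor space to a finite discrete space differ by
a homeomorphism as soon as they have the same range. -/
theorem exists_homeomorph {F : Type} [TopologicalSpace F] [DiscreteTopology F]
    (ψ ψ' : Cantor → F) (hψ : Continuous ψ) (hψ' : Continuous ψ')
    (h : Set.range ψ = Set.range ψ') : ∃ g : CantorGroup, ∀ x, ψ' (g x) = ψ x := by
  obtain ⟨n, hn⟩ := exists_factor ψ hψ
  obtain ⟨n', hn'⟩ := exists_factor ψ' hψ'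
  set N := max n n'
  let z : Cantor := fun _ => false
  let a : (Fin N → Bool) → F := fun s => ψ ((split N).symm (s, z))
  let a' : (Fin N → Bool) → F := fun s => ψ' ((split N).symm (s, z))
  have key : ∀ (s : Fin N → Bool) (y y' : Cantor) (i : ℕ), i < N →
      (split N).symm (s, y) i = (split N).symm (s, y') i := by
    intro s y y' i hi
    simp [split, hi]
  have ha : ∀ x, a (split N x).1 = ψ x := by
    intro x
    conv_rhs => rw [← (split N).symm_apply_apply x]
    exact hn _ _ fun i hi => key _ _ _ _ (hi.trans_le (le_max_left _ _))
  have ha' : ∀ x, a' (split N x).1 = ψ' x := by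
    intro x
    conv_rhs => rw [← (split N).symm_apply_apply x]
    exact hn' _ _ fun i hi => key _ _ _ _ (hi.trans_le (le_max_right _ _))
  have fib : ∀ f : F, Nonempty ({s // a s = f} × Cantor ≃ₜ {s // a' s = f} × Cantor) := by
    intro f
    by_cases hf : f ∈ Set.range ψ
    · obtain ⟨x, hx⟩ := hf
      obtain ⟨x', hx'⟩ : f ∈ Set.range ψ' := h ▸ ⟨x, hx⟩
      have : Nonempty {s // a s = f} := ⟨⟨_, (ha x).trans hx⟩⟩
      have : Nonempty {s // a' s = f} := ⟨⟨_, (ha' x').trans hx'⟩⟩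
      obtain ⟨e⟩ := finite_prod {s // a s = f}
      obtain ⟨e'⟩ := finite_prod {s // a' s = f}
      exact ⟨e.trans e'.symm⟩
    · have h1 : IsEmpty {s // a s = f} := ⟨fun s => hf ⟨_, s.2⟩⟩
      have h2 : IsEmpty {s // a' s = f} := ⟨fun s => hf (h ▸ ⟨_, s.2⟩)⟩
      exact ⟨Homeomorph.empty⟩
  let e := fun f => (fib f).some
  let E : Cantor ≃ₜ Σ f, {s // a s = f} × Cantor :=
    (split N).trans ((Homeomorph.prodCongr
      (Equiv.toHomeomorphOfDiscrete (Equiv.sigmaFiberEquiv a).symm) (Homeomorph.refl _)).trans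
      Homeomorph.sigmaProdDistrib)
  let E' : Cantor ≃ₜ Σ f, {s // a' s = f} × Cantor :=
    (split N).trans ((Homeomorph.prodCongr
      (Equiv.toHomeomorphOfDiscrete (Equiv.sigmaFiberEquiv a').symm) (Homeomorph.refl _)).trans
      Homeomorph.sigmaProdDistrib)
  let M : (Σ f, {s // a s = f} × Cantor) ≃ₜ Σ f, {s // a' s = f} × Cantor :=
    { toEquiv := Equiv.sigmaCongrRight fun f => (e f).toEquiv
      continuous_toFun := continuous_sigma fun f => continuous_sigmaMk.comp (e f).continuous
      continuous_invFun := continuous_sigma fun f => continuous_sigmaMk.comp (e f).symm.continuous }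
  have hE : ∀ x, (E x).1 = ψ x := fun x => ha x
  have hE' : ∀ x, (E' x).1 = ψ' x := fun x => ha' x
  refine ⟨(E.trans M).trans E'.symm, fun x => ?_⟩
  rw [← hE', ← hE]
  change (E' (E'.symm (M (E x)))).1 = _
  rw [E'.apply_symm_apply]
  rfl

end Cantor

theorem exists_stab_subset (U : Subgroup CantorGroup) (hU : IsOpen (U : Set CantorGroup)) :
    ∃ S : Finset (TopologicalSpace.Clopens Cantor), ∀ h : CantorGroup,
      (∀ A ∈ S, h '' (A : Set Cantor) = A) → h ∈ U := by
  obtain ⟨S, hS⟩ := hU 1 U.one_mem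
  exact ⟨S, fun h hh => by simpa using hS h hh⟩

instance : RoelckePrecompact CantorGroup where
  exists_finset U V hU hV := by
    classical
    obtain ⟨S, hS⟩ := exists_stab_subset U hU
    obtain ⟨T, hT⟩ := exists_stab_subset V hV
    let χ (R : Finset (TopologicalSpace.Clopens Cantor)) (x : Cantor) : R → Bool :=
      fun A => (A.1 : Set Cantor).boolIndicator x
    have hχ : ∀ R, Continuous (χ R) := fun R => continuous_pi fun A =>
      (continuous_boolIndicator_iff_isClopen _).2 A.1.isClopen
    have hχ' : ∀ R (h : CantorGroup), (∀ x, χ R (h x) = χ R x) →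
        ∀ A ∈ R, h '' (A : Set Cantor) = A := by
      intro R h hh A hA
      have : ∀ x, h x ∈ A ↔ x ∈ A := fun x => by
        have := congrFun (hh x) ⟨A, hA⟩
        simp only [χ, Set.boolIndicator] at this
        by_cases h1 : h x ∈ A <;> by_cases h2 : x ∈ A <;> simp_all
      ext y
      constructor
      · rintro ⟨x, hx, rfl⟩
        exact (this x).2 hx
      · intro hy
        exact ⟨h.symm y, (this _).1 (by simpa using hy), by simp⟩
    let c : CantorGroup → Set ((S → Bool) × (T → Bool)) := fun g =>
      Set.range fun x => (χ S x, χ T (g.symm x))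
    let r : Set ((S → Bool) × (T → Bool)) → CantorGroup := fun s =>
      if h : ∃ g, c g = s then h.choose else 1
    refine ⟨Finset.univ.image r, fun g => ⟨r (c g), by simp, ?_⟩⟩
    have hr : c (r (c g)) = c g := by
      have h : ∃ g', c g' = c g := ⟨g, rfl⟩
      simp only [r, dif_pos h]
      exact h.choose_spec
    set a := r (c g)
    obtain ⟨h, hh⟩ := Cantor.exists_homeomorph
      (fun x => (χ S x, χ T (a.symm x))) (fun x => (χ S x, χ T (g.symm x)))
      ((hχ S).prodMk ((hχ T).comp a.symm.continuous))
      ((hχ S).prodMk ((hχ T).comp g.symm.continuous)) hr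
    refine ⟨h, hS _ (hχ' S _ fun x => congrArg Prod.fst (hh x)), a⁻¹ * h⁻¹ * g, ?_, by group⟩
    have : (a⁻¹ * h⁻¹ * g)⁻¹ ∈ V := by
      refine hT _ (hχ' T _ fun x => ?_)
      have := congrArg Prod.snd (hh (a x))
      simp only [a.symm_apply_apply] at this
      rw [← this]
      congr 1
    simpa using V.inv_mem this

/-- The `G`-set `Y(n)` of continuous maps from the Cantor space to `{1, …, n}`. -/
def setY (n : ℕ) : GSet CantorGroup where
  carrier := C(Cantor, Fin n)
  action :=
    { smul := fun g φ => φ.comp ⟨g.symm, g.symm.continuous⟩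
      one_smul := fun _ => rfl
      mul_smul := fun _ _ _ => rfl }
  smooth := fun φ => by
    classical
    intro g hg
    refine ⟨Finset.univ.image fun i : Fin n =>
      ⟨φ ⁻¹' {i}, (isClopen_discrete {i}).preimage φ.continuous⟩, fun h hh => ?_⟩
    refine mul_mem hg ?_
    refine ContinuousMap.ext fun x => ?_
    have h1 := hh _ (Finset.mem_image_of_mem _ (Finset.mem_univ (φ x)))
    have h2 : x ∈ h '' (φ ⁻¹' {φ x}) := by
      have h3 : h '' (φ ⁻¹' {φ x}) = φ ⁻¹' {φ x} := h1
      rw [h3]; rfl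
    obtain ⟨y, hy, rfl⟩ := h2
    change φ (h.symm (h y)) = _
    rw [h.symm_apply_apply]
    exact hy
  finitary := by
    refine Finite.of_injective (β := Set (Fin n)) (Quotient.lift (fun φ => Set.range φ) ?_) ?_
    · rintro _ φ ⟨g, rfl⟩
      exact g.symm.surjective.range_comp φ
    · intro a b
      induction a using Quotient.inductionOn with | h φ => ?_
      induction b using Quotient.inductionOn with | h ψ => ?_
      intro h
      obtain ⟨g, hg⟩ := Cantor.exists_homeomorph ψ φ ψ.continuous φ.continuous h.symm
      refine Quotient.sound ⟨g, ContinuousMap.ext fun x => ?_⟩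
      change ψ (g.symm x) = φ x
      rw [← hg, g.apply_symm_apply]

/-- The `G`-set `X(n)` of surjective continuous maps from the Cantor space to `{1, …, n}`. -/
def setX (n : ℕ) : GSet CantorGroup where
  carrier := {φ : C(Cantor, Fin n) // Function.Surjective φ}
  action :=
    { smul := fun g φ => ⟨φ.1.comp ⟨g.symm, g.symm.continuous⟩,
        φ.2.comp g.symm.surjective⟩
      one_smul := fun _ => rfl
      mul_smul := fun _ _ _ => rfl }
  smooth := fun φ => by
    convert (setY n).smooth φ.1 using 1
    ext g
    exact Subtype.ext_iff
  finitary := by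
    refine Finite.of_injective (β := (setY n).Orb)
      (Quotient.map (sb := MulAction.orbitRel CantorGroup (setY n)) (fun φ => φ.1) ?_) ?_
    · rintro a b ⟨g, rfl⟩
      exact ⟨g, rfl⟩
    · intro a b
      induction a using Quotient.inductionOn
      induction b using Quotient.inductionOn
      intro h
      obtain ⟨g, hg⟩ := Quotient.exact h
      exact Quotient.sound ⟨g, Subtype.ext hg⟩

/-- The characterization of `ν`: a regular measure with `ν (X(n)) = (-1) ^ (n - 1)`
for all `n ≥ 1`. -/
structure IsNu (ν : Measure CantorGroup ℚ) : Prop where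
  regular : ν.IsRegular
  size_setX : ∀ n : ℕ, ν.size (setX (n + 1)) = (-1) ^ n

end CantorGroup

section Categories

open Limits

/-- The categorical trace of an endomorphism of `X`, computed with a dual `Y` of `X`. -/
def catTrace {C : Type*} [Category C] [MonoidalCategory C] [BraidedCategory C] {X : C} (Y : C)
    [ExactPairing X Y] (f : X ⟶ X) : 𝟙_ C ⟶ 𝟙_ C :=
  η_ X Y ≫ f ▷ Y ≫ (β_ X Y).hom ≫ ε_ X Y

/-- A preadditive category is semi-simple if it is abelian and every object is a finite direct sum
of simple objects. -/
structure IsSemisimpleCategory (C : Type*) [Category C] [Preadditive C] : Prop where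
  hasFiniteProducts : HasFiniteProducts C
  hasKernels : HasKernels C
  hasCokernels : HasCokernels C
  normalMono : IsNormalMonoCategory C
  normalEpi : IsNormalEpiCategory C
  exists_simple : ∀ X : C, ∃ (n : ℕ) (S : Fin n → C) (b : Bicone S),
    (∀ i, Simple (S i)) ∧ Nonempty b.IsBilimit ∧ Nonempty (X ≅ b.pt)

/-- A `k`-linear abelian symmetric monoidal category (with `k`-bilinear tensor product) is
pre-Tannakian if all objects have finite length, all `Hom` spaces are finite dimensional, all
objects are rigid, and the endomorphism ring of the unit is `k`. -/
structure IsPreTannakian (k : Type*) [Field k] (T : Type*) [Category T] [Abelian T] [Linear k T]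
    [MonoidalCategory T] [SymmetricCategory T] [MonoidalPreadditive T] [MonoidalLinear k T] :
    Prop where
  isNoetherianObject : ∀ X : T, IsNoetherianObject X
  isArtinianObject : ∀ X : T, IsArtinianObject X
  finite_hom : ∀ X Y : T, Module.Finite k (X ⟶ Y)
  rigid : ∀ X : T, ∃ Y : T, Nonempty (ExactPairing Y X)
  end_unit : Function.Bijective fun a : k => a • 𝟙 (𝟙_ T)

end Categories

end Oligo

end

/-! Existence of the measure. A locally constant map from the Cantor space to a set is a colouring,
and its stabilizer depends only on the partition into fibres. Every open subgroup `U` contains such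
a stabilizer `H` with finite index (`exists_colorStab_relIndex_ne_zero`). Moreover `H` is determined
by `U`, because a colour stabilizer contains no other one as a proper subgroup of finite index. If
the colouring has `n` colours, `U` receives the weight `(-1)^(n-1) / [U : H]`; a `G`-set receives
the sum `gsize` of the weights of its orbits, and `X → Y` the quotient `gsize X / gsize Y`. Only
base change is not formal. Finite covers by the `X(n)` reduce it to `X(a) → X(c) ← X(b)`. There the
orbits of the fibre product correspond to the subsets of a fibre product of finite sets that surject
onto both factors, and inclusion-exclusion gives their signed count
(`sum_neg_one_pow_card_fiberProduct`).

The nilpotent. For any measure with the prescribed values on the `X(n)`, push-forward along a map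
that recolours by `p` takes the indicator function of "all colours lie in `T`" to that of "all
colours lie in `p(T)`" (`push_indicator`). Hence matrices on `Y(3)` that come from relations on the
three colours multiply like relations. Let `A` come from the relation "different" and `J` from the
full relation. Any two of three colours leave a colour different from both, so `A² = J`; also `AJ =
JA = J² = J`, and therefore `(A - J)² = 0`. The diagonal of `A` vanishes and the trace of `J` is
`1`, so `A - J` has trace `-1`.

The obstruction. If `f = p ≫ i` with `p` epi and `i` mono, then `i ≫ p` has the same trace as `f`,
and cancelling `p` and `i` shows that its nilpotency exponent is smaller. So cyclic traces vanish on
nilpotents in every abelian category (`cyclic_eq_zero_of_isNilpotent`). This excludes an abelian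
Karoubi envelope. It also excludes a faithful symmetric monoidal functor to a pre-Tannakian
category, since such a functor preserves traces. -/

set_option linter.unusedSectionVars false

noncomputable section

namespace Oligo

/-! ### Categorical traces, and their vanishing on nilpotent endomorphisms -/

section Trace

variable {C : Type*} [Category C] [MonoidalCategory C] [BraidedCategory C]

/-- The categorical trace is cyclic; in particular it is independent of the choice of duals. -/
theorem catTrace_comp_comm {X Y : C} (X' Y' : C) [hX : ExactPairing X X'] [hY : ExactPairing Y Y']
    (f : X ⟶ Y) (g : Y ⟶ X) : catTrace X' (f ≫ g) = catTrace Y' (g ≫ f) := by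
  -- `m` is the mate of `f` for the given pairings: it carries `f` across the coevaluation and back
  -- across the evaluation.
  obtain ⟨m, h1, h2⟩ : ∃ m : Y' ⟶ X', η_ Y Y' ≫ Y ◁ m = η_ X X' ≫ f ▷ X' ∧
      m ▷ X ≫ ε_ X X' = Y' ◁ f ≫ ε_ Y Y' := by
    let _ : HasRightDual X := { rightDual := X', exact := hX }
    let _ : HasRightDual Y := { rightDual := Y', exact := hY }
    exact ⟨fᘁ, coevaluation_comp_rightAdjointMate f, rightAdjointMate_comp_evaluation f⟩
  simp only [catTrace, comp_whiskerRight, Category.assoc]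
  rw [← reassoc_of% h1, whisker_exchange_assoc, BraidedCategory.braiding_naturality_right_assoc, h2]
  simp only [BraidedCategory.braiding_naturality_left_assoc]

/-- A monoidal functor preserves exact pairings. -/
@[reducible]
def mapExactPairing {D : Type*} [Category D] [MonoidalCategory D] (F : C ⥤ D) [F.Monoidal]
    (X Y : C) [ExactPairing X Y] : ExactPairing (F.obj X) (F.obj Y) where
  coevaluation' := Functor.LaxMonoidal.ε F ≫ F.map (η_ X Y) ≫ Functor.OplaxMonoidal.δ F X Y
  evaluation' := Functor.LaxMonoidal.μ F Y X ≫ F.map (ε_ X Y) ≫ Functor.OplaxMonoidal.η F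
  coevaluation_evaluation' := by
    have h := congrArg F.map (ExactPairing.coevaluation_evaluation X Y)
    -- The image of the zigzag identity lives on `F` of a tensor product; composing with the
    -- structure maps of `F` on both sides moves it to tensor products of images.
    replace h := congrArg (fun t => F.obj Y ◁ Functor.LaxMonoidal.ε F ≫ Functor.LaxMonoidal.μ F _ _ ≫
      t ≫ Functor.OplaxMonoidal.δ F _ _ ≫ Functor.OplaxMonoidal.η F ▷ F.obj Y) h
    simp only [Functor.map_comp, Functor.Monoidal.map_whiskerLeft,
      Functor.Monoidal.map_whiskerRight, Functor.Monoidal.map_associator_inv,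
      Functor.Monoidal.map_rightUnitor, Functor.Monoidal.map_leftUnitor_inv, Category.assoc,
      Functor.Monoidal.μ_δ_assoc, Functor.Monoidal.whiskerLeft_ε_η_assoc,
      Functor.Monoidal.whiskerRight_ε_η, Category.comp_id] at h
    simpa only [comp_whiskerRight, MonoidalCategory.whiskerLeft_comp, Category.assoc] using h
  evaluation_coevaluation' := by
    have h := congrArg F.map (ExactPairing.evaluation_coevaluation X Y)
    replace h := congrArg (fun t => Functor.LaxMonoidal.ε F ▷ F.obj X ≫ Functor.LaxMonoidal.μ F _ _ ≫
      t ≫ Functor.OplaxMonoidal.δ F _ _ ≫ F.obj X ◁ Functor.OplaxMonoidal.η F) h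
    simp only [Functor.map_comp, Functor.Monoidal.map_whiskerLeft,
      Functor.Monoidal.map_whiskerRight, Functor.Monoidal.map_associator,
      Functor.Monoidal.map_leftUnitor, Functor.Monoidal.map_rightUnitor_inv, Category.assoc,
      Functor.Monoidal.μ_δ_assoc, 
      Functor.Monoidal.whiskerRight_ε_η_assoc, Functor.Monoidal.whiskerLeft_ε_η, Category.comp_id] at h
    simpa only [comp_whiskerRight, MonoidalCategory.whiskerLeft_comp, Category.assoc] using h

theorem catTrace_map {D : Type*} [Category D] [MonoidalCategory D] [BraidedCategory D] (F : C ⥤ D)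
    [F.Braided] {X : C} (Y : C) [ExactPairing X Y] (f : X ⟶ X) :
    letI := mapExactPairing F X Y
    catTrace (F.obj Y) (F.map f) =
      Functor.LaxMonoidal.ε F ≫ F.map (catTrace Y f) ≫ Functor.OplaxMonoidal.η F := by
  have h : (β_ (F.obj X) (F.obj Y)).hom =
      Functor.LaxMonoidal.μ F X Y ≫ F.map (β_ X Y).hom ≫ Functor.OplaxMonoidal.δ F Y X := by
    simp
  simp only [catTrace, Functor.map_comp, Functor.Monoidal.map_whiskerRight, h, Category.assoc]
  change (_ ≫ _ ≫ _) ≫ _ ≫ _ ≫ _ ≫ _ ≫ _ ≫ _ ≫ _ = _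
  simp

end Trace

/-- If every morphism is the composition of an epimorphism and a monomorphism, then a cyclic
function on endomorphisms that vanishes on zero morphisms vanishes on nilpotent endomorphisms. -/
theorem cyclic_eq_zero_of_isNilpotent {C : Type*} [Category C] [Preadditive C]
    (fac : ∀ {X Y : C} (f : X ⟶ Y), ∃ (I : C) (p : X ⟶ I) (i : I ⟶ Y), Epi p ∧ Mono i ∧ p ≫ i = f)
    {K : Type*} [Zero K] (t : ∀ {X : C}, (X ⟶ X) → K) (t_zero : ∀ X : C, t (0 : X ⟶ X) = 0)
    (t_comm : ∀ {X Y : C} (f : X ⟶ Y) (g : Y ⟶ X), t (f ≫ g) = t (g ≫ f))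
    {X : C} (f : End X) (hf : IsNilpotent f) : t f = 0 := by
  obtain ⟨n, hn⟩ := hf
  induction n generalizing X with
  | zero =>
    have : f = 0 := by
      have h : (1 : End X) = 0 := by simpa using hn
      rw [← mul_one f, h, mul_zero]
    rw [this]; exact t_zero X
  | succ n ih =>
    obtain ⟨I, p, i, hp, hi, e⟩ := fac f
    -- `f ^ (m + 1)` passes through `(i ≫ p) ^ m`. Cancelling `p` and `i` in `f ^ (n + 1) = 0`
    -- leaves `(i ≫ p) ^ n = 0`, so passing from `f` to `i ≫ p` keeps the trace and lowers the
    -- exponent.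
    have key : ∀ m : ℕ, p ≫ ((show End I from i ≫ p) ^ m : End I) ≫ i = (f ^ (m + 1) : End X) := by
      intro m
      induction m with
      | zero => 
        rw [zero_add, pow_one, pow_zero, ← e]
        change p ≫ 𝟙 _ ≫ i = _
        simp
      | succ m ihm =>
        rw [pow_succ _ (m + 1), ← ihm, pow_succ]
        change p ≫ ((i ≫ p) ≫ _) ≫ i = f ≫ p ≫ _ ≫ i
        rw [← e]; simp
    rw [← e, t_comm]
    refine ih _ ?_
    have h := (key n).trans hn
    have h0 : p ≫ ((show End I from i ≫ p) ^ n : End I) ≫ i = p ≫ (0 : I ⟶ I) ≫ i := by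
      rw [h]; simp
    rw [cancel_epi, cancel_mono] at h0
    exact h0

theorem isNilpotent_mapEnd {C D : Type*} [Category C] [Preadditive C] [Category D] [Preadditive D]
    (F : C ⥤ D) [F.Additive] {X : C} {f : End X} (hf : IsNilpotent f) :
    IsNilpotent (F.mapEnd X f) := by
  obtain ⟨n, hn⟩ := hf
  refine ⟨n, ?_⟩
  rw [← map_pow, hn]
  exact F.map_zero X X

theorem Abelian.exists_epi_mono_fac {C : Type*} [Category C] [Abelian C] {X Y : C} (f : X ⟶ Y) :
    ∃ (I : C) (p : X ⟶ I) (i : I ⟶ Y), Epi p ∧ Mono i ∧ p ≫ i = f :=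
  ⟨_, Abelian.factorThruImage f, Abelian.image.ι f, inferInstance, inferInstance,
    Abelian.image.fac f⟩

/-! ### What a nilpotent endomorphism with non-zero trace excludes -/

section Perm

variable {G : Type} [Group G] [TopologicalSpace G] [RoelckePrecompact G] {k : Type w}

/-- If some nilpotent endomorphism has non-zero trace, then the Karoubi envelope is not
semi-simple; in fact it is not abelian. -/
theorem Perm.not_isSemisimpleCategory_karoubi [CommRing k] {μ : Measure G k} {X : Perm μ}
    (f : End X) (hf : IsNilpotent f) (ht : catTrace X f ≠ 0) :
    ¬ IsSemisimpleCategory (Idempotents.Karoubi (Perm μ)) := by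
  rintro ⟨h1, h2, h3, h4, h5, -⟩
  let _ : Abelian (Idempotents.Karoubi (Perm μ)) :=
    { toPreadditive := inferInstance
      toIsNormalMonoCategory := h4
      toIsNormalEpiCategory := h5
      has_kernels := h2
      has_cokernels := h3
      has_finite_products := h1 }
  have hf' : IsNilpotent ((Idempotents.toKaroubi (Perm μ)).mapEnd X f) :=
    isNilpotent_mapEnd _ hf
  -- The trace on the envelope is the trace of the underlying morphism of permutation modules. It
  -- inherits cyclicity, so no duals in the envelope have to be constructed.
  refine ht (cyclic_eq_zero_of_isNilpotent (C := Idempotents.Karoubi (Perm μ))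
    Abelian.exists_epi_mono_fac
    (t := fun {P : Idempotents.Karoubi (Perm μ)} (g : P ⟶ P) => catTrace P.X g.f) ?_ ?_ _ hf')
  · intro P
    change catTrace P.X (0 : P.X ⟶ P.X) = 0
    simp [catTrace]
  · intro P Q g h
    exact catTrace_comp_comm P.X Q.X g.f h.f

/-- If some nilpotent endomorphism has non-zero trace, then there is no embedding into
a pre-Tannakian category. -/
theorem Perm.not_exists_faithful_preTannakian [Field k] {μ : Measure G k} {X : Perm μ}
    (f : End X) (hf : IsNilpotent f) (ht : catTrace X f ≠ 0)
    (T : Type u) [Category.{v} T] [Abelian T] [Linear k T] [MonoidalCategory T]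
    [SymmetricCategory T] [MonoidalPreadditive T] [MonoidalLinear k T] (hT : IsPreTannakian k T) :
    ¬ ∃ F : Perm μ ⥤ T, Nonempty F.Braided ∧ F.Additive ∧ F.Linear k ∧ F.Faithful := by
  rintro ⟨F, ⟨_⟩, _, -, _⟩
  choose D hD using hT.rigid
  -- Rigidity gives a dual on one side; the braiding moves it to the side that `catTrace` uses.
  let _ (Y : T) : ExactPairing Y (D Y) :=
    letI := (hD Y).some
    BraidedCategory.exactPairing_swap (D Y) Y
  have h0 := cyclic_eq_zero_of_isNilpotent Abelian.exists_epi_mono_fac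
    (t := fun {Y} (g : Y ⟶ Y) => catTrace (D Y) g) (fun Y => by simp [catTrace])
    (fun g h => catTrace_comp_comm _ _ g h) _
    (isNilpotent_mapEnd F hf)
  -- The functor preserves the trace taken with the transported dual `F.obj X`. Cyclicity, applied
  -- to `F.map f` and an identity, replaces this dual by the chosen one.
  have h1 : catTrace (D (F.obj X)) (F.map f) =
      Functor.LaxMonoidal.ε F ≫ F.map (catTrace X f) ≫ Functor.OplaxMonoidal.η F := by
    rw [← catTrace_map]
    let _ := mapExactPairing F X X
    have := catTrace_comp_comm (D (F.obj X)) (F.obj X) (F.map f) (𝟙 (F.obj X))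
    simpa using this
  have h2 : Functor.LaxMonoidal.ε F ≫ F.map (catTrace X f) ≫ Functor.OplaxMonoidal.η F =
      Functor.LaxMonoidal.ε F ≫ F.map 0 ≫ Functor.OplaxMonoidal.η F := by
    rw [← h1, Functor.map_zero]
    simpa using h0
  rw [cancel_epi, cancel_mono] at h2
  exact ht (F.map_injective h2)

end Perm

/-! ### Stabilizers of colourings -/

namespace Cantor

/-- The stabilizer of a colouring of the Cantor space. -/
def colorStab {F : Type} (φ : Cantor → F) : Subgroup CantorGroup where
  carrier := {g | ∀ x, φ (g x) = φ x}
  one_mem' _ := rfl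
  mul_mem' {a b} ha hb x := (ha (b x)).trans (hb x)
  inv_mem' {a} ha x := by
    have := ha (a.symm x)
    rw [a.apply_symm_apply] at this
    exact this.symm

/-- Two colourings with corresponding values on the fibres of `θ` differ by
a homeomorphism that preserves `θ`. -/
theorem exists_mem_colorStab {E F : Type} {θ : Cantor → E} {a b : Cantor → F}
    (hθ : IsLocallyConstant θ) (ha : IsLocallyConstant a) (hb : IsLocallyConstant b)
    (h : ∀ x, ∃ y, θ y = θ x ∧ b y = a x) (h' : ∀ x, ∃ y, θ y = θ x ∧ a y = b x) :
    ∃ g ∈ colorStab θ, ∀ x, b (g x) = a x := by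
  let _ : TopologicalSpace (E × F) := ⊥
  have : DiscreteTopology (E × F) := ⟨rfl⟩
  obtain ⟨g, hg⟩ := exists_homeomorph (fun x => (θ x, a x)) (fun x => (θ x, b x))
    (hθ.prodMk ha).continuous (hθ.prodMk hb).continuous (by
      ext ⟨e, f⟩
      constructor
      · rintro ⟨x, hx⟩
        obtain ⟨y, h1, h2⟩ := h x
        exact ⟨y, by rw [← hx]; exact Prod.ext h1 h2⟩
      · rintro ⟨x, hx⟩
        obtain ⟨y, h1, h2⟩ := h' x
        exact ⟨y, by rw [← hx]; exact Prod.ext h1 h2⟩)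
  exact ⟨g, fun x => congrArg Prod.fst (hg x), fun x => congrArg Prod.snd (hg x)⟩

/-- There is a two-valued colouring that takes both values on every fibre of `θ`. -/
theorem exists_generic {E : Type} {θ : Cantor → E} (hθ : IsLocallyConstant θ) :
    ∃ ρ : Cantor → Bool, IsLocallyConstant ρ ∧ ∀ x b, ∃ y, θ y = θ x ∧ ρ y = b := by
  let _ : TopologicalSpace E := ⊥
  have : DiscreteTopology E := ⟨rfl⟩
  obtain ⟨n, hn⟩ := exists_factor θ hθ.continuous
  -- `θ` depends on the coordinates before `n` only, so the coordinate `n` varies freely on each of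
  -- its fibres.
  refine ⟨fun x => x n, (IsLocallyConstant.iff_continuous _).2 (continuous_apply n),
    fun x b => ⟨Function.update x n b, hn _ _ fun i hi => ?_, by simp⟩⟩
  simp [hi.ne]

/-- A colouring preserved by the stabilizer of `φ` is a function of `φ`. -/
theorem eq_of_colorStab_le {E F : Type} {φ : Cantor → E} {ψ : Cantor → F}
    (hφ : IsLocallyConstant φ) (hψ : IsLocallyConstant ψ) (h : colorStab φ ≤ colorStab ψ)
    {x y : Cantor} (hxy : φ x = φ y) : ψ x = ψ y := by
  classical
  by_contra hne
  -- If `ψ` separates `x` from `y` inside one fibre of `φ`, some `g` preserving `φ` moves the piece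
  -- of that fibre coloured `ψ x` onto the piece coloured `ψ y`, so `g` does not preserve `ψ`.
  obtain ⟨g, hg, hg'⟩ := exists_mem_colorStab (a := fun z => decide (φ z = φ x ∧ ψ z = ψ x))
    (b := fun z => decide (φ z = φ x ∧ ψ z = ψ y)) hφ
    ((hφ.prodMk hψ).comp fun p => decide (p.1 = φ x ∧ p.2 = ψ x))
    ((hφ.prodMk hψ).comp fun p => decide (p.1 = φ x ∧ p.2 = ψ y))
    (fun z => by
      by_cases hz : φ z = φ x
      · by_cases hz' : ψ z = ψ x
        · exact ⟨y, by rw [hz, hxy], by simp [hz, hz', hxy]⟩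
        · exact ⟨x, hz.symm, by simp [hz', hne]⟩
      · exact ⟨z, rfl, by simp [hz]⟩)
    (fun z => by
      by_cases hz : φ z = φ x
      · by_cases hz' : ψ z = ψ y
        · exact ⟨x, hz.symm, by simp [hz, hz']⟩
        · exact ⟨y, by rw [hz, hxy], by simp [hz', Ne.symm hne]⟩
      · exact ⟨z, rfl, by simp [hz]⟩)
  have h1 := hg' x
  simp only [and_self, decide_true, decide_eq_true_eq] at h1
  exact hne ((h hg x).symm.trans h1.2)

theorem colorStab_le_of_factor {E F : Type} {φ : Cantor → E} {ψ : Cantor → F}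
    (h : ∀ x y, φ x = φ y → ψ x = ψ y) : colorStab φ ≤ colorStab ψ :=
  fun _ hg x => h _ _ (hg x)

theorem ncard_range_le_of_factor {E F : Type} {φ : Cantor → E} {ψ : Cantor → F}
    (hφ : IsLocallyConstant φ) (h : ∀ x y, φ x = φ y → ψ x = ψ y) :
    (Set.range ψ).ncard ≤ (Set.range φ).ncard := by
  have e : Set.range ψ = (fun e => ψ (Function.invFun φ e)) '' Set.range φ := by
    ext f
    constructor
    · rintro ⟨x, rfl⟩
      exact ⟨φ x, ⟨x, rfl⟩, h _ _ (Function.invFun_eq ⟨x, rfl⟩)⟩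
    · rintro ⟨_, ⟨x, rfl⟩, rfl⟩
      exact ⟨_, rfl⟩
  rw [e]
  exact Set.ncard_image_le hφ.range_finite

/-- The stabilizers of colourings have no proper subgroups of the same kind of finite index. -/
theorem colorStab_le_of_relIndex_ne_zero {E F : Type} {φ : Cantor → E} {θ : Cantor → F}
    (hφ : IsLocallyConstant φ) (hθ : IsLocallyConstant θ)
    (h : (colorStab θ).relIndex (colorStab φ) ≠ 0) : colorStab φ ≤ colorStab θ := by
  classical
  refine colorStab_le_of_factor fun x x' hx => ?_
  by_contra hne
  obtain ⟨ρ, hρ, hgen⟩ := exists_generic (hφ.prodMk hθ)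
  -- `g` preserves `φ` and shrinks the piece `φ = φ x`, `θ = θ x` onto its half `ρ = true`. The
  -- point `x'` of the same fibre of `φ` lies outside the piece, which leaves room for the
  -- complement. By finite index some positive power of `g` preserves `θ`, hence maps the piece onto
  -- itself, whereas positive powers of `g` map it into the half.
  obtain ⟨g, hg, hg'⟩ := exists_mem_colorStab (a := fun z => decide (φ z = φ x ∧ θ z = θ x))
    (b := fun z => decide (φ z = φ x ∧ θ z = θ x ∧ ρ z = true)) hφ
    ((hφ.prodMk hθ).comp fun p => decide (p.1 = φ x ∧ p.2 = θ x))
    ((hφ.prodMk (hθ.prodMk hρ)).comp fun p => decide (p.1 = φ x ∧ p.2.1 = θ x ∧ p.2.2 = true))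
    (fun z => by
      by_cases hz : φ z = φ x
      · by_cases hz' : θ z = θ x
        · obtain ⟨y, hy, hy'⟩ := hgen z true
          obtain ⟨h1, h2⟩ := Prod.ext_iff.1 hy
          exact ⟨y, h1, by simp_all⟩
        · exact ⟨z, rfl, by simp [hz']⟩
      · exact ⟨z, rfl, by simp [hz]⟩)
    (fun z => by
      by_cases hz : φ z = φ x ∧ θ z = θ x ∧ ρ z = true
      · exact ⟨z, rfl, by simp [hz.1, hz.2.1, hz.2.2]⟩
      · by_cases hz' : φ z = φ x
        · exact ⟨x', by rw [hz', hx], by simp [hz, Ne.symm hne]⟩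
        · exact ⟨z, rfl, by simp [hz']⟩)
  obtain ⟨n, hn0, -, hn⟩ := Subgroup.exists_pow_mem_of_relIndex_ne_zero h hg
  obtain ⟨y, hy, hy'⟩ := hgen x false
  obtain ⟨h1, h2⟩ := Prod.ext_iff.1 hy
  simp only at h1 h2
  obtain ⟨m, rfl⟩ : ∃ m, n = m + 1 := ⟨n - 1, by omega⟩
  -- `y` lies in the piece but outside the half. Its preimage `z` under the power of `g` is in the
  -- piece again, so `y` would have to lie in the half.
  set z := (g ^ (m + 1))⁻¹ y
  have hz : (g ^ (m + 1)) z = y := (g ^ (m + 1)).apply_symm_apply y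
  have hzφ : φ z = φ x := by
    rw [← h1, ← hz]; exact (pow_mem hg (m + 1) z).symm
  have hzθ : θ z = θ x := by
    rw [← h2, ← hz]; exact (hn.1 z).symm
  have key : ∀ (j : ℕ), φ ((g ^ j) z) = φ x ∧ θ ((g ^ j) z) = θ x := by
    intro j
    induction j with
    | zero => exact ⟨hzφ, hzθ⟩
    | succ j ih =>
      have := hg' ((g ^ j) z)
      simp only [ih, and_self, decide_true, decide_eq_true_eq] at this
      rw [pow_succ']
      exact ⟨this.1, this.2.1⟩
  have := hg' ((g ^ m) z)
  simp only [key m, and_self, decide_true, decide_eq_true_eq] at this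
  have h3 : g ((g ^ m) z) = y := by rw [← hz, pow_succ']; rfl
  rw [h3, hy'] at this
  simp at this

end Cantor

/-! ### Merging two colours inside a subgroup -/

namespace Cantor

theorem isLocallyConstant_comp_homeo {F : Type} {φ : Cantor → F} (hφ : IsLocallyConstant φ)
    (g : CantorGroup) : IsLocallyConstant fun x => φ (g x) :=
  hφ.comp_continuous g.continuous

section Merge

variable {E F : Type} [DecidableEq E] [DecidableEq F]

/-- Identifying the colours `i` and `j`. -/
def merge (i j a : F) : F := if a = j then i else a

theorem merge_eq_iff {i j a : F} : merge i j a = i ↔ a = i ∨ a = j := by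
  unfold merge; split_ifs with h <;> simp [h]

theorem eq_of_merge_eq {i j a b : F} (h : merge i j a = merge i j b) (ha : merge i j a ≠ i) :
    a = b := by
  unfold merge at h ha; split_ifs at h ha <;> simp_all

/-- The colouring that is changed to the generic one (given by `ρ`) on the part of the union of the
colours `i`, `j` of `φ` where `θ` has the value `c`. -/
def mix (i j : F) (φ : Cantor → F) (ρ : Cantor → Bool) (θ : Cantor → E) (c : E) (a : Cantor → F) :
    Cantor → F :=
  fun x => if merge i j (φ x) = i ∧ θ x = c then (if ρ x then i else j) else a x

variable {i j : F} {φ a : Cantor → F} {ρ : Cantor → Bool} {θ : Cantor → E} {c : E}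

theorem isLocallyConstant_mix (hφ : IsLocallyConstant φ) (hρ : IsLocallyConstant ρ)
    (hθ : IsLocallyConstant θ) (ha : IsLocallyConstant a) :
    IsLocallyConstant (mix i j φ ρ θ c a) :=
  (hφ.prodMk (hρ.prodMk (hθ.prodMk ha))).comp fun p =>
    if merge i j p.1 = i ∧ p.2.2.1 = c then (if p.2.1 then i else j) else p.2.2.2

theorem merge_mix (ha : ∀ x, merge i j (a x) = merge i j (φ x)) (x : Cantor) :
    merge i j (mix i j φ ρ θ c a x) = merge i j (φ x) := by
  unfold mix
  split_ifs with h h'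
  · rw [h.1, merge_eq_iff]; simp
  · rw [h.1, merge_eq_iff]; simp
  · exact ha x

/-- Both colourings agree outside the region where `φ` has one of the merged colours and `θ = c`.
Inside it both use only `i` and `j`. The generic colouring shows both colours on every part that
matters, and `hi`, `hj` provide them for `a`, so the two have the same colours on each fibre of `θ`.
-/
theorem exists_mix (hφ : IsLocallyConstant φ) (hρ : IsLocallyConstant ρ)
    (hθ : IsLocallyConstant θ) (ha : IsLocallyConstant a)
    (hm : ∀ x, merge i j (a x) = merge i j (φ x))
    (hgen : ∀ x b, ∃ y, φ y = φ x ∧ θ y = θ x ∧ ρ y = b)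
    (hi : ∃ y, θ y = c ∧ a y = i) (hj : ∃ y, θ y = c ∧ a y = j) :
    ∃ g ∈ colorStab θ, ∀ x, mix i j φ ρ θ c a (g x) = a x := by
  refine exists_mem_colorStab hθ ha (isLocallyConstant_mix hφ hρ hθ ha) (fun x => ?_) fun x => ?_
  · by_cases h : merge i j (φ x) = i ∧ θ x = c
    · have h1 := (hm x).trans h.1
      rcases merge_eq_iff.1 h1 with h2 | h2
      · obtain ⟨y, hy1, hy2, hy3⟩ := hgen x true
        exact ⟨y, hy2, by simp [mix, hy1, hy2, hy3, h, h2]⟩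
      · obtain ⟨y, hy1, hy2, hy3⟩ := hgen x false
        exact ⟨y, hy2, by simp [mix, hy1, hy2, hy3, h, h2]⟩
    · exact ⟨x, rfl, by simp [mix, h]⟩
  · by_cases h : merge i j (φ x) = i ∧ θ x = c
    · by_cases hb : ρ x
      · obtain ⟨y, hy, hy'⟩ := hi
        exact ⟨y, by rw [hy, h.2], by simp [mix, h, hb, hy']⟩
      · obtain ⟨y, hy, hy'⟩ := hj
        exact ⟨y, by rw [hy, h.2], by simp [mix, h, hb, hy']⟩
    · exact ⟨x, rfl, by simp [mix, h]⟩

/-- If a subgroup contains the stabilizers of `φ` and `ψ`, and some fibre of `ψ` meets two fibres of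
`φ`, then it contains the stabilizer of the colouring in which these are united. -/
theorem colorStab_merge_le {U : Subgroup CantorGroup} {ψ : Cantor → E}
    (hφ : IsLocallyConstant φ) (hψ : IsLocallyConstant ψ) (hφU : colorStab φ ≤ U)
    (hψU : colorStab ψ ≤ U) {x₀ x₁ : Cantor} (hx : ψ x₀ = ψ x₁) (hne : φ x₀ ≠ φ x₁) :
    colorStab (fun x => merge (φ x₀) (φ x₁) (φ x)) ≤ U := by
  obtain ⟨ρ, hρ, hgen'⟩ := exists_generic (hφ.prodMk hψ)
  have hgen : ∀ x b, ∃ y, φ y = φ x ∧ ψ y = ψ x ∧ ρ y = b := fun x b => by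
    obtain ⟨y, hy, hb⟩ := hgen' x b
    exact ⟨y, congrArg Prod.fst hy, congrArg Prod.snd hy, hb⟩
  set i := φ x₀ with hi
  set j := φ x₁ with hj
  have hmi : merge i j i = i := merge_eq_iff.2 (Or.inl rfl)
  have hmj : merge i j j = i := merge_eq_iff.2 (Or.inr rfl)
  have hgφ : ∀ x b, ∃ y, φ y = φ x ∧ φ y = φ x ∧ ρ y = b := fun x b => by
    obtain ⟨y, h1, -, h3⟩ := hgen x b
    exact ⟨y, h1, h1, h3⟩
  -- the generic colouring
  set t : Cantor → F := mix i j φ ρ (fun _ => ()) () φ with ht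
  have ht_eq : ∀ x, t x = if merge i j (φ x) = i then (if ρ x then i else j) else φ x := by
    intro x; simp [ht, mix]
  -- two fibres of `φ` give the generic colouring
  have good : ∀ a : Cantor → F, IsLocallyConstant a → (∀ x, merge i j (a x) = merge i j (φ x)) →
      (∃ y, ψ y = ψ x₀ ∧ a y = i) → (∃ y, ψ y = ψ x₀ ∧ a y = j) →
      ∃ g ∈ U, ∀ x, t (g x) = a x := by
    intro a ha hm h1 h2
    -- Mixing on the fibre of `ψ` through `x₀` and `x₁` puts both colours into both fibres `φ = i`
    -- and `φ = j`, since that fibre meets each of them. Each of these fibres can then be mixed by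
    -- an element of `colorStab φ`.
    obtain ⟨g₁, hg₁, e₁⟩ := exists_mix hφ hρ hψ ha hm hgen h1 h2
    set a₁ := mix i j φ ρ ψ (ψ x₀) a
    have ha₁ : IsLocallyConstant a₁ := isLocallyConstant_mix hφ hρ hψ ha
    have hm₁ : ∀ x, merge i j (a₁ x) = merge i j (φ x) := merge_mix hm
    obtain ⟨y, hy1, hy2, hy3⟩ := hgen x₀ true
    obtain ⟨y', hy1', hy2', hy3'⟩ := hgen x₀ false
    obtain ⟨z, hz1, hz2, hz3⟩ := hgen x₁ true
    obtain ⟨z', hz1', hz2', hz3'⟩ := hgen x₁ false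
    rw [← hi] at hy1 hy1'
    rw [← hj] at hz1 hz1'
    rw [← hx] at hz2 hz2'
    obtain ⟨g₂, hg₂, e₂⟩ := exists_mix (c := i) hφ hρ hφ ha₁ hm₁ hgφ
      ⟨y, hy1, by simp [a₁, mix, hy1, hy2, hy3, hmi]⟩
      ⟨y', hy1', by simp [a₁, mix, hy1', hy2', hy3', hmi]⟩
    set a₂ := mix i j φ ρ φ i a₁
    have ha₂ : IsLocallyConstant a₂ := isLocallyConstant_mix hφ hρ hφ ha₁
    have hm₂ : ∀ x, merge i j (a₂ x) = merge i j (φ x) := merge_mix hm₁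
    obtain ⟨g₃, hg₃, e₃⟩ := exists_mix (c := j) hφ hρ hφ ha₂ hm₂ hgφ
      ⟨z, hz1, by simp [a₁, a₂, mix, hz1, hz2, hz3, hmj, Ne.symm hne]⟩
      ⟨z', hz1', by simp [a₁, a₂, mix, hz1', hz2', hz3', hmj, Ne.symm hne]⟩
    refine ⟨g₃ * g₂ * g₁, mul_mem (mul_mem (hφU hg₃) (hφU hg₂)) (hψU hg₁), fun x => ?_⟩
    have e : ∀ x, t x = mix i j φ ρ φ j a₂ x := by
      intro x
      rw [ht_eq]
      by_cases h : merge i j (φ x) = i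
      · rcases merge_eq_iff.1 h with h' | h' <;> simp [mix, a₂, h', hmi, hmj]
      · have h1 : a x = φ x := eq_of_merge_eq (hm x) (by rwa [hm x])
        simp [mix, a₂, a₁, h, h1]
    rw [e]
    change mix i j φ ρ φ j a₂ (g₃ (g₂ (g₁ x))) = a x
    rw [e₃, e₂, e₁]
  -- If `a` shows both colours on the fibre of `φ` through `x₀` or `x₁`, mixing that fibre brings
  -- both colours into the fibre of `ψ`. Otherwise `a` is constant on each of the two fibres, and
  -- the constants differ because both colours occur; then `x₀` and `x₁` themselves show both
  -- colours on one fibre of `ψ`.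
  have all : ∀ a : Cantor → F, IsLocallyConstant a → (∀ x, merge i j (a x) = merge i j (φ x)) →
      (∃ y, a y = i) → (∃ y, a y = j) → ∃ g ∈ U, ∀ x, t (g x) = a x := by
    intro a ha hm h1 h2
    by_cases hc : ∃ x, (x = x₀ ∨ x = x₁) ∧ (∃ y, φ y = φ x ∧ a y = i) ∧ ∃ y, φ y = φ x ∧ a y = j
    · obtain ⟨x, hxx, h3, h4⟩ := hc
      obtain ⟨g₁, hg₁, e₁⟩ := exists_mix hφ hρ hφ ha hm hgφ h3 h4
      have hψx : ψ x = ψ x₀ := by rcases hxx with rfl | rfl <;> simp [hx]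
      have hmx : merge i j (φ x) = i := by
        rcases hxx with rfl | rfl
        · exact hmi
        · exact hmj
      obtain ⟨y, hy1, hy2, hy3⟩ := hgen x true
      obtain ⟨y', hy1', hy2', hy3'⟩ := hgen x false
      obtain ⟨g, hg, e⟩ := good (mix i j φ ρ φ (φ x) a) (isLocallyConstant_mix hφ hρ hφ ha)
        (merge_mix hm) ⟨y, hy2.trans hψx, by simp [mix, hy1, hy3, hmx]⟩
        ⟨y', hy2'.trans hψx, by simp [mix, hy1', hy3', hmx]⟩
      exact ⟨g * g₁, mul_mem hg (hφU hg₁), fun x => (e _).trans (e₁ x)⟩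
    · have hval : ∀ x, merge i j (φ x) = i → a x = i ∨ a x = j := fun x h =>
        merge_eq_iff.1 ((hm x).trans h)
      have hcell : ∀ y, a y = i ∨ a y = j → φ y = φ x₀ ∨ φ y = φ x₁ := fun y h =>
        merge_eq_iff.1 ((hm y).symm.trans (merge_eq_iff.2 h))
      obtain ⟨y, hy⟩ := h1
      obtain ⟨z, hz⟩ := h2
      push Not at hc
      have c0 := hc x₀ (Or.inl rfl)
      have c1 := hc x₁ (Or.inr rfl)
      have v0 := hval x₀ hmi
      have v1 := hval x₁ hmj
      have hy' := hcell y (Or.inl hy)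
      have hz' := hcell z (Or.inr hz)
      rcases v0 with v0 | v0 <;> rcases v1 with v1 | v1
      · exact absurd hz (by rcases hz' with h | h; exacts [c0 ⟨x₀, rfl, v0⟩ z h, c1 ⟨x₁, rfl, v1⟩ z h])
      · exact good a ha hm ⟨x₀, rfl, v0⟩ ⟨x₁, hx.symm, v1⟩
      · exact good a ha hm ⟨x₁, hx.symm, v1⟩ ⟨x₀, rfl, v0⟩
      · exact absurd v0 (by
          rcases hy' with h | h
          exacts [c0 ⟨y, h, hy⟩ x₀ rfl, absurd v1 (c1 ⟨y, h, hy⟩ x₁ rfl)])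
  intro g hg
  -- Both `φ` and its translate by `g` are related to the generic colouring `t` by elements of `U`,
  -- so `g` agrees up to `U` with an element that fixes `φ`.
  obtain ⟨k₁, hk₁, e₁⟩ := all φ hφ (fun _ => rfl) ⟨x₀, rfl⟩ ⟨x₁, rfl⟩
  obtain ⟨k₂, hk₂, e₂⟩ := all (fun x => φ (g x)) (isLocallyConstant_comp_homeo hφ g) hg
    ⟨g.symm x₀, by simp [hi]⟩ ⟨g.symm x₁, by simp [hj]⟩
  have h1 : g * (k₂⁻¹ * k₁) ∈ colorStab φ := fun x => by
    have := e₂ ((k₂⁻¹ * k₁) x)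
    rw [← e₁ x]
    refine this.symm.trans ?_
    congr 1
    exact k₂.apply_symm_apply _
  have h2 : k₂⁻¹ * k₁ ∈ U := mul_mem (inv_mem hk₂) hk₁
  exact (Subgroup.mul_mem_cancel_right U h2).1 (hφU h1)

end Merge

end Cantor

/-! ### Open subgroups and their weights -/

namespace Cantor

/-- Every colouring is equivalent to a surjective one. -/
theorem exists_fin_coloring {F : Type} {φ : Cantor → F} (hφ : IsLocallyConstant φ) :
    ∃ (n : ℕ) (ψ : Cantor → Fin (n + 1)), IsLocallyConstant ψ ∧ Function.Surjective ψ ∧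
      colorStab ψ = colorStab φ := by
  have : Finite (Set.range φ) := hφ.range_finite
  obtain ⟨n, ⟨e⟩⟩ := Finite.exists_equiv_fin (Set.range φ)
  obtain _ | n := n
  · exact (e ⟨φ fun _ => false, _, rfl⟩).elim0
  let ψ : Cantor → Fin (n + 1) := fun x => e ⟨φ x, x, rfl⟩
  have h1 : ∀ x y, ψ x = ψ y ↔ φ x = φ y := by
    intro x y
    rw [e.injective.eq_iff]; exact Subtype.mk_eq_mk
  refine ⟨n, ψ, (IsLocallyConstant.desc (fun x => (⟨φ x, x, rfl⟩ : Set.range φ)) Subtype.val hφ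
      Subtype.val_injective).comp e, fun i => ?_,
    le_antisymm (colorStab_le_of_factor fun x y => (h1 x y).1)
      (colorStab_le_of_factor fun x y => (h1 x y).2)⟩
  obtain ⟨x, hx⟩ := (e.symm i).2
  exact ⟨x, by rw [← e.apply_symm_apply i]; exact congrArg e (Subtype.ext hx)⟩

/-- Equal stabilizers force each colouring to factor through the other. The number of colours is
thus an invariant of the subgroup, as the sign in `weight` requires. -/
theorem ncard_range_eq_of_colorStab_eq {E F : Type} {φ : Cantor → E} {ψ : Cantor → F}
    (hφ : IsLocallyConstant φ) (hψ : IsLocallyConstant ψ) (h : colorStab φ = colorStab ψ) :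
    (Set.range φ).ncard = (Set.range ψ).ncard :=
  le_antisymm (ncard_range_le_of_factor hψ fun _ _ => eq_of_colorStab_le hψ hφ h.ge)
    (ncard_range_le_of_factor hφ fun _ _ => eq_of_colorStab_le hφ hψ h.le)

/-- Colours may be taken to be natural numbers. -/
theorem exists_nat_coloring {F : Type} {φ : Cantor → F} (hφ : IsLocallyConstant φ) :
    ∃ ψ : Cantor → ℕ, IsLocallyConstant ψ ∧ colorStab ψ = colorStab φ := by
  obtain ⟨n, ψ, h1, -, h2⟩ := exists_fin_coloring hφ
  refine ⟨fun x => ψ x, h1.comp Fin.val, h2 ▸ ?_⟩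
  exact le_antisymm (colorStab_le_of_factor fun x y => Fin.ext)
    (colorStab_le_of_factor fun x y => congrArg Fin.val)

/-- Every open subgroup contains the stabilizer of some colouring. -/
theorem exists_colorStab_le {U : Subgroup CantorGroup} (hU : IsOpen (U : Set CantorGroup)) :
    ∃ φ : Cantor → ℕ, IsLocallyConstant φ ∧ colorStab φ ≤ U := by
  classical
  obtain ⟨S, hS⟩ := exists_stab_subset U hU
  let χ (x : Cantor) : S → Bool := fun A => (A.1 : Set Cantor).boolIndicator x
  have hχ : Continuous χ := continuous_pi fun A =>
    (continuous_boolIndicator_iff_isClopen _).2 A.1.isClopen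
  obtain ⟨φ, hφ, e⟩ := exists_nat_coloring ((IsLocallyConstant.iff_continuous χ).2 hχ)
  refine ⟨φ, hφ, e ▸ fun h hh => hS h fun A hA => ?_⟩
  have : ∀ x, h x ∈ A ↔ x ∈ A := fun x => by
    have := congrFun (hh x) ⟨A, hA⟩
    simp only [χ, Set.boolIndicator] at this
    by_cases h1 : h x ∈ A <;> by_cases h2 : x ∈ A <;> simp_all
  ext y
  constructor
  · rintro ⟨x, hx, rfl⟩
    exact (this x).2 hx
  · intro hy
    exact ⟨h.symm y, (this _).1 (by simpa using hy), by simp⟩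

/-- Every open subgroup contains the stabilizer of some colouring with finite index. -/
theorem exists_colorStab_relIndex_ne_zero {U : Subgroup CantorGroup}
    (hU : IsOpen (U : Set CantorGroup)) :
    ∃ φ : Cantor → ℕ, IsLocallyConstant φ ∧ colorStab φ ≤ U ∧ (colorStab φ).relIndex U ≠ 0 := by
  classical
  -- The colouring is chosen with the fewest colours among those whose stabilizer lies in `U`.
  let P : ℕ → Prop := fun n => ∃ φ : Cantor → ℕ, IsLocallyConstant φ ∧ colorStab φ ≤ U ∧
    (Set.range φ).ncard = n
  have hP : ∃ n, P n := by
    obtain ⟨φ, h1, h2⟩ := exists_colorStab_le hU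
    exact ⟨_, φ, h1, h2, rfl⟩
  obtain ⟨φ, hφ, hφU, hn⟩ := Nat.find_spec hP
  -- Every competitor refines `φ`: otherwise one of its fibres meets two fibres of `φ`, and
  -- `colorStab_merge_le` allows merging these two, which saves a colour.
  have hmin : ∀ ψ : Cantor → ℕ, IsLocallyConstant ψ → colorStab ψ ≤ U →
      ∀ x y, ψ x = ψ y → φ x = φ y := by
    intro ψ hψ hψU x y hxy
    by_contra hne
    have h1 := colorStab_merge_le hφ hψ hφU hψU hxy hne
    have h2 : (Set.range fun z => merge (φ x) (φ y) (φ z)) ⊂ Set.range φ := by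
      refine ⟨?_, fun h => ?_⟩
      · rintro _ ⟨z, rfl⟩
        simp only [merge]
        split_ifs
        · exact ⟨x, rfl⟩
        · exact ⟨z, rfl⟩
      · obtain ⟨z, hz⟩ := h ⟨y, rfl⟩
        simp only [merge] at hz
        split_ifs at hz with h3
        · exact hne hz
        · exact h3 hz
    have h3 := Set.ncard_lt_ncard h2 hφ.range_finite
    rw [hn] at h3
    exact Nat.find_min hP h3 ⟨_, hφ.comp (merge (φ x) (φ y)), h1, rfl⟩
  refine ⟨φ, hφ, hφU, ?_⟩
  -- The translate of `φ` by `u` has a stabilizer conjugate under `U`, so it is a competitor. Its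
  -- refining `φ` means that `U` permutes the fibres of `φ`.
  have hfac : ∀ u ∈ U, ∀ x y, φ x = φ y → φ (u x) = φ (u y) := by
    intro u hu x y hxy
    refine hmin (fun z => φ (u⁻¹ z)) (isLocallyConstant_comp_homeo hφ _) ?_ _ _ ?_
    · intro g hg
      have h1 : u⁻¹ * g * u ∈ colorStab φ := fun z => by
        refine (hg (u z)).trans ?_
        exact congrArg φ (u.symm_apply_apply z)
      have h2 := mul_mem (mul_mem hu (hφU h1)) (inv_mem hu)
      simpa [mul_assoc] using h2
    · simpa [Homeomorph.inv_apply] using hxy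
  have : Finite (Set.range φ) := hφ.range_finite
  let r : Set.range φ → Cantor := fun c => c.2.choose
  have hr : ∀ c, φ (r c) = c := fun c => c.2.choose_spec
  -- A coset is determined by its action on the finitely many colours, so there are finitely many
  -- cosets.
  let f : U ⧸ (colorStab φ).subgroupOf U → Set.range φ → Set.range φ :=
    fun q c => ⟨φ ((q.out.1)⁻¹ (r c)), ⟨_, rfl⟩⟩
  have hf : Function.Injective f := by
    intro q q' h
    rw [← QuotientGroup.out_eq' q, ← QuotientGroup.out_eq' q', QuotientGroup.eq,
      Subgroup.mem_subgroupOf]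
    intro x
    set y := q'.out.1 x with hy
    have h2 : φ ((q.out.1)⁻¹ (r ⟨φ y, y, rfl⟩)) = φ ((q'.out.1)⁻¹ (r ⟨φ y, y, rfl⟩)) :=
      congrArg Subtype.val (congrFun h ⟨φ y, ⟨y, rfl⟩⟩)
    rw [hfac _ (inv_mem q.out.2) _ y (hr _), hfac _ (inv_mem q'.out.2) _ y (hr _)] at h2
    exact h2.trans (congrArg φ (q'.out.1.symm_apply_apply x))
  have := Finite.of_injective f hf
  exact Subgroup.index_ne_zero_of_finite

/-- The weight `(-1) ^ (n - 1) / [U : H]` of an open subgroup `U` that contains the stabilizer `H`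
of a colouring with `n` colours as a subgroup of finite index. -/
def weight (U : Subgroup CantorGroup) : ℚ :=
  open Classical in
  if h : ∃ φ : Cantor → ℕ, IsLocallyConstant φ ∧ colorStab φ ≤ U ∧ (colorStab φ).relIndex U ≠ 0
  then -(-1) ^ (Set.range h.choose).ncard / (colorStab h.choose).relIndex U
  else 0

/-- Independence of the choice made in `weight`: two colour stabilizers of finite index in `U` have
finite index relative to each other, hence coincide by `colorStab_le_of_relIndex_ne_zero`. -/
theorem weight_eq {F : Type} {φ : Cantor → F} {U : Subgroup CantorGroup} (hφ : IsLocallyConstant φ)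
    (h : colorStab φ ≤ U) (h' : (colorStab φ).relIndex U ≠ 0) :
    weight U = -(-1) ^ (Set.range φ).ncard / (colorStab φ).relIndex U := by
  have hex : ∃ φ : Cantor → ℕ, IsLocallyConstant φ ∧ colorStab φ ≤ U ∧
      (colorStab φ).relIndex U ≠ 0 := by
    obtain ⟨ψ, h1, h2⟩ := exists_nat_coloring hφ
    exact ⟨ψ, h1, h2 ▸ h, h2 ▸ h'⟩
  rw [weight, dif_pos hex]
  obtain ⟨h1, h2, h3⟩ := hex.choose_spec
  set ψ := hex.choose
  have l1 : colorStab φ ≤ colorStab ψ := colorStab_le_of_relIndex_ne_zero hφ h1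
    fun h0 => h3 (Subgroup.relIndex_eq_zero_of_le_right h h0)
  have l2 : colorStab ψ ≤ colorStab φ := colorStab_le_of_relIndex_ne_zero h1 hφ
    fun h0 => h' (Subgroup.relIndex_eq_zero_of_le_right h2 h0)
  rw [le_antisymm l2 l1, ncard_range_eq_of_colorStab_eq hφ h1 (le_antisymm l1 l2)]

theorem weight_colorStab {F : Type} {φ : Cantor → F} (hφ : IsLocallyConstant φ) :
    weight (colorStab φ) = -(-1) ^ (Set.range φ).ncard := by
  rw [weight_eq hφ le_rfl (by simp)]; simp

/-- An open subgroup never takes the default value in `weight`. This is the source of regularity,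
and it permits cancelling sizes in the base change arguments. -/
theorem weight_ne_zero {U : Subgroup CantorGroup} (hU : IsOpen (U : Set CantorGroup)) :
    weight U ≠ 0 := by
  obtain ⟨φ, h1, h2, h3⟩ := exists_colorStab_relIndex_ne_zero hU
  rw [weight_eq h1 h2 h3]
  exact div_ne_zero (neg_ne_zero.2 (pow_ne_zero _ (by norm_num))) (Nat.cast_ne_zero.2 h3)

/-- A colour stabilizer of finite index in `V` has finite index in `U` too, so both weights carry
the same sign and multiplicativity of the index gives the ratio. -/
theorem weight_eq_relIndex_mul {U V : Subgroup CantorGroup} (hV : IsOpen (V : Set CantorGroup))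
    (h : V ≤ U) (h' : V.relIndex U ≠ 0) : weight V = V.relIndex U * weight U := by
  obtain ⟨φ, h1, h2, h3⟩ := exists_colorStab_relIndex_ne_zero hV
  have e := Subgroup.relIndex_mul_relIndex _ _ _ h2 h
  rw [weight_eq h1 h2 h3, weight_eq h1 (h2.trans h) (by rw [← e]; exact mul_ne_zero h3 h'), ← e]
  have : (V.relIndex U : ℚ) ≠ 0 := Nat.cast_ne_zero.2 h'
  have : ((colorStab φ).relIndex V : ℚ) ≠ 0 := Nat.cast_ne_zero.2 h3
  push_cast
  field_simp

/-- Conjugation moves the colouring and keeps the colours. It makes the weight of an orbit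
independent of the chosen point. -/
theorem weight_map_conj {U : Subgroup CantorGroup} (hU : IsOpen (U : Set CantorGroup))
    (g : CantorGroup) : weight (U.map (MulAut.conj g).toMonoidHom) = weight U := by
  obtain ⟨φ, h1, h2, h3⟩ := exists_colorStab_relIndex_ne_zero hU
  have hinj : Function.Injective (MulAut.conj g).toMonoidHom := (MulAut.conj g).injective
  have e : colorStab (fun x => φ (g⁻¹ x)) = (colorStab φ).map (MulAut.conj g).toMonoidHom := by
    ext h
    constructor
    · intro hh
      refine ⟨g⁻¹ * h * g, fun x => ?_, by simp [mul_assoc]⟩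
      refine (hh (g x)).trans ?_
      exact congrArg φ (g.symm_apply_apply x)
    · rintro ⟨k, hk, rfl⟩ x
      refine Eq.trans ?_ (hk (g⁻¹ x))
      refine congrArg φ ?_
      exact g.symm_apply_apply _
  have hr : (Set.range fun x => φ (g⁻¹ x)) = Set.range φ := (g⁻¹).surjective.range_comp φ
  have e' : (colorStab fun x => φ (g⁻¹ x)).relIndex (U.map (MulAut.conj g).toMonoidHom) =
      (colorStab φ).relIndex U := by
    rw [e, Subgroup.relIndex_map_map_of_injective _ _ hinj]
  rw [weight_eq h1 h2 h3, weight_eq (isLocallyConstant_comp_homeo h1 g⁻¹)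
    (e ▸ Subgroup.map_mono h2) (by rwa [e']), hr, e']

end Cantor

/-! ### Alternating sums over finite sets of colours -/

section Combinatorics

open Finset

variable {A B C D E : Type*} [DecidableEq A] [DecidableEq B] [DecidableEq C] [DecidableEq D]
  [DecidableEq E]

/-- Möbius inversion on the Boolean lattice: the sets between `X` and `S` are the `X ∪ Q` with `Q ⊆
S \ X`, and their signs cancel unless `S \ X` is empty. -/
theorem sum_neg_one_pow_card_of_superset (X S : Finset D) :
    ∑ R ∈ S.powerset with X ⊆ R, (-1 : ℤ) ^ #R = if X = S then (-1) ^ #S else 0 := by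
  by_cases h : X ⊆ S
  · have e : {R ∈ S.powerset | X ⊆ R} = (S \ X).powerset.image (X ∪ ·) := by
      rw [← Finset.Icc_eq_image_powerset h]
      ext R; simp [and_comm]
    have hd : ∀ Q ∈ (S \ X).powerset, Disjoint X Q := fun Q hQ =>
      disjoint_of_subset_right (mem_powerset.1 hQ) disjoint_sdiff
    rw [e, sum_image fun Q hQ Q' hQ' (hh : X ∪ Q = X ∪ Q') => by
      rw [← union_sdiff_cancel_left (hd Q hQ), hh, union_sdiff_cancel_left (hd Q' hQ')]]
    rw [sum_congr rfl fun Q hQ => by rw [card_union_of_disjoint (hd Q hQ), pow_add], ← mul_sum,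
      sum_powerset_neg_one_pow_card]
    by_cases hXS : X = S
    · simp [hXS]
    · rw [if_neg hXS, if_neg, mul_zero]
      exact fun h0 => hXS (h.antisymm (sdiff_eq_empty_iff_subset.1 h0))
  · rw [if_neg (fun h0 => h h0.le), filter_false_of_mem, sum_empty]
    exact fun R hR hX => h (hX.trans (mem_powerset.1 hR))

/-- The alternating sum over all `d ⊆ T` with image `S` under `p`, by inclusion-exclusion. -/
theorem sum_neg_one_pow_card_image_eq_aux (p : E → D) (S : Finset D) (𝒟 : Finset (Finset E)) :
    ∑ d ∈ 𝒟 with d.image p = S, (-1 : ℤ) ^ #d =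
      (-1) ^ #S * ∑ R ∈ S.powerset, (-1) ^ #R * ∑ d ∈ 𝒟 with d.image p ⊆ R, (-1) ^ #d := by
  simp only [sum_filter, mul_sum]
  rw [sum_comm]
  refine sum_congr rfl fun d _ => ?_
  have := sum_neg_one_pow_card_of_superset (d.image p) S
  rw [sum_filter] at this
  have h2 : ∀ R ∈ S.powerset, (-1 : ℤ) ^ #S * ((-1) ^ #R * if d.image p ⊆ R then (-1) ^ #d else 0) =
      ((-1) ^ #S * (-1) ^ #d) * if d.image p ⊆ R then (-1) ^ #R else 0 := by
    intro R _
    split_ifs <;> ring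
  rw [sum_congr rfl h2, ← mul_sum, this]
  split_ifs
  · rw [mul_right_comm, ← pow_add, Even.neg_one_pow ⟨_, rfl⟩, one_mul]
  · simp

/-- After inclusion-exclusion over `R ⊆ S`, the inner sum runs over all subsets of the part of `T`
above `R` and vanishes unless this part is empty. When `S ⊆ p(T)`, that leaves only `R = ∅`. This is
the combinatorial content of `push_indicator`. -/
theorem sum_neg_one_pow_card_image_eq (p : E → D) (T : Finset E) (S : Finset D) :
    ∑ d ∈ T.powerset with d.image p = S, (-1 : ℤ) ^ #d =
      if S ⊆ T.image p then (-1) ^ #S else 0 := by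
  split_ifs with h
  · rw [sum_neg_one_pow_card_image_eq_aux, sum_eq_single ∅]
    · have : {d ∈ T.powerset | d.image p ⊆ ∅} = {∅} := by
        ext d; simp; rintro rfl; simp
      rw [this]; simp
    · intro R hR hne
      have : {d ∈ T.powerset | d.image p ⊆ R} = {e ∈ T | p e ∈ R}.powerset := by
        ext d; simp [subset_iff]; grind
      rw [this, sum_powerset_neg_one_pow_card, if_neg, mul_zero]
      obtain ⟨i, hi⟩ := nonempty_iff_ne_empty.2 hne
      obtain ⟨e, he, rfl⟩ := mem_image.1 (h (mem_powerset.1 hR hi))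
      exact ne_empty_of_mem (mem_filter.2 ⟨he, hi⟩)
    · simp
  · rw [filter_false_of_mem, sum_empty]
    rintro d hd rfl
    exact h (image_subset_image (mem_powerset.1 hd))

/-- The alternating sum over all subsets of a fibre product that surject onto both factors. -/
theorem sum_neg_one_pow_card_fiberProduct [Fintype A] [Fintype B] [Fintype C] (s : A → C)
    (t : B → C) (hs : Function.Surjective s) (ht : Function.Surjective t) :
    ∑ d : Finset (A × B) with (∀ e ∈ d, s e.1 = t e.2) ∧ d.image Prod.fst = univ ∧
      d.image Prod.snd = univ, (-1 : ℤ) ^ #d =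
      (-1) ^ (Fintype.card A + Fintype.card B + Fintype.card C) := by
  set E : Finset (A × B) := {e | s e.1 = t e.2} with hE
  have e1 : ({d : Finset (A × B) | (∀ e ∈ d, s e.1 = t e.2) ∧ d.image Prod.fst = univ ∧
      d.image Prod.snd = univ} : Finset (Finset (A × B))) =
      {d ∈ {d ∈ E.powerset | d.image Prod.fst = univ} | d.image Prod.snd = univ} := by
    ext d; simp [hE, subset_iff, and_assoc]
  -- Inclusion-exclusion is applied to surjectivity onto `B`; surjectivity onto `A` is kept as a
  -- condition on the summands.
  rw [e1, sum_neg_one_pow_card_image_eq_aux, powerset_univ]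
  -- The part of the fibre product above `R` surjects onto `A` exactly when `t(R)` is all of `C`,
  -- because `s` is surjective.
  have e2 : ∀ R : Finset B, ∑ d ∈ {d ∈ E.powerset | d.image Prod.fst = univ} with
      d.image Prod.snd ⊆ R, (-1 : ℤ) ^ #d =
      if R.image t = univ then (-1) ^ Fintype.card A else 0 := by
    intro R
    have e3 : {d ∈ {d ∈ E.powerset | d.image Prod.fst = univ} | d.image Prod.snd ⊆ R} =
        {d ∈ {e ∈ E | e.2 ∈ R}.powerset | d.image Prod.fst = univ} := by
      ext d; simp only [mem_filter, mem_powerset, subset_iff, mem_image]; grind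
    rw [e3, sum_neg_one_pow_card_image_eq, card_univ]
    congr 1
    rw [eq_iff_iff]
    constructor
    · intro h
      refine eq_univ_iff_forall.2 fun c => ?_
      obtain ⟨a, rfl⟩ := hs c
      obtain ⟨e, he, rfl⟩ := mem_image.1 (h (mem_univ a))
      simp only [hE, mem_filter, mem_univ, true_and] at he
      exact mem_image.2 ⟨_, he.2, he.1.symm⟩
    · intro h a _
      obtain ⟨b, hb, hb'⟩ := mem_image.1 (h ▸ mem_univ (s a))
      exact mem_image.2 ⟨(a, b), by simp [hE, hb, hb'], rfl⟩
  -- The remaining sum over the `R` with `t(R) = C` has the same form, now for `t`.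
  have e4 := sum_neg_one_pow_card_image_eq t univ univ
  rw [if_pos (by rw [image_univ_of_surjective ht]), sum_filter, powerset_univ] at e4
  simp only [e2]
  have e5 : ∀ R : Finset B, (-1 : ℤ) ^ #R * (if R.image t = univ then (-1) ^ Fintype.card A else 0) =
      (-1) ^ Fintype.card A * if R.image t = univ then (-1) ^ #R else 0 := by
    intro R; split_ifs <;> ring
  rw [sum_congr rfl fun R _ => e5 R, ← mul_sum, e4, card_univ, card_univ]
  ring

end Combinatorics

/-! ### `G`-sets whose points are colourings -/

open GSet

theorem Cantor.exists_range_eq {F : Type} {d : Finset F} (hd : d.Nonempty) :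
    ∃ φ : Cantor → F, IsLocallyConstant φ ∧ Set.range φ = d := by
  have : Nonempty d := hd.to_subtype
  let _ : TopologicalSpace d := ⊥
  have : DiscreteTopology d := ⟨rfl⟩
  obtain ⟨e⟩ := Cantor.finite_prod d
  refine ⟨fun x => (e.symm x).1, ((IsLocallyConstant.iff_continuous fun x => (e.symm x).1).2
    (continuous_fst.comp e.symm.continuous)).comp Subtype.val, ?_⟩
  ext f
  constructor
  · rintro ⟨x, rfl⟩
    exact (e.symm x).1.2
  · intro hf
    exact ⟨e (⟨f, hf⟩, fun _ => false), by simp⟩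

/-- An identification of the points of a `G`-set with certain colourings of the Cantor space. -/
structure Coloring (X : GSet CantorGroup) (F : Type) where
  /-- the colouring that corresponds to a point -/
  col : X → Cantor → F
  isLocallyConstant : ∀ x, IsLocallyConstant (col x)
  col_smul : ∀ (g : CantorGroup) (x : X) (c : Cantor), col (g • x) c = col x (g⁻¹ c)
  injective : Function.Injective col

namespace Coloring

variable {X Y Z P : GSet CantorGroup} {F F' : Type}

/-- The set of colours that occur at a point. -/
def ran (c : Coloring X F) (x : X) : Finset F := (c.isLocallyConstant x).range_finite.toFinset

theorem coe_ran (c : Coloring X F) (x : X) : (c.ran x : Set F) = Set.range (c.col x) :=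
  Set.Finite.coe_toFinset _

theorem mem_ran (c : Coloring X F) {x : X} {f : F} : f ∈ c.ran x ↔ ∃ t, c.col x t = f := by
  rw [← Finset.mem_coe, coe_ran]; rfl

theorem ncard_range (c : Coloring X F) (x : X) :
    (Set.range (c.col x)).ncard = (c.ran x).card := by
  rw [← coe_ran, Set.ncard_coe_finset]

theorem ran_nonempty (c : Coloring X F) (x : X) : (c.ran x).Nonempty :=
  ⟨_, c.mem_ran.2 ⟨fun _ => false, rfl⟩⟩

/-- Colourings with equal ranges differ by a homeomorphism (`Cantor.exists_homeomorph`), so the set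
of colours in use is a complete invariant of the orbit. -/
theorem orb_eq_iff (c : Coloring X F) {x y : X} : X.orb x = X.orb y ↔ c.ran x = c.ran y := by
  rw [← Finset.coe_inj, coe_ran, coe_ran, orb_eq]
  constructor
  · rintro ⟨g, rfl⟩
    have : c.col (g • y) = c.col y ∘ (g⁻¹ : CantorGroup) := funext (c.col_smul g y)
    rw [this, (g⁻¹ : CantorGroup).surjective.range_comp]
  · intro h
    let _ : TopologicalSpace F := ⊥
    have : DiscreteTopology F := ⟨rfl⟩
    obtain ⟨g, hg⟩ := Cantor.exists_homeomorph _ _ (c.isLocallyConstant y).continuous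
      (c.isLocallyConstant x).continuous h.symm
    refine ⟨g, c.injective (funext fun t => ?_)⟩
    rw [c.col_smul, ← hg]
    exact congrArg _ (g.apply_symm_apply t)

theorem stabilizer_eq (c : Coloring X F) (x : X) :
    MulAction.stabilizer CantorGroup x = Cantor.colorStab (c.col x) := by
  ext g
  rw [MulAction.mem_stabilizer_iff, ← inv_mem_iff (x := g)]
  constructor
  · intro h t
    rw [← c.col_smul, h]
  · intro h
    exact c.injective (funext fun t => (c.col_smul g x t).trans (h t))

/-- The bridge from measures to combinatorics: sums over orbits become sums over finite sets of
colours. -/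
theorem sum_orb (c : Coloring X F) {R : Type*} [AddCommMonoid R] (𝒟 : Finset (Finset F))
    (h𝒟 : ∀ d, d ∈ 𝒟 ↔ ∃ x, c.ran x = d) (h : X.Orb → R) (h' : Finset F → R)
    (hh : ∀ x, h (X.orb x) = h' (c.ran x)) : ∑ w, h w = ∑ d ∈ 𝒟, h' d := by
  refine Finset.sum_bij (fun w _ => c.ran w.out) (fun w _ => (h𝒟 _).2 ⟨_, rfl⟩) ?_ ?_ ?_
  · intro a _ b _ hab
    rw [← a.out_eq, ← b.out_eq]
    exact c.orb_eq_iff.2 hab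
  · intro d hd
    obtain ⟨x, rfl⟩ := (h𝒟 d).1 hd
    exact ⟨X.orb x, Finset.mem_univ _, c.orb_eq_iff.1 (Quotient.out_eq _)⟩
  · intro w _
    rw [← hh]
    congr 1
    exact w.out_eq.symm

/-- The points of `Y(n)` are colourings with `n` colours. -/
def setY (n : ℕ) : Coloring (setY n) (Fin n) where
  col φ := φ.1
  isLocallyConstant φ := (IsLocallyConstant.iff_continuous _).2 φ.2
  col_smul _ _ _ := rfl
  injective _ _ h := ContinuousMap.ext (congrFun h)

/-- The points of `X(n)` are colourings with `n` colours. -/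
def setX (n : ℕ) : Coloring (setX n) (Fin n) where
  col φ := φ.1.1
  isLocallyConstant φ := (IsLocallyConstant.iff_continuous _).2 φ.1.2
  col_smul _ _ _ := rfl
  injective _ _ h := Subtype.ext (ContinuousMap.ext (congrFun h))

/-- Colourings of a fibre product. -/
def fiberProduct {p : P →[CantorGroup] X} {q : P →[CantorGroup] Y} {f : X →[CantorGroup] Z}
    {g : Y →[CantorGroup] Z} (h : IsCartesian p q f g) (c : Coloring X F) (c' : Coloring Y F') :
    Coloring P (F × F') where
  col a t := (c.col (p a) t, c'.col (q a) t)
  isLocallyConstant a := (c.isLocallyConstant _).prodMk (c'.isLocallyConstant _)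
  col_smul k a t := by rw [p.map_smul, q.map_smul, c.col_smul, c'.col_smul]
  injective a b hab := by
    have h1 : p a = p b := c.injective (funext fun t => congrArg Prod.fst (congrFun hab t))
    have h2 : q a = q b := c'.injective (funext fun t => congrArg Prod.snd (congrFun hab t))
    obtain ⟨_, _, hu⟩ := h.lift (p b) (q b) (h.comm b)
    exact (hu a ⟨h1, h2⟩).trans (hu b ⟨rfl, rfl⟩).symm

/-- Colourings of a product. -/
def prod (c : Coloring X F) (c' : Coloring Y F') : Coloring (X.prod Y) (F × F') where
  col a t := (c.col a.1 t, c'.col a.2 t)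
  isLocallyConstant _ := (c.isLocallyConstant _).prodMk (c'.isLocallyConstant _)
  col_smul k a t := Prod.ext (c.col_smul k a.1 t) (c'.col_smul k a.2 t)
  injective _ _ hab := Prod.ext
    (c.injective (funext fun t => congrArg Prod.fst (congrFun hab t)))
    (c'.injective (funext fun t => congrArg Prod.snd (congrFun hab t)))

end Coloring

theorem setX_transitive (n : ℕ) : (setX (n + 1)).IsTransitive := by
  constructor
  · obtain ⟨φ, h1, h2⟩ := Cantor.exists_range_eq (Finset.univ_nonempty (α := Fin (n + 1)))
    exact ⟨⟨⟨φ, h1.continuous⟩, Set.range_eq_univ.1 (by simpa using h2)⟩⟩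
  · refine ⟨fun x y => ?_⟩
    refine orb_eq.1 (((Coloring.setX (n + 1)).orb_eq_iff (x := y) (y := x)).2 ?_)
    ext i
    rw [Coloring.mem_ran, Coloring.mem_ran]
    exact ⟨fun _ => x.2 i, fun _ => y.2 i⟩

/-! ### The size of a `G`-set as the sum of the weights of its orbits -/

section Size

variable {X Y Z P : GSet CantorGroup}

/-- The weight of an orbit. -/
def orbWeight (X : GSet CantorGroup) (w : X.Orb) : ℚ :=
  Cantor.weight (MulAction.stabilizer CantorGroup w.out)

theorem weight_stabilizer_smul (g : CantorGroup) (x : X) :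
    Cantor.weight (MulAction.stabilizer CantorGroup (g • x)) =
      Cantor.weight (MulAction.stabilizer CantorGroup x) := by
  rw [MulAction.stabilizer_smul_eq_stabilizer_map_conj]
  exact Cantor.weight_map_conj (X.smooth x) g

theorem orbWeight_orb (x : X) :
    orbWeight X (X.orb x) = Cantor.weight (MulAction.stabilizer CantorGroup x) := by
  obtain ⟨g, hg⟩ := orb_eq.1 (Quotient.out_eq (X.orb x))
  rw [orbWeight, ← hg, weight_stabilizer_smul]

theorem orbWeight_ne_zero (w : X.Orb) : orbWeight X w ≠ 0 := Cantor.weight_ne_zero (X.smooth _)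

/-- The total weight of the orbits of a `G`-set. -/
def gsize (X : GSet CantorGroup) : ℚ := ∑ w : X.Orb, orbWeight X w

theorem gsize_eq_of_transitive (hX : X.IsTransitive) (x : X) : gsize X = orbWeight X (X.orb x) := by
  have := hX.2
  refine Finset.sum_eq_single _ (fun w _ hw => absurd ?_ hw) (by simp)
  induction w using Quotient.inductionOn with | h y => ?_
  exact orb_eq.2 (MulAction.exists_smul_eq CantorGroup x y)

theorem gsize_ne_zero (hX : X.IsTransitive) : gsize X ≠ 0 := by
  obtain ⟨x⟩ := hX.1
  rw [gsize_eq_of_transitive hX x]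
  exact orbWeight_ne_zero _

open Classical in
theorem gsize_eq_sum_fiber (f : X →[CantorGroup] Y) :
    gsize X = ∑ v : Y.Orb, ∑ w with orbMap f w = v, orbWeight X w :=
  (Finset.sum_fiberwise _ _ _).symm

theorem stabilizer_le (f : X →[CantorGroup] Y) (x : X) :
    MulAction.stabilizer CantorGroup x ≤ MulAction.stabilizer CantorGroup (f x) := by
  intro g hg
  rw [MulAction.mem_stabilizer_iff] at hg ⊢
  rw [← f.map_smul, hg]

/-- Orbit-stabilizer for the stabilizer of `f x` acting on the fibre of `f`: its orbit through `x`
is the part of the fibre in the `G`-orbit of `x`. Both sides are `0` in the infinite case. -/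
theorem relIndex_stabilizer (f : X →[CantorGroup] Y) (x : X) :
    (MulAction.stabilizer CantorGroup x).relIndex (MulAction.stabilizer CantorGroup (f x)) =
      {z | f z = f x ∧ X.orb z = X.orb x}.ncard := by
  have h1 : (MulAction.stabilizer CantorGroup x).subgroupOf
      (MulAction.stabilizer CantorGroup (f x)) =
      MulAction.stabilizer (MulAction.stabilizer CantorGroup (f x)) x := by
    ext g; rfl
  rw [Subgroup.relIndex, h1, MulAction.index_stabilizer]
  congr 1
  ext z
  constructor
  · rintro ⟨g, rfl⟩
    refine ⟨?_, orb_smul g.1 x⟩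
    exact (f.map_smul g.1 x).trans g.2
  · rintro ⟨h2, h3⟩
    obtain ⟨g, rfl⟩ := orb_eq.1 h3
    exact ⟨⟨g, by rw [MulAction.mem_stabilizer_iff, ← f.map_smul, h2]⟩, rfl⟩

/-- If the fibres of a map have finite size, then the weight of an orbit of the source is
a multiple of the weight of the image. -/
theorem orbWeight_eq_ncard_mul (f : X →[CantorGroup] Y) (x : X)
    (hf : {z | f z = f x}.Finite) :
    orbWeight X (X.orb x) = {z | f z = f x ∧ X.orb z = X.orb x}.ncard *
      orbWeight Y (Y.orb (f x)) := by
  rw [orbWeight_orb, orbWeight_orb,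
    Cantor.weight_eq_relIndex_mul (X.smooth x) (stabilizer_le f x) ?_, relIndex_stabilizer]
  rw [relIndex_stabilizer]
  exact Set.ncard_ne_zero_of_mem (a := x) ⟨rfl, rfl⟩ (hf.subset fun z hz => hz.1)

/-- The size is multiplied by `d` in a covering of degree `d`. -/
theorem gsize_eq_mul_of_fibers (f : X →[CantorGroup] Y) {d : ℕ} (hd : d ≠ 0)
    (hf : ∀ y, {x | f x = y}.ncard = d) : gsize X = d * gsize Y := by
  classical
  rw [gsize_eq_sum_fiber f, gsize, Finset.mul_sum]
  refine Finset.sum_congr rfl fun v _ => ?_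
  induction v using Quotient.inductionOn with | h y => ?_
  have hfin : {x | f x = y}.Finite := Set.finite_of_ncard_ne_zero (by rw [hf]; exact hd)
  -- The `d` points of the fibre over `y` are distributed among the orbits above `y`, and each such
  -- orbit weighs as many times the orbit of `y` as it has points in this fibre.
  have h1 : ∀ w ∈ Finset.univ.filter (fun w => orbMap f w = Y.orb y), orbWeight X w =
      ((hfin.toFinset.filter fun x => X.orb x = w).card : ℚ) * orbWeight Y (Y.orb y) := by
    intro w hw
    induction w using Quotient.inductionOn with | h x => ?_
    obtain ⟨g, hg⟩ := orb_eq.1 (show Y.orb y = Y.orb (f x) from (Finset.mem_filter.1 hw).2.symm)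
    rw [← f.map_smul] at hg
    have e : X.orb x = X.orb (g • x) := (orb_smul g x).symm
    change orbWeight X (X.orb x) = ((hfin.toFinset.filter fun z => X.orb z = X.orb x).card : ℚ) * _
    rw [e, orbWeight_eq_ncard_mul f (g • x) (by rw [hg]; exact hfin), hg,
      ← Set.ncard_coe_finset]
    congr 3
    ext z; simp
  change _ = (d : ℚ) * orbWeight Y (Y.orb y)
  rw [Finset.sum_congr rfl h1, ← Finset.sum_mul, ← Nat.cast_sum,
    ← Finset.card_eq_sum_card_fiberwise (f := X.orb), ← Set.ncard_eq_toFinset_card _ hfin, hf]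
  intro x hx
  have hx' : f x = y := by simpa using hx
  simp [hx']

end Size

/-! ### Fibre products and maps of transitive `G`-sets -/

section FiberProduct

variable {G : Type} [Group G] [TopologicalSpace G] {X Y Z P : GSet G}

theorem exists_isCartesian [RoelckePrecompact G] (f : X →[G] Z) (g : Y →[G] Z) :
    ∃ (P : GSet G) (p : P →[G] X) (q : P →[G] Y), IsCartesian p q f g := by
  let T : Set (X.prod Y).Orb := {w | ∃ x y, f x = g y ∧ (X.prod Y).orb (x, y) = w}
  have hT : ∀ x y, (X.prod Y).orb (x, y) ∈ T ↔ f x = g y := by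
    intro x y
    refine ⟨?_, fun h => ⟨x, y, h, rfl⟩⟩
    rintro ⟨x', y', h, e⟩
    obtain ⟨a, ha⟩ := orb_eq.1 e
    have h1 : a • x = x' := congrArg Prod.fst ha
    have h2 : a • y = y' := congrArg Prod.snd ha
    rw [← h1, ← h2, f.map_smul, g.map_smul] at h
    exact smul_left_cancel a h
  refine ⟨(X.prod Y).sub T, ⟨fun a => a.1.1, fun _ _ => rfl⟩, ⟨fun a => a.1.2, fun _ _ => rfl⟩,
    fun a => (hT _ _).1 a.2, fun x y h => ⟨⟨(x, y), (hT x y).2 h⟩, ⟨rfl, rfl⟩, ?_⟩⟩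
  rintro a ⟨h1, h2⟩
  exact Subtype.ext (Prod.ext h1 h2)

theorem IsCartesian.paste {Y' P' : GSet G} {p : P →[G] X} {q : P →[G] Y} {f : X →[G] Z}
    {g : Y →[G] Z} {p' : P' →[G] P} {q' : P' →[G] Y'} {g' : Y' →[G] Y} (h : IsCartesian p q f g)
    (h' : IsCartesian p' q' q g') : IsCartesian (p.comp p') q' f (g.comp g') := by
  refine ⟨fun a => (h.comm (p' a)).trans (congrArg g (h'.comm a)), fun x y e => ?_⟩
  obtain ⟨b, ⟨hb1, hb2⟩, hb⟩ := h.lift x (g' y) e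
  obtain ⟨a, ⟨ha1, ha2⟩, ha⟩ := h'.lift b y hb2
  refine ⟨a, ⟨(congrArg p ha1).trans hb1, ha2⟩, fun a' h2 => ha a' ⟨hb _ ⟨h2.1, ?_⟩, h2.2⟩⟩
  exact (h'.comm a').trans (congrArg g' h2.2)

theorem IsCartesian.symm {p : P →[G] X} {q : P →[G] Y} {f : X →[G] Z} {g : Y →[G] Z}
    (h : IsCartesian p q f g) : IsCartesian q p g f :=
  ⟨fun a => (h.comm a).symm, fun y x e => by
    obtain ⟨a, ha, hu⟩ := h.lift x y e.symm
    exact ⟨a, ha.symm, fun b hb => hu b hb.symm⟩⟩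

/-- Fibre products are unique up to isomorphism, so a statement about their sizes can be checked on
one model. -/
theorem IsCartesian.exists_bijective {P' : GSet G} {p : P →[G] X} {q : P →[G] Y} {f : X →[G] Z}
    {g : Y →[G] Z} {p' : P' →[G] X} {q' : P' →[G] Y} (h : IsCartesian p q f g)
    (h' : IsCartesian p' q' f g) : ∃ e : P →[G] P', Function.Bijective e := by
  choose e he hu using fun a => h'.lift (p a) (q a) (h.comm a)
  refine ⟨⟨e, fun c a => ?_⟩, fun a b hab => ?_, fun b => ?_⟩
  · refine ((hu (c • a) (c • e a)) ⟨?_, ?_⟩).symm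
    · rw [p'.map_smul, p.map_smul, (he a).1]
    · rw [q'.map_smul, q.map_smul, (he a).2]
  · change e a = e b at hab
    obtain ⟨_, _, hu'⟩ := h.lift (p b) (q b) (h.comm b)
    refine (hu' a ⟨?_, ?_⟩).trans (hu' b ⟨rfl, rfl⟩).symm
    · rw [← (he a).1, hab, (he b).1]
    · rw [← (he a).2, hab, (he b).2]
  · obtain ⟨a, ⟨ha1, ha2⟩, -⟩ := h.lift (p' b) (q' b) (h'.comm b)
    refine ⟨a, (hu a b ⟨ha1.symm, ha2.symm⟩).symm⟩

theorem IsCartesian.ncard_fiber {p : P →[G] X} {q : P →[G] Y} {f : X →[G] Z} {g : Y →[G] Z}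
    (h : IsCartesian p q f g) (x : X) : {a | p a = x}.ncard = {y | g y = f x}.ncard := by
  refine Set.ncard_congr (fun a _ => q a) ?_ ?_ ?_
  · rintro a rfl
    exact (h.comm a).symm
  · rintro a b rfl hb e
    obtain ⟨_, _, hu⟩ := h.lift (p a) (q a) (h.comm a)
    exact (hu a ⟨rfl, rfl⟩).trans (hu b ⟨hb, e.symm⟩).symm
  · intro y hy
    obtain ⟨a, ⟨ha1, ha2⟩, -⟩ := h.lift x y (Eq.symm hy)
    exact ⟨a, ha1, ha2⟩

/-- The inclusion of a union of orbits. -/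
def incl (X : GSet G) (T : Set X.Orb) : X.sub T →[G] X := ⟨fun x => x.1, fun _ _ => rfl⟩

theorem IsCartesian.restrict {p : P →[G] X} {q : P →[G] Y} {f : X →[G] Z} {g : Y →[G] Z}
    (h : IsCartesian p q f g) (T : Set X.Orb) :
    IsCartesian (res p {u | orbMap p u ∈ T} T fun _ hu => hu) (q.comp (incl P _))
      (f.comp (incl X T)) g := by
  refine ⟨fun a => h.comm a.1, fun x y e => ?_⟩
  obtain ⟨a, ⟨ha1, ha2⟩, hu⟩ := h.lift x.1 y e
  refine ⟨⟨a, ?_⟩, ⟨Subtype.ext ha1, ha2⟩, fun b hb => Subtype.ext (hu b.1 ⟨?_, hb.2⟩)⟩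
  · change X.orb (p a) ∈ T
    rw [ha1]; exact x.2
  · exact congrArg Subtype.val hb.1

/-- Equivariant maps out of a transitive `G`-set. -/
theorem exists_map_of_stabilizer_le (hX : X.IsTransitive) (x : X) (y : Y)
    (h : MulAction.stabilizer G x ≤ MulAction.stabilizer G y) : ∃ f : X →[G] Y, f x = y := by
  have := hX.2
  choose a ha using MulAction.exists_smul_eq G x
  have key : ∀ b c : G, b • x = c • x → b • y = c • y := by
    intro b c hbc
    have : c⁻¹ * b ∈ MulAction.stabilizer G x := by
      rw [MulAction.mem_stabilizer_iff, mul_smul, hbc, inv_smul_smul]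
    have := MulAction.mem_stabilizer_iff.1 (h this)
    rwa [mul_smul, inv_smul_eq_iff] at this
  refine ⟨⟨fun z => a z • y, fun c z => ?_⟩, ?_⟩
  · change a (c • z) • y = c • a z • y
    rw [smul_smul]
    exact key _ _ (by rw [ha, mul_smul, ha])
  · change a x • y = y
    conv_rhs => rw [← one_smul G y]
    exact key _ _ (by rw [ha, one_smul])

theorem map_ext_of_transitive (hX : X.IsTransitive) {f g : X →[G] Y} (x : X) (h : f x = g x) :
    f = g := by
  have := hX.2
  ext z
  obtain ⟨a, rfl⟩ := MulAction.exists_smul_eq G x z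
  rw [f.map_smul, g.map_smul, h]

theorem surjective_of_transitive (hX : Nonempty X) (hY : Y.IsTransitive) (f : X →[G] Y) :
    Function.Surjective f := by
  have := hY.2
  intro y
  obtain ⟨x⟩ := hX
  obtain ⟨a, rfl⟩ := MulAction.exists_smul_eq G (f x) y
  exact ⟨a • x, f.map_smul a x⟩

end FiberProduct

/-! ### Sizes under bijections, injections and decompositions -/

section Size

variable {X Y Z P : GSet CantorGroup}

theorem gsize_eq_of_bijective (f : X →[CantorGroup] Y) (hf : Function.Bijective f) :
    gsize X = gsize Y := by
  rw [gsize_eq_mul_of_fibers f one_ne_zero, Nat.cast_one, one_mul]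
  intro y
  obtain ⟨x, rfl⟩ := hf.2 y
  rw [Set.ncard_eq_one]
  exact ⟨x, by ext z; exact hf.1.eq_iff⟩

open Classical in
theorem gsize_eq_sum_of_injective (i : X →[CantorGroup] Y) (hi : Function.Injective i) :
    gsize X = ∑ v with v ∈ Set.range (orbMap i), orbWeight Y v := by
  have hw : ∀ w, orbWeight X w = orbWeight Y (orbMap i w) := by
    intro w
    induction w using Quotient.inductionOn with | h x => ?_
    change orbWeight X (X.orb x) = orbWeight Y (Y.orb (i x))
    rw [orbWeight_orb, orbWeight_orb]
    congr 1
    refine le_antisymm (stabilizer_le i x) fun g hg => ?_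
    rw [MulAction.mem_stabilizer_iff, ← i.map_smul] at hg
    exact hi hg
  have hinj : Function.Injective (orbMap i) := by
    intro a b
    induction a using Quotient.inductionOn with | h a => ?_
    induction b using Quotient.inductionOn with | h b => ?_
    intro h
    obtain ⟨g, hg⟩ := orb_eq.1 (show Y.orb (i a) = Y.orb (i b) from h)
    rw [← i.map_smul] at hg
    exact orb_eq.2 ⟨g, hi hg⟩
  rw [gsize, Finset.sum_congr rfl fun w _ => hw w, ← Finset.sum_image (f := orbWeight Y)
    (g := orbMap i) (fun a _ b _ h => hinj h)]
  congr 1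
  ext v; simp

open Classical in
theorem gsize_sub (T : Set X.Orb) : gsize (X.sub T) = ∑ w with w ∈ T, orbWeight X w := by
  rw [gsize_eq_sum_of_injective (incl X T) fun _ _ h => Subtype.ext h]
  congr 1
  ext w
  simp only [Finset.mem_filter, Finset.mem_univ, true_and]
  constructor
  · rintro ⟨u, rfl⟩
    induction u using Quotient.inductionOn with | h x => ?_
    exact x.2
  · intro hw
    induction w using Quotient.inductionOn with | h x => ?_
    exact ⟨(X.sub T).orb ⟨x, hw⟩, rfl⟩

theorem gsize_eq_sum_sub (f : X →[CantorGroup] Y) :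
    gsize X = ∑ v : Y.Orb, gsize (X.sub {w | orbMap f w ∈ ({v} : Set Y.Orb)}) := by
  classical
  rw [gsize_eq_sum_fiber f]
  refine Finset.sum_congr rfl fun v _ => ?_
  rw [gsize_sub]
  exact Finset.sum_congr (by ext; simp) fun _ _ => rfl

end Size

/-! ### Permanence properties of the base change formula -/

section BaseChange

variable {X Y Z P Y' : GSet CantorGroup}

/-- The size of a base change along `g` is as expected. -/
def SizeBaseChange (f : X →[CantorGroup] Z) (g : Y →[CantorGroup] Z) : Prop :=
  ∀ {P : GSet CantorGroup} (p : P →[CantorGroup] X) (q : P →[CantorGroup] Y),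
    IsCartesian p q f g → gsize P * gsize Z = gsize X * gsize Y

theorem SizeBaseChange.of_exists {f : X →[CantorGroup] Z} {g : Y →[CantorGroup] Z}
    {p : P →[CantorGroup] X} {q : P →[CantorGroup] Y} (h : IsCartesian p q f g)
    (e : gsize P * gsize Z = gsize X * gsize Y) : SizeBaseChange f g := by
  intro P' p' q' h'
  obtain ⟨b, hb⟩ := h.exists_bijective h'
  rw [← gsize_eq_of_bijective b hb, e]

/-- The fibres of `P → X` are those of `g`, so both maps multiply the size by the same `d`. -/
theorem SizeBaseChange.of_fibers {g : Y →[CantorGroup] Z} {d : ℕ} (hd : d ≠ 0)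
    (hg : ∀ z, {y | g y = z}.ncard = d) (f : X →[CantorGroup] Z) : SizeBaseChange f g := by
  intro P p q h
  rw [gsize_eq_mul_of_fibers g hd hg, gsize_eq_mul_of_fibers p hd fun x => by
    rw [h.ncard_fiber, hg]]
  ring

theorem SizeBaseChange.of_orbits {f : X →[CantorGroup] Z} {g : Y →[CantorGroup] Z}
    (h : ∀ w : X.Orb, SizeBaseChange (f.comp (incl X {w})) g) : SizeBaseChange f g := by
  intro P p q hP
  rw [gsize_eq_sum_sub p, Finset.sum_mul,
    Finset.sum_congr rfl fun w _ => h w _ _ (hP.restrict {w}), ← Finset.sum_mul]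
  congr 1
  rw [gsize_eq_sum_sub (idt X)]
  refine Finset.sum_congr rfl fun w _ => ?_
  congr 2
  ext u
  simp [idt]

/-- Pulling the cover `π` back to `P` gives a cover of `P` of the same degree, and the non-zero
degree cancels. -/
theorem SizeBaseChange.of_cover {X' : GSet CantorGroup} {f : X →[CantorGroup] Z}
    {g : Y →[CantorGroup] Z} (π : X' →[CantorGroup] X) {d : ℕ} (hd : d ≠ 0)
    (hπ : ∀ x, {y | π y = x}.ncard = d) (h : SizeBaseChange (f.comp π) g) :
    SizeBaseChange f g := by
  intro P p q hP
  obtain ⟨P', p', q', hP'⟩ := exists_isCartesian p π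
  have h1 := h _ _ (hP.symm.paste hP').symm
  rw [gsize_eq_mul_of_fibers π hd hπ, gsize_eq_mul_of_fibers p' hd fun x => by
    rw [hP'.ncard_fiber, hπ]] at h1
  have hd' : (d : ℚ) ≠ 0 := Nat.cast_ne_zero.2 hd
  refine mul_left_cancel₀ hd' ?_
  linarith

theorem SizeBaseChange.comp {g : Y →[CantorGroup] Z} {g' : Y' →[CantorGroup] Y}
    (hY : gsize Y ≠ 0) (h : ∀ {X : GSet CantorGroup} (f : X →[CantorGroup] Z), SizeBaseChange f g)
    (h' : ∀ {X : GSet CantorGroup} (f : X →[CantorGroup] Y), SizeBaseChange f g')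
    (f : X →[CantorGroup] Z) : SizeBaseChange f (g.comp g') := by
  obtain ⟨P, p, q, hP⟩ := exists_isCartesian f g
  obtain ⟨P', p', q', hP'⟩ := exists_isCartesian q g'
  refine SizeBaseChange.of_exists (hP.paste hP') (mul_right_cancel₀ hY ?_)
  have h1 := h _ _ _ hP
  have h2 := h' _ _ _ hP'
  linear_combination gsize Z * h2 + gsize Y' * h1

/-- Cancellation by pasting squares: it lets the source of `g` be replaced by a cover `X(n)`.
Dividing by the size of `Y'` is what requires it to be non-zero. -/
theorem SizeBaseChange.of_comp {g : Y →[CantorGroup] Z} {g' : Y' →[CantorGroup] Y}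
    (hY' : gsize Y' ≠ 0)
    (h : ∀ {X : GSet CantorGroup} (f : X →[CantorGroup] Z), SizeBaseChange f (g.comp g'))
    (h' : ∀ {X : GSet CantorGroup} (f : X →[CantorGroup] Y), SizeBaseChange f g')
    (f : X →[CantorGroup] Z) : SizeBaseChange f g := by
  obtain ⟨P, p, q, hP⟩ := exists_isCartesian f g
  obtain ⟨P', p', q', hP'⟩ := exists_isCartesian q g'
  refine SizeBaseChange.of_exists hP (mul_right_cancel₀ hY' ?_)
  have h1 := h _ _ _ (hP.paste hP')
  have h2 := h' _ _ _ hP'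
  linear_combination gsize Y * h1 - gsize Z * h2

end BaseChange

/-! ### Base change: reduction to maps between the sets `X(n)` -/

theorem Coloring.orbWeight {X : GSet CantorGroup} {F : Type} (c : Coloring X F) (x : X) :
    orbWeight X (X.orb x) = -(-1) ^ (c.ran x).card := by
  rw [orbWeight_orb, c.stabilizer_eq, Cantor.weight_colorStab (c.isLocallyConstant x),
    c.ncard_range]

theorem Coloring.ran_setX (n : ℕ) (x : Oligo.setX n) :
    (Coloring.setX n).ran x = Finset.univ := by
  ext i
  rw [Coloring.mem_ran]
  exact ⟨fun _ => Finset.mem_univ _, fun _ => x.2 i⟩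

theorem gsize_setX (n : ℕ) : gsize (setX (n + 1)) = (-1) ^ n := by
  obtain ⟨x⟩ := (setX_transitive n).1
  rw [gsize_eq_of_transitive (setX_transitive n) x, (Coloring.setX (n + 1)).orbWeight,
    Coloring.ran_setX]
  simp [pow_succ]

/-- Points of `X(n)` from surjective colourings. -/
def setX.mk {n : ℕ} (φ : Cantor → Fin n) (h : IsLocallyConstant φ) (h' : Function.Surjective φ) :
    setX n := ⟨⟨φ, h.continuous⟩, h'⟩

/-- The stabilizer of a point contains that of a surjective colouring with finite index; this index
is the number of points of one fibre, and transitivity makes all fibres equinumerous. -/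
theorem exists_cover {X : GSet CantorGroup} (hX : X.IsTransitive) :
    ∃ (n : ℕ) (π : setX (n + 1) →[CantorGroup] X) (d : ℕ), d ≠ 0 ∧ ∀ x, {y | π y = x}.ncard = d := by
  obtain ⟨x⟩ := hX.1
  obtain ⟨φ, h1, h2, h3⟩ := Cantor.exists_colorStab_relIndex_ne_zero (X.smooth x)
  obtain ⟨n, ψ, h4, h5, h6⟩ := Cantor.exists_fin_coloring h1
  have e := (Coloring.setX (n + 1)).stabilizer_eq (setX.mk ψ h4 h5)
  change _ = Cantor.colorStab ψ at e
  rw [← h6, ← e] at h2 h3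
  obtain ⟨π, hπ⟩ := exists_map_of_stabilizer_le (setX_transitive n) _ x h2
  refine ⟨n, π, {y | π y = x}.ncard, ?_, fun x' => ?_⟩
  · subst hπ
    rw [relIndex_stabilizer] at h3
    have : ∀ z : setX (n + 1), (setX (n + 1)).orb z = (setX (n + 1)).orb (setX.mk ψ h4 h5) := by
      intro z
      have := (setX_transitive n).2
      exact orb_eq.2 (MulAction.exists_smul_eq _ _ _)
    simpa [this] using h3
  · have := hX.2
    obtain ⟨g, rfl⟩ := MulAction.exists_smul_eq CantorGroup x x'
    refine (Set.ncard_congr (fun z _ => g • z) ?_ ?_ ?_).symm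
    · rintro z rfl
      exact π.map_smul g z
    · intro a b _ _ h
      exact smul_left_cancel g h
    · intro z hz
      refine ⟨g⁻¹ • z, ?_, smul_inv_smul g z⟩
      rw [Set.mem_ofPred_eq, π.map_smul, show π z = g • x from hz, inv_smul_smul]

/-- The stabilizer of `x₀` fixes `f x₀`, so `f x₀` is a function of the colours of `x₀` by
`eq_of_colorStab_le`; equivariance carries the same recolouring `s` to all points. -/
theorem exists_factor_setX {a c : ℕ} (f : setX (a + 1) →[CantorGroup] setX (c + 1)) :
    ∃ s : Fin (a + 1) → Fin (c + 1), Function.Surjective s ∧ ∀ x t, (f x).1 t = s (x.1 t) := by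
  obtain ⟨x₀⟩ := (setX_transitive a).1
  have h := stabilizer_le f x₀
  rw [(Coloring.setX _).stabilizer_eq, (Coloring.setX _).stabilizer_eq] at h
  have h1 := fun t t' => Cantor.eq_of_colorStab_le ((Coloring.setX _).isLocallyConstant x₀)
    ((Coloring.setX _).isLocallyConstant (f x₀)) h (x := t) (y := t')
  choose r hr using x₀.2
  have hs : ∀ t, (f x₀).1 t = (f x₀).1 (r (x₀.1 t)) := fun t => h1 _ _ (hr _).symm
  refine ⟨fun i => (f x₀).1 (r i), fun j => ?_, fun x t => ?_⟩
  · obtain ⟨t, ht⟩ := (f x₀).2 j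
    exact ⟨x₀.1 t, (hs t).symm.trans ht⟩
  · have := (setX_transitive a).2
    obtain ⟨g, rfl⟩ := MulAction.exists_smul_eq CantorGroup x₀ x
    rw [f.map_smul]
    exact hs (g⁻¹ t)

/-- A point of the fibre product is a colouring by pairs of colours with equal images in the target.
Its orbit is the set `d` of pairs in use, and surjectivity of both components says that `d` projects
onto both factors. The sizes then match by `sum_neg_one_pow_card_fiberProduct`. -/
theorem sizeBaseChange_setX_setX {a b c : ℕ} (f : setX (a + 1) →[CantorGroup] setX (c + 1))
    (g : setX (b + 1) →[CantorGroup] setX (c + 1)) : SizeBaseChange f g := by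
  classical
  intro P p q h
  obtain ⟨s, hs, hs'⟩ := exists_factor_setX f
  obtain ⟨t, ht, ht'⟩ := exists_factor_setX g
  let C := Coloring.fiberProduct h (Coloring.setX _) (Coloring.setX _)
  have key := C.sum_orb {d | (∀ e ∈ d, s e.1 = t e.2) ∧ d.image Prod.fst = Finset.univ ∧
      d.image Prod.snd = Finset.univ} ?_ (orbWeight P) (fun d => -(-1) ^ d.card) C.orbWeight
  · have e := congrArg (Int.cast : ℤ → ℚ) (sum_neg_one_pow_card_fiberProduct s t hs ht)
    push_cast at e
    rw [gsize, key, Finset.sum_neg_distrib, e, gsize_setX, gsize_setX, gsize_setX]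
    simp only [Fintype.card_fin]
    have : ((-1 : ℚ) ^ c) ^ 2 = 1 := by rw [← pow_mul, mul_comm, pow_mul]; simp
    linear_combination (-1) ^ a * (-1) ^ b * this
  · intro d
    simp only [Finset.mem_filter, Finset.mem_univ, true_and]
    constructor
    · rintro ⟨h1, h2, h3⟩
      have hne : d.Nonempty := by
        rw [← Finset.image_nonempty (f := Prod.fst), h2]
        exact Finset.univ_nonempty
      obtain ⟨φ, hφ, hφ'⟩ := Cantor.exists_range_eq hne
      have hmem : ∀ z, φ z ∈ d := fun z => by
        rw [← Finset.mem_coe, ← hφ']; exact ⟨z, rfl⟩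
      have hsurj : ∀ e ∈ d, ∃ z, φ z = e := fun e he => by
        rw [← Finset.mem_coe, ← hφ'] at he; exact he
      obtain ⟨y, ⟨hy1, hy2⟩, -⟩ := h.lift
        (setX.mk (fun z => (φ z).1) (hφ.comp Prod.fst) fun i => by
          obtain ⟨e, he, rfl⟩ := Finset.mem_image.1 (h2 ▸ Finset.mem_univ i)
          obtain ⟨z, rfl⟩ := hsurj e he
          exact ⟨z, rfl⟩)
        (setX.mk (fun z => (φ z).2) (hφ.comp Prod.snd) fun i => by
          obtain ⟨e, he, rfl⟩ := Finset.mem_image.1 (h3 ▸ Finset.mem_univ i)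
          obtain ⟨z, rfl⟩ := hsurj e he
          exact ⟨z, rfl⟩)
        (Subtype.ext (ContinuousMap.ext fun z => by
          rw [hs', ht']; exact h1 _ (hmem z)))
      refine ⟨y, ?_⟩
      have hcol : C.col y = φ := by
        funext z
        refine Prod.ext ?_ ?_
        · exact congrArg (fun x : setX (a + 1) => x.1 z) hy1
        · exact congrArg (fun x : setX (b + 1) => x.1 z) hy2
      rw [← Finset.coe_inj, Coloring.coe_ran, hcol, hφ']
    · rintro ⟨y, rfl⟩
      refine ⟨fun e he => ?_, ?_, ?_⟩
      · obtain ⟨z, rfl⟩ := C.mem_ran.1 he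
        change s ((p y).1 z) = t ((q y).1 z)
        rw [← hs', ← ht', h.comm]
      · refine Finset.eq_univ_iff_forall.2 fun i => ?_
        obtain ⟨z, hz⟩ := (p y).2 i
        exact Finset.mem_image.2 ⟨_, C.mem_ran.2 ⟨z, rfl⟩, hz⟩
      · refine Finset.eq_univ_iff_forall.2 fun i => ?_
        obtain ⟨z, hz⟩ := (q y).2 i
        exact Finset.mem_image.2 ⟨_, C.mem_ran.2 ⟨z, rfl⟩, hz⟩

theorem sizeBaseChange_setX {b c : ℕ} (g : setX (b + 1) →[CantorGroup] setX (c + 1))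
    {X : GSet CantorGroup} (f : X →[CantorGroup] setX (c + 1)) : SizeBaseChange f g := by
  refine SizeBaseChange.of_orbits fun w => ?_
  obtain ⟨a, π, d, hd, hπ⟩ := exists_cover (sub_singleton_transitive X w)
  exact SizeBaseChange.of_cover π hd hπ (sizeBaseChange_setX_setX _ g)

/-- `g` factors through a finite cover `π : X(c) → Z`. Indeed, for `y` above `g x`, the stabilizer
of `y` has finite index in that of `g x`, hence finite relative index in that of `x`, and by
`colorStab_le_of_relIndex_ne_zero` it contains the stabilizer of `x`. The formula holds for `π`
because its fibres are finite of constant size, and for the lift because it is a map between sets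
`X(n)`. -/
theorem sizeBaseChange_of_setX {b : ℕ} {Z : GSet CantorGroup} (hZ : Z.IsTransitive)
    (g : setX (b + 1) →[CantorGroup] Z) {X : GSet CantorGroup} (f : X →[CantorGroup] Z) :
    SizeBaseChange f g := by
  obtain ⟨c, π, d, hd, hπ⟩ := exists_cover hZ
  obtain ⟨x⟩ := (setX_transitive b).1
  obtain ⟨y, hy⟩ := surjective_of_transitive (setX_transitive c).1 hZ π (g x)
  have h1 := relIndex_stabilizer π y
  have hfin : {z | π z = π y}.Finite := Set.finite_of_ncard_ne_zero (by rw [hπ]; exact hd)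
  have h2 : (MulAction.stabilizer CantorGroup y).relIndex
      (MulAction.stabilizer CantorGroup (π y)) ≠ 0 := by
    rw [h1]
    exact Set.ncard_ne_zero_of_mem (a := y) ⟨rfl, rfl⟩
      (hfin.subset fun z hz => hz.1)
  rw [hy] at h2
  have h3 : MulAction.stabilizer CantorGroup x ≤ MulAction.stabilizer CantorGroup y := by
    have h4 := fun h0 => h2 (Subgroup.relIndex_eq_zero_of_le_right (stabilizer_le g x) h0)
    rw [(Coloring.setX _).stabilizer_eq, (Coloring.setX _).stabilizer_eq] at h4 ⊢
    exact Cantor.colorStab_le_of_relIndex_ne_zero ((Coloring.setX _).isLocallyConstant x)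
      ((Coloring.setX _).isLocallyConstant y) h4
  obtain ⟨g', hg'⟩ := exists_map_of_stabilizer_le (setX_transitive b) x y h3
  have e : g = π.comp g' := map_ext_of_transitive (setX_transitive b) x
    (by rw [← hy, ← hg']; rfl)
  have h5 : ∀ f : X →[CantorGroup] Z, SizeBaseChange f (π.comp g') :=
    SizeBaseChange.comp (gsize_ne_zero (setX_transitive c))
      (SizeBaseChange.of_fibers hd hπ) (sizeBaseChange_setX g')
  subst e
  intro P p q h
  exact h5 f p q h

/-- A cover `π : X(b) → Y` settles the general case, since `sizeBaseChange_of_setX` applies both to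
`π` and to `g ∘ π`. -/
theorem sizeBaseChange {X Y Z : GSet CantorGroup} (hY : Y.IsTransitive) (hZ : Z.IsTransitive)
    (f : X →[CantorGroup] Z) (g : Y →[CantorGroup] Z) : SizeBaseChange f g := by
  obtain ⟨b, π, -⟩ := exists_cover hY
  exact SizeBaseChange.of_comp (gsize_ne_zero (setX_transitive b))
    (sizeBaseChange_of_setX hZ _) (sizeBaseChange_of_setX hY π) f

/-! ### Construction of the measure -/

theorem gsize_eq_add {X₁ X₂ X : GSet CantorGroup} (i₁ : X₁ →[CantorGroup] X)
    (i₂ : X₂ →[CantorGroup] X) (h₁ : Function.Injective i₁) (h₂ : Function.Injective i₂)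
    (h : IsCompl (Set.range i₁) (Set.range i₂)) : gsize X = gsize X₁ + gsize X₂ := by
  classical
  rw [gsize_eq_sum_of_injective i₁ h₁, gsize_eq_sum_of_injective i₂ h₂, gsize,
    ← Finset.sum_filter_add_sum_filter_not _ (fun v => v ∈ Set.range (orbMap i₁))]
  congr 1
  refine Finset.sum_congr (Finset.filter_congr fun v _ => ?_) fun _ _ => rfl
  have hr : ∀ {W : GSet CantorGroup} (i : W →[CantorGroup] X) (x : X),
      X.orb x ∈ Set.range (orbMap i) ↔ x ∈ Set.range i := by
    intro W i x
    constructor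
    · rintro ⟨w, hw⟩
      induction w using Quotient.inductionOn with | h w => ?_
      obtain ⟨g, hg⟩ := orb_eq.1 (Eq.symm hw : X.orb x = X.orb (i w))
      exact ⟨g • w, by rw [i.map_smul, hg]⟩
    · rintro ⟨w, rfl⟩
      exact ⟨W.orb w, rfl⟩
  induction v using Quotient.inductionOn with | h x => ?_
  rw [hr i₁ x, hr i₂ x, ← h.compl_eq, Set.mem_compl_iff]

/-- The measure `ν`. -/
def nu : Measure CantorGroup ℚ where
  val {X Y} _ _ := gsize X / gsize Y
  iso f hY h := by rw [gsize_eq_of_bijective f h, div_self (gsize_ne_zero hY)]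
  add i₁ i₂ f hY h₁ h₂ h := by rw [gsize_eq_add i₁ i₂ h₁ h₂ h, add_div]
  comp f g hY hZ := by
    have := gsize_ne_zero hY
    have := gsize_ne_zero hZ
    field_simp
  baseChange p f' f g hY hY' h := by
    have h1 := gsize_ne_zero hY
    have h2 := gsize_ne_zero hY'
    rw [div_eq_div_iff h2 h1]
    exact sizeBaseChange hY' hY f g p f' h

theorem gsize_one : gsize (one : GSet CantorGroup) = 1 := by
  have h := gsize_eq_of_bijective (X := setX 1) (Y := one) (pt _) ⟨fun x y _ => ?_, fun _ => ?_⟩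
  · rw [← h, gsize_setX, pow_zero]
  · exact Subtype.ext (ContinuousMap.ext fun t => Subsingleton.elim _ _)
  · exact ⟨(setX_transitive 0).1.some, rfl⟩

theorem isNu_nu : IsNu nu where
  regular _ hY hX := (div_ne_zero (gsize_ne_zero hX) (gsize_ne_zero hY)).isUnit
  size_setX n := by
    change gsize (setX (n + 1)) / gsize one = _
    rw [gsize_setX, gsize_one, div_one]

/-! ### The trace of a matrix as the integral of its diagonal -/

section Trace

variable {G : Type} [Group G] [TopologicalSpace G] [RoelckePrecompact G] {k : Type w} [CommRing k]
  (μ : Measure G k)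

theorem push_sub {X Y : GSet G} (f : X →[G] Y) (φ ψ : Fn k X) :
    push μ f (φ - ψ) = push μ f φ - push μ f ψ := by
  rw [eq_sub_iff_add_eq, ← push_add, sub_add_cancel]

/-- The categorical trace of a matrix is the integral over its diagonal. -/
theorem Perm.catTrace_eq (X : GSet G) (A : Mat k X X) :
    catTrace (vec X : Perm μ) (X := vec X) A =
      push μ (pair (pt X) (pt X)) (pull (pair (idt X) (idt X)) A) := by
  have he : ind k (pair (pt X) (pair (idt X) (idt X))) = push μ _ 1 :=
    (push_one_of_injective μ _
      (fun _ _ h => (congrArg (fun p : one.prod (X.prod X) => p.2.1) h :))).symm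
  have hc : ind k (pair (pair (idt X) (idt X)) (pt X)) = push μ _ 1 :=
    (push_one_of_injective μ _
      (fun _ _ h => (congrArg (fun p : (X.prod X).prod one => p.1.1) h :))).symm
  have h1 : IsCartesian (pair (idt X) (idt X)) (idt X)
      (pair snd fst : X.prod X →[G] X.prod X) (pair (idt X) (idt X)) := by
    refine ⟨fun _ => rfl, ?_⟩
    rintro ⟨x, y⟩ z e
    have e1 : y = z := (congrArg Prod.fst e :)
    have e2 : x = z := (congrArg Prod.snd e :)
    subst e1 e2
    exact ⟨x, ⟨rfl, rfl⟩, fun b hb => hb.2⟩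
  have h2 : IsCartesian (pair fst (pair snd snd) : X.prod X →[G] X.prod (X.prod X))
      (pair (pt (X.prod X)) snd : X.prod X →[G] one.prod X)
      (pair ((pt X).comp fst) snd : X.prod (X.prod X) →[G] one.prod (X.prod X))
      (pair fst ((pair (idt X) (idt X)).comp snd)) := by
    refine ⟨fun _ => rfl, ?_⟩
    rintro ⟨x, y, z⟩ ⟨u, s⟩ e
    have e1 : y = s := (congrArg (fun p : one.prod (X.prod X) => p.2.1) e :)
    have e2 : z = s := (congrArg (fun p : one.prod (X.prod X) => p.2.2) e :)
    subst e1 e2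
    exact ⟨(x, z), ⟨rfl, rfl⟩, fun b hb => Prod.ext (congrArg (fun p : X.prod (X.prod X) => p.1) hb.1 :)
      (congrArg (fun p : X.prod (X.prod X) => p.2.1) hb.1 :)⟩
  -- The braiding disappears because the diagonal is symmetric.
  have h3 : mul μ (ind k (pair (pt X) (pair (idt X) (idt X))))
      (graph k (pair snd fst : X.prod X →[G] X.prod X)) =
      push μ (pair (pt X) (pair (idt X) (idt X))) 1 := by
    rw [he, graph_eq_push μ, span_mul_span μ h1]
    rfl
  -- At `((x, x), (z, z))` the matrix `A ⊗ 1` takes the value `A (x, z)` times the indicator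
  -- function of `x = z`, so only diagonal entries are integrated.
  have h4 : pull (pair fst (pair snd snd) : X.prod X →[G] X.prod (X.prod X))
      (pull (pair ((pair (idt X) (idt X)).comp fst) snd) (kron A (graph k (idt X)))) =
      A * graph k (idt X) := by
    simp only [kron, pull_mul, pull_comp]
    congr 1
    · exact pull_id A
    · exact pull_id _
  change mul μ (Z := one) (Y := X.prod X) (X := one) (mul μ (Z := one) (Y := X.prod X)
    (X := X.prod X) (mul μ (ind k (pair (pt X) (pair (idt X) (idt X)))) (graph k (pair snd fst)))
    (kron A (graph k (idt X)))) (ind k (pair (pair (idt X) (idt X)) (pt X))) = _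
  rw [h3, hc, span_mul, mul_span, pull_push μ h2, h4, graph_eq_push μ, ← push_pull_mul, mul_one,
    push_comp, push_comp]
  rfl

end Trace

/-! ### Push-forward for measures with the prescribed values on `X(n)` -/

namespace Measure

variable {G : Type} [Group G] [TopologicalSpace G] {k : Type w} [CommRing k] (μ : Measure G k)

theorem size_eq_mul {X Y : GSet G} (f : X →[G] Y) (hY : Y.IsTransitive) :
    μ.size X = μ.size Y * μ.val f hY :=
  μ.comp f (⟨fun _ => (), fun _ _ => rfl⟩ : Y →[G] (one : GSet G)) hY
    ⟨⟨()⟩, ⟨fun _ _ => ⟨1, rfl⟩⟩⟩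

theorem size_map {k' : Type*} [CommRing k'] (φ : k →+* k') (X : GSet G) :
    (μ.map φ).size X = φ (μ.size X) := rfl

end Measure

namespace Coloring

variable {k : Type w} [CommRing k] {X Y Z : GSet CantorGroup} {F F' F'' : Type}

/-- The orbit of a colouring with `m` colours is isomorphic to `X(m)`: the stabilizers agree, which
gives equivariant maps both ways, mutually inverse by transitivity. -/
theorem size_sub_orb {μ : Measure CantorGroup k} (hμ : ∀ n, μ.size (Oligo.setX (n + 1)) = (-1) ^ n)
    (c : Coloring X F) (x : X) : μ.size (X.sub {X.orb x}) = -(-1) ^ (c.ran x).card := by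
  obtain ⟨n, ψ, h1, h2, h3⟩ := Cantor.exists_fin_coloring (c.isLocallyConstant x)
  have e := Cantor.ncard_range_eq_of_colorStab_eq h1 (c.isLocallyConstant x) h3
  rw [c.ncard_range, h2.range_eq, Set.ncard_univ, Nat.card_eq_fintype_card, Fintype.card_fin] at e
  let x' : X.sub {X.orb x} := ⟨x, rfl⟩
  let y : Oligo.setX (n + 1) := setX.mk ψ h1 h2
  have hx : MulAction.stabilizer CantorGroup x' = MulAction.stabilizer CantorGroup y := by
    refine Eq.trans ?_ ((c.stabilizer_eq x).trans (h3.symm.trans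
      ((Coloring.setX (n + 1)).stabilizer_eq y).symm))
    ext g
    exact Subtype.ext_iff
  have hX := sub_singleton_transitive X (X.orb x)
  obtain ⟨f, hf⟩ := exists_map_of_stabilizer_le hX x' y hx.le
  obtain ⟨f', hf'⟩ := exists_map_of_stabilizer_le (setX_transitive n) y x' hx.ge
  have h4 : f'.comp f = idt _ := map_ext_of_transitive hX x' (by
    change f' (f x') = x'
    rw [hf, hf'])
  have h5 : f.comp f' = idt _ := map_ext_of_transitive (setX_transitive n) y (by
    change f (f' y) = y
    rw [hf', hf])
  have hb : Function.Bijective f := Function.bijective_iff_has_inverse.2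
    ⟨f', fun z => DFunLike.congr_fun h4 z, fun z => DFunLike.congr_fun h5 z⟩
  rw [μ.size_eq_mul f (setX_transitive n), μ.iso f _ hb, hμ, ← e, pow_succ]
  ring

/-- Sizes of orbits are signs, hence units, so multiplicativity of the measure along orbit → image →
point determines the value. Any measure with the given sizes can thus be computed with, without
comparing it to `nu`. -/
theorem orbVal_eq {μ : Measure CantorGroup k} (hμ : ∀ n, μ.size (Oligo.setX (n + 1)) = (-1) ^ n)
    (c : Coloring X F) (c' : Coloring Y F') (f : X →[CantorGroup] Y) (x : X) :
    μ.orbVal f (X.orb x) = (-1) ^ (c'.ran (f x)).card * (-1) ^ (c.ran x).card := by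
  have h := μ.size_eq_mul (res f {X.orb x} {orbMap f (X.orb x)} (by rintro _ rfl; rfl))
    (sub_singleton_transitive _ _)
  have h0 : μ.size (Y.sub {orbMap f (X.orb x)}) = -(-1) ^ (c'.ran (f x)).card :=
    c'.size_sub_orb hμ (f x)
  rw [c.size_sub_orb hμ, h0] at h
  change _ = _ * μ.orbVal f (X.orb x) at h
  have h1 : ((-1 : k) ^ (c'.ran (f x)).card) * (-1) ^ (c'.ran (f x)).card = 1 := by
    rw [← pow_add, Even.neg_one_pow ⟨_, rfl⟩]
  linear_combination ((-1 : k) ^ (c'.ran (f x)).card) * h - μ.orbVal f (X.orb x) * h1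

variable [DecidableEq F] [DecidableEq F']

/-- The indicator function of the points whose colours all lie in `T`. -/
def indicator (k : Type w) [CommRing k] (c : Coloring X F) (T : Finset F) : Fn k X :=
  fun w => if c.ran w.out ⊆ T then 1 else 0

theorem indicator_orb (c : Coloring X F) (T : Finset F) (x : X) :
    c.indicator k T (X.orb x) = if c.ran x ⊆ T then 1 else 0 := by
  rw [indicator, c.orb_eq_iff.1 (Quotient.out_eq (X.orb x))]

theorem indicator_univ [Fintype F] (c : Coloring X F) : c.indicator k Finset.univ = 1 := by
  ext w; simp [indicator]

theorem indicator_mul (c : Coloring X F) (S T : Finset F) :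
    c.indicator k S * c.indicator k T = c.indicator k (S ∩ T) := by
  ext w
  simp only [Pi.mul_apply, indicator, Finset.subset_inter_iff, ite_and]
  split_ifs <;> simp

theorem ran_map {c : Coloring X F} {c' : Coloring Y F'} {f : X →[CantorGroup] Y} {p : F → F'}
    (h : ∀ x t, c'.col (f x) t = p (c.col x t)) (x : X) : c'.ran (f x) = (c.ran x).image p := by
  ext i
  rw [mem_ran, Finset.mem_image]
  constructor
  · rintro ⟨t, rfl⟩
    exact ⟨_, c.mem_ran.2 ⟨t, rfl⟩, (h x t).symm⟩
  · rintro ⟨e, he, rfl⟩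
    obtain ⟨t, rfl⟩ := c.mem_ran.1 he
    exact ⟨t, h x t⟩

theorem pull_indicator [Fintype F] {c : Coloring X F} {c' : Coloring Y F'}
    {f : X →[CantorGroup] Y} {p : F → F'} (h : ∀ x t, c'.col (f x) t = p (c.col x t))
    (T : Finset F') : pull f (c'.indicator k T) = c.indicator k {e | p e ∈ T} := by
  ext w
  induction w using Quotient.inductionOn with | h x => ?_
  change c'.indicator k T (Y.orb (f x)) = c.indicator k _ (X.orb x)
  rw [indicator_orb, indicator_orb, ran_map h]
  simp [Finset.subset_iff]

/-- The push-forward of an indicator function along a map that forgets part of the colouring. -/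
theorem push_indicator [Fintype F] {μ : Measure CantorGroup k}
    (hμ : ∀ n, μ.size (Oligo.setX (n + 1)) = (-1) ^ n) {c : Coloring X F} {c' : Coloring Y F'}
    {f : X →[CantorGroup] Y} {p : F → F'} (h : ∀ x t, c'.col (f x) t = p (c.col x t))
    (hc : ∀ d : Finset F, d.Nonempty → ∃ x, c.ran x = d) (T : Finset F) :
    push μ f (c.indicator k T) = c'.indicator k (T.image p) := by
  classical
  ext v
  induction v using Quotient.inductionOn with | h y => ?_
  change push μ f _ (Y.orb y) = c'.indicator k _ (Y.orb y)
  rw [indicator_orb, push_apply, Finset.sum_filter]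
  set S := c'.ran y
  -- The orbits above that of `y` are the non-empty sets `d` of colours with image `S`, and by `hc`
  -- all of these occur.
  rw [c.sum_orb {d : Finset F | d.Nonempty} (fun d => ?_) _ (fun d => if d.image p = S then
      (-1) ^ S.card * (-1) ^ d.card * (if d ⊆ T then 1 else 0) else 0) fun x => ?_]
  · have key := congrArg (Int.cast : ℤ → k) (sum_neg_one_pow_card_image_eq p T S)
    rw [Finset.sum_filter] at key
    push_cast at key
    have e : ∀ d : Finset F, (if d.image p = S then
        (-1) ^ S.card * (-1) ^ d.card * (if d ⊆ T then 1 else 0) else 0 : k) =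
        (-1) ^ S.card * if d ⊆ T then if d.image p = S then (-1) ^ d.card else 0 else 0 := by
      intro d; split_ifs <;> simp
    -- The empty `d` may be included: its image is empty, whereas `S` is not.
    rw [Finset.sum_congr rfl fun d _ => e d, ← Finset.mul_sum, Finset.sum_filter_of_ne,
      ← Finset.sum_filter]
    · rw [show Finset.univ.filter (· ⊆ T) = T.powerset by ext; simp, key]
      split_ifs
      · rw [← pow_add, Even.neg_one_pow ⟨_, rfl⟩]
      · rw [mul_zero]
    · intro d _ hd
      have hS : d.image p = S := by
        by_contra h0
        simp [h0] at hd
      rw [← Finset.image_nonempty (f := p), hS]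
      exact c'.ran_nonempty y
  · rw [Finset.mem_filter]
    exact ⟨fun h => hc d h.2, fun ⟨x, hx⟩ => ⟨Finset.mem_univ _, hx ▸ c.ran_nonempty x⟩⟩
  · have h1 : orbMap f (X.orb x) = Y.orb y ↔ (c.ran x).image p = S := by
      rw [orbMap_orb, c'.orb_eq_iff, ran_map h]
    change (if orbMap f (X.orb x) = Y.orb y then μ.orbVal f (X.orb x) * c.indicator k T (X.orb x)
      else 0) = _
    by_cases h2 : (c.ran x).image p = S
    · rw [if_pos (h1.2 h2), if_pos h2, orbVal_eq hμ c c', indicator_orb, ran_map h, h2]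
    · rw [if_neg (fun h0 => h2 (h1.1 h0)), if_neg h2]

/-- A `G`-set with at most one point has a colouring with one colour. -/
def ofSubsingleton (X : GSet CantorGroup) [Subsingleton X] : Coloring X Unit where
  col _ _ := ()
  isLocallyConstant _ := IsLocallyConstant.const ()
  col_smul _ _ _ := rfl
  injective _ _ _ := Subsingleton.elim _ _

theorem exists_ran_eq_of_surjective {c : Coloring X F}
    (hc : ∀ φ, IsLocallyConstant φ → ∃ x, c.col x = φ) (d : Finset F) (hd : d.Nonempty) :
    ∃ x, c.ran x = d := by
  obtain ⟨φ, h1, h2⟩ := Cantor.exists_range_eq hd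
  obtain ⟨x, rfl⟩ := hc φ h1
  exact ⟨x, by rw [← Finset.coe_inj, coe_ran, h2]⟩

theorem setY_surjective (n : ℕ) (φ : Cantor → Fin n) (hφ : IsLocallyConstant φ) :
    ∃ x, (Coloring.setY n).col x = φ :=
  ⟨(⟨φ, hφ.continuous⟩ : C(Cantor, Fin n)), rfl⟩

theorem prod_surjective {c : Coloring X F} {c' : Coloring Y F'}
    (hc : ∀ φ, IsLocallyConstant φ → ∃ x, c.col x = φ)
    (hc' : ∀ φ, IsLocallyConstant φ → ∃ x, c'.col x = φ) (φ : Cantor → F × F')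
    (hφ : IsLocallyConstant φ) : ∃ x, (c.prod c').col x = φ := by
  obtain ⟨x, hx⟩ := hc _ (hφ.comp Prod.fst)
  obtain ⟨y, hy⟩ := hc' _ (hφ.comp Prod.snd)
  exact ⟨(x, y), funext fun t => Prod.ext (congrFun hx t) (congrFun hy t)⟩

end Coloring

/-! ### A nilpotent endomorphism of trace `-1` -/

section Nilpotent

variable {k : Type w} [CommRing k]

/-- The pairs of colourings with three colours that differ at every point, minus all pairs. -/
def nilMat (k : Type w) [CommRing k] : Mat k (setY 3) (setY 3) :=
  ((Coloring.setY 3).prod (Coloring.setY 3)).indicator k {e | e.1 ≠ e.2} - 1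

/-- The product expands into four indicator functions on triples of colourings. Each is pushed
forward to the constant `1`, because each of the four relations on triples of colours projects onto
all pairs of outer colours. The signs `1 - 1 - (1 - 1)` then cancel. -/
theorem nilMat_mul_nilMat {μ : Measure CantorGroup k}
    (hμ : ∀ n, μ.size (setX (n + 1)) = (-1) ^ n) : mul μ (nilMat k) (nilMat k) = 0 := by
  let c := Coloring.setY 3
  let C := c.prod (c.prod c)
  have hC : ∀ d : Finset (Fin 3 × Fin 3 × Fin 3), d.Nonempty → ∃ x, C.ran x = d :=
    Coloring.exists_ran_eq_of_surjective (Coloring.prod_surjective (Coloring.setY_surjective 3)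
      (Coloring.prod_surjective (Coloring.setY_surjective 3) (Coloring.setY_surjective 3)))
  let π : (setY 3).prod ((setY 3).prod (setY 3)) →[CantorGroup] (setY 3).prod (setY 3) :=
    pair fst (snd.comp snd)
  have hπ : ∀ T : Finset (Fin 3 × Fin 3 × Fin 3), T.image (fun e => (e.1, e.2.2)) = Finset.univ →
      push μ π (C.indicator k T) = 1 := by
    intro T hT
    rw [Coloring.push_indicator hμ (c' := c.prod c) (p := fun e => (e.1, e.2.2))
      (fun _ _ => rfl) hC, hT, Coloring.indicator_univ]
  have h1 : pull (pair fst (fst.comp snd)) (nilMat k) =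
      C.indicator k {e | e.1 ≠ e.2.1} - 1 := by
    change pull _ ((c.prod c).indicator k _) - 1 = _
    rw [Coloring.pull_indicator (c := C) (p := fun e => (e.1, e.2.1)) (fun _ _ => rfl)]
    simp
  have h2 : pull snd (nilMat k) = C.indicator k {e | e.2.1 ≠ e.2.2} - 1 := by
    change pull _ ((c.prod c).indicator k _) - 1 = _
    rw [Coloring.pull_indicator (c := C) (p := fun e => e.2) (fun _ _ => rfl)]
    simp
  have h3 : pull (pair fst (fst.comp snd)) (nilMat k) * pull snd (nilMat k) =
      (C.indicator k (({e | e.1 ≠ e.2.1} : Finset (Fin 3 × Fin 3 × Fin 3)) ∩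
        ({e | e.2.1 ≠ e.2.2} : Finset (Fin 3 × Fin 3 × Fin 3))) -
          C.indicator k {e | e.1 ≠ e.2.1}) -
        (C.indicator k {e | e.2.1 ≠ e.2.2} - C.indicator k Finset.univ) := by
    rw [h1, h2, ← Coloring.indicator_mul, Coloring.indicator_univ]
    ring
  -- Of the four finite checks, the first uses that there are three colours: for any two outer
  -- colours there is a middle one different from both.
  rw [mul, h3, push_sub, push_sub, push_sub, hπ _ (by decide), hπ _ (by decide), hπ _ (by decide),
    hπ _ (by decide)]
  simp

/-- On the diagonal, "different at every point" allows no colour at all, so it restricts to the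
indicator function of the empty set of colours, which is zero. The constant `1` is pushed forward to
`1`. The trace is therefore `0 - 1`. -/
theorem catTrace_nilMat_ne_zero [Nontrivial k] {μ : Measure CantorGroup k}
    (hμ : ∀ n, μ.size (setX (n + 1)) = (-1) ^ n) :
    catTrace (Perm.vec (setY 3) : Perm μ) (X := Perm.vec (setY 3)) (nilMat k) ≠ 0 := by
  rw [Perm.catTrace_eq]
  let c := Coloring.setY 3
  have h1 : pull (pair (idt (setY 3)) (idt (setY 3))) (nilMat k) =
      c.indicator k ∅ - c.indicator k Finset.univ := by
    change pull _ ((c.prod c).indicator k _) - 1 = _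
    rw [Coloring.pull_indicator (c := c) (p := fun e => (e, e)) (fun _ _ => rfl),
      Coloring.indicator_univ]
    simp
  have : Subsingleton ((one : GSet CantorGroup).prod one) :=
    inferInstanceAs (Subsingleton (Unit × Unit))
  let c' := Coloring.ofSubsingleton ((one : GSet CantorGroup).prod one)
  have h2 := fun T => Coloring.push_indicator hμ (c := c) (c' := c') (f := pair (pt _) (pt _))
    (p := fun _ => ()) (fun _ _ => rfl)
    (Coloring.exists_ran_eq_of_surjective (Coloring.setY_surjective 3)) T
  rw [h1, push_sub, h2, h2]
  intro h
  let z : (one : GSet CantorGroup).prod one := ((() : Unit), (() : Unit))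
  have h3 := congrFun h (GSet.orb _ z)
  rw [Pi.sub_apply, Coloring.indicator_orb, Coloring.indicator_orb, if_neg, if_pos] at h3
  · have h4 : (0 : k) - 1 = 0 := h3
    simp at h4
  · exact fun u _ => by simp
  · rw [Finset.image_empty, Finset.subset_empty]
    exact (c'.ran_nonempty _).ne_empty

end Nilpotent

end Oligo

end

theorem mainTheorem6 :
    (∃ ν : Oligo.Measure Oligo.CantorGroup ℚ, Oligo.IsNu ν) ∧
    ∀ ν : Oligo.Measure Oligo.CantorGroup ℚ, Oligo.IsNu ν →
      ∀ (k : Type w) [Field k] [CharZero k],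
        (∃ f : End (Oligo.Perm.vec (Oligo.setY 3) : Oligo.Perm (ν.map (Rat.castHom k))),
          IsNilpotent f ∧ Oligo.catTrace (Oligo.Perm.vec (Oligo.setY 3)) f ≠ 0) ∧
        ¬ Oligo.IsSemisimpleCategory
          (Idempotents.Karoubi (Oligo.Perm (ν.map (Rat.castHom k)))) ∧
        ∀ (T : Type u) [Category.{v} T] [Abelian T] [Linear k T] [MonoidalCategory T]
          [SymmetricCategory T] [MonoidalPreadditive T] [MonoidalLinear k T],
          Oligo.IsPreTannakian k T →
          ¬ ∃ F : Oligo.Perm (ν.map (Rat.castHom k)) ⥤ T,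
            Nonempty F.Braided ∧ F.Additive ∧ F.Linear k ∧ F.Faithful := by
  refine ⟨⟨Oligo.nu, Oligo.isNu_nu⟩, fun ν hν k _ _ => ?_⟩
  have hμ : ∀ n, (ν.map (Rat.castHom k)).size (Oligo.setX (n + 1)) = (-1) ^ n := fun n => by
    rw [Oligo.Measure.size_map, hν.size_setX]; simp
  let f : End (Oligo.Perm.vec (Oligo.setY 3) : Oligo.Perm (ν.map (Rat.castHom k))) :=
    Oligo.nilMat k
  have hf : IsNilpotent f := ⟨2, (pow_two f).trans (Oligo.nilMat_mul_nilMat hμ)⟩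
  have ht : Oligo.catTrace (Oligo.Perm.vec (Oligo.setY 3)) f ≠ 0 :=
    Oligo.catTrace_nilMat_ne_zero hμ
  exact ⟨⟨f, hf, ht⟩, Oligo.Perm.not_isSemisimpleCategory_karoubi f hf ht,
    fun T _ _ _ _ _ _ _ hT => Oligo.Perm.not_exists_faithful_preTannakian f hf ht T hT⟩
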